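/- Let $K$ be a field and let $A$ be a finite-dimensional connected $K$-algebra (i.e. $A\neq 0$ and $0,1$ are the only central idempotents of $A$). Modules are finite-dimensional left modules; $D=\mathrm{Hom}_K(-,K)$ is the standard duality between left and right modules (equivalently, between modules over $A$ and over $A^{op}$), $\mathrm{Tr}$ is the transpose (the cokernel of $\mathrm{Hom}_A(P_0,A)\to \mathrm{Hom}_A(P_1,A)$ for a minimal projective presentation $P_1\to P_0\to M\to 0$), and $\tau=D\,\mathrm{Tr}$. An $A$-module $M$ is Gorenstein projective if $\mathrm{Ext}_A^i(M,A)=0$ and $\mathrm{Ext}_{A^{op}}^i(\mathrm{Tr}\,M,A)=0$ for all $i\ge 1$; it is Gorenstein injective if $D(M)$ is Gorenstein projective over $A^{op}$; it is Gorenstein projective-injective if it is both. $A$ is CM-finite if there are only finitely many indecomposable Gorenstein projective $A$-modules up to isomorphism. The dominant dimension of $A$ is at least $2$ if the first two terms $I_0,I_1$ of a minimal injective resolution of the regular module $A$ are projective. $A$ is gendo-symmetric if it has dominant dimension at least $2$ and, for an idempotent $e$ such that $Ae$ is the minimal faithful projective-injective module, $Ae\cong D(eA)$ as $(A,eAe)$-bimodules.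 The Auslander–Reiten quiver of $A$ has as vertices the isomorphism classes of indecomposable modules and an arrow $[X]\to[Y]$ whenever there is an irreducible morphism $X\to Y$; an Auslander–Reiten component is a connected component of it. A stable Auslander–Reiten component is a connected component of the stable Auslander–Reiten quiver, the full subquiver on those vertices whose $\tau$-orbit contains no projective and no injective module. Assume that $A$ is gendo-symmetric and not selfinjective. Then: 1. If an Auslander–Reiten component of $A$ contains a nonprojective Gorenstein projective-injective module, then all modules in this component are Gorenstein projective-injective. Moreover, the set of (isomorphism classes of) indecomposable nonprojective Gorenstein projective-injective $A$-modules is a union of stable Auslander–Reiten components of $A$. 2. If $A$ is CM-finite, then every Gorenstein projective-injective $A$-module is projective. -/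

import Mathlib

open CategoryTheory

universe u

namespace FinDimAlg

noncomputable section

/-! Throughout, `A` is a finite-dimensional algebra over a field `K`, and `A`-modules are left
modules, as objects of `ModuleCat A`; the right `A`-modules are the objects of `ModuleCat Aᵐᵒᵖ`.
Finite-dimensionality of a module `M` is `Module.Finite A M`. -/

section Dual

variable (K : Type u) [Field K] {R : Type u} [Ring R] [Algebra K R]

open scoped ModuleCat in
/-- The `R`-action from the other side on `Hom_K(M, K)`: `(φ r)(m) = φ (r m)`. -/
@[reducible]
def dualModule (M : ModuleCat.{u} R) : Module Rᵐᵒᵖ (M →ₗ[K] K) where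
  smul r φ := φ ∘ₗ Algebra.lsmul K K M r.unop
  one_smul φ := LinearMap.ext fun m => congrArg φ (one_smul R m)
  mul_smul r s φ := LinearMap.ext fun m => congrArg φ (mul_smul s.unop r.unop m)
  smul_zero _ := rfl
  smul_add _ _ _ := rfl
  add_smul r s φ := LinearMap.ext fun m =>
    (congrArg φ (add_smul r.unop s.unop m)).trans (map_add φ _ _)
  zero_smul φ := LinearMap.ext fun m => (congrArg φ (zero_smul R m)).trans (map_zero φ)

open scoped ModuleCat in
/-- The duality `D = Hom_K(-, K)` (on objects) from left to right modules. -/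
def D (M : ModuleCat.{u} R) : ModuleCat.{u} Rᵐᵒᵖ :=
  letI := dualModule K M
  ModuleCat.of Rᵐᵒᵖ (M →ₗ[K] K)

end Dual

section Ring

variable {R : Type u} [Ring R]

/-- The submodule `N` of `M` is superfluous. -/
def IsSuperfluous {M : Type u} [AddCommGroup M] [Module R M] (N : Submodule R M) : Prop :=
  ∀ L : Submodule R M, N ⊔ L = ⊤ → L = ⊤

/-- The submodule `N` of `M` is essential. -/
def IsEssential {M : Type u} [AddCommGroup M] [Module R M] (N : Submodule R M) : Prop :=
  ∀ L : Submodule R M, N ⊓ L = ⊥ → L = ⊥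

/-- `ι : M ⟶ I` is an injective envelope. -/
structure IsInjectiveEnvelope {M I : ModuleCat.{u} R} (ι : M ⟶ I) : Prop where
  injective : Module.Injective R I
  mono : Function.Injective ι.hom
  essential : IsEssential (LinearMap.range ι.hom)

/-- `n ≤ domdim M`: the first `n` terms `I₀, …, Iₙ₋₁` of a minimal injective resolution of `M`
are projective. -/
def DomDimAtLeast : ℕ → ModuleCat.{u} R → Prop
  | 0, _ => True
  | n + 1, M => ∃ (I : ModuleCat.{u} R) (ι : M ⟶ I), IsInjectiveEnvelope ι ∧
      Module.Projective R I ∧ DomDimAtLeast n (ModuleCat.of R (I ⧸ LinearMap.range ι.hom))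

/-- A minimal projective presentation `P₁ ⟶ P₀ ⟶ M ⟶ 0`. -/
structure MinProjPresentation (M : ModuleCat.{u} R) where
  P₁ : ModuleCat.{u} R
  P₀ : ModuleCat.{u} R
  d : P₁ ⟶ P₀
  π : P₀ ⟶ M
  projective₁ : Module.Projective R P₁
  projective₀ : Module.Projective R P₀
  surjective : Function.Surjective π.hom
  exact : LinearMap.range d.hom = LinearMap.ker π.hom
  superfluous₀ : IsSuperfluous (LinearMap.ker π.hom)
  superfluous₁ : IsSuperfluous (LinearMap.ker d.hom)

/-- The map of right modules `Hom_R(N, R) → Hom_R(M, R)` induced by `f : M ⟶ N`; here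
`Hom_R(M, R)` has the right action `(φ r)(m) = φ(m) r`. -/
def homToRing {M N : ModuleCat.{u} R} (f : M ⟶ N) : (N →ₗ[R] R) →ₗ[Rᵐᵒᵖ] (M →ₗ[R] R) where
  toFun φ := φ ∘ₗ f.hom
  map_add' _ _ := rfl
  map_smul' _ _ := rfl

/-- The transpose `Tr M = coker (Hom_R(P₀, R) → Hom_R(P₁, R))`, computed with the minimal
projective presentation `p` of `M`. -/
def MinProjPresentation.Tr {M : ModuleCat.{u} R} (p : MinProjPresentation M) :
    ModuleCat.{u} Rᵐᵒᵖ :=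
  ModuleCat.of Rᵐᵒᵖ ((p.P₁ →ₗ[R] R) ⧸ LinearMap.range (homToRing p.d))

/-- `M` is Gorenstein projective: `Extⁱ(M, R) = 0 = Extⁱ(Tr M, R)` for all `i ≥ 1`. -/
def IsGorensteinProjective (M : ModuleCat.{u} R) : Prop :=
  (∀ i : ℕ, 1 ≤ i → Subsingleton (Abelian.Ext M (ModuleCat.of R R) i)) ∧
  ∃ p : MinProjPresentation M,
    ∀ i : ℕ, 1 ≤ i → Subsingleton (Abelian.Ext p.Tr (ModuleCat.of Rᵐᵒᵖ R) i)

/-- `f` is an irreducible morphism in the category of finitely generated modules. -/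
def IsIrreducibleMor {X Y : ModuleCat.{u} R} (f : X ⟶ Y) : Prop :=
  ¬ IsSplitMono f ∧ ¬ IsSplitEpi f ∧
  ∀ (Z : ModuleCat.{u} R) (g : X ⟶ Z) (h : Z ⟶ Y), Module.Finite R Z → g ≫ h = f →
    IsSplitMono g ∨ IsSplitEpi h

variable (R) in
/-- The indecomposable finitely generated modules. -/
def IndMod : Type (u + 1) :=
  {M : ModuleCat.{u} R // Module.Finite R M ∧ Indecomposable M}

/-- `X` and `Y` represent the same vertex of the Auslander–Reiten quiver, or there is an arrow
from (the vertex of) `X` to (the vertex of) `Y`. -/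
def AREdge (X Y : IndMod R) : Prop :=
  Nonempty (X.1 ≅ Y.1) ∨ ∃ f : X.1 ⟶ Y.1, IsIrreducibleMor f

/-- `C` is (the class of all modules belonging to) a connected component of the Auslander–Reiten
quiver of `R`. -/
def IsARComponent (C : Set (IndMod R)) : Prop :=
  ∃ X : IndMod R, C = {Y | Relation.EqvGen AREdge X Y}

end Ring

section Algebra

variable (K : Type u) [Field K] {A : Type u} [Ring A] [Algebra K A]

/-- `M` is Gorenstein injective: `D(M)` is a Gorenstein projective module over the opposite
algebra. -/
def IsGorensteinInjective (M : ModuleCat.{u} A) : Prop :=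
  IsGorensteinProjective (D K M)

/-- `M` is Gorenstein projective-injective. -/
def IsGorensteinProjInj (M : ModuleCat.{u} A) : Prop :=
  IsGorensteinProjective M ∧ IsGorensteinInjective K M

/-- `N ≅ τ(M) = D(Tr M)`, the Auslander–Reiten translate of `M`. -/
def IsTau (M N : ModuleCat.{u} A) : Prop :=
  ∃ p : MinProjPresentation M,
    Nonempty (N ≅ (ModuleCat.restrictScalars (RingEquiv.opOp A).toRingHom).obj (D K p.Tr))

/-- `M` is a stable vertex of the Auslander–Reiten quiver: `τⁿ(M)` is defined and not projective
for all `n ∈ ℤ`, that is, the `τ`-orbit of `M` contains neither projective nor injective modules.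
The family `X` is `n ↦ τⁿ(M)`. -/
def IsStable (M : IndMod A) : Prop :=
  ∃ X : ℤ → IndMod A, X 0 = M ∧ (∀ n, ¬ Module.Projective A (X n).1) ∧
    ∀ n, IsTau K (X n).1 (X (n + 1)).1

/-- `C` is a connected component of the stable Auslander–Reiten quiver, the full subquiver on the
stable vertices. -/
def IsStableARComponent (C : Set (IndMod A)) : Prop :=
  ∃ X : IndMod A, IsStable K X ∧
    C = {Y | Relation.EqvGen (fun U V => IsStable K U ∧ IsStable K V ∧ AREdge U V) X Y}

variable (A)

/-- `A` is CM-finite: there are only finitely many indecomposable finite-dimensional Gorenstein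
projective modules up to isomorphism. -/
def IsCMFinite : Prop :=
  ∃ S : Set (ModuleCat.{u} A), S.Finite ∧
    ∀ M : IndMod A, IsGorensteinProjective M.1 → ∃ N ∈ S, Nonempty (M.1 ≅ N)

/-- `A` is connected (indecomposable as an algebra). -/
def IsConnectedAlg : Prop :=
  Nontrivial A ∧ ∀ c : A, IsIdempotentElem c → c ∈ Subring.center A → c = 0 ∨ c = 1

variable {A}

/-- `Ae`, for an idempotent `e`, is the minimal faithful projective-injective left module: it is
injective, faithful, and a direct summand of every faithful finite-dimensional module. -/
def IsMinFaithfulProjInj (e : A) : Prop :=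
  Module.Injective A (Submodule.span A {e}) ∧ FaithfulSMul A (Submodule.span A {e}) ∧
  ∀ M : ModuleCat.{u} A, Module.Finite A M → FaithfulSMul A M →
    ∃ f : ModuleCat.of A (Submodule.span A {e}) ⟶ M, IsSplitMono f

/-- `Ae ≅ D(eA)` as `(A, eAe)`-bimodules. The action of `a ∈ A` on `D(eA)` is
`(aψ)(y) = ψ(ya)`, that of `b ∈ eAe` is `(ψb)(y) = ψ(by)`. -/
def BimoduleIsoDual (e : A) : Prop :=
  ∃ Φ : Submodule.span A {e} ≃ₗ[K] (Submodule.span Aᵐᵒᵖ {e} →ₗ[K] K),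
    (∀ (a : A) (x : Submodule.span A {e}) (y : Submodule.span Aᵐᵒᵖ {e}),
      Φ (a • x) y = Φ x (MulOpposite.op a • y)) ∧
    ∀ (a : A) (x x' : Submodule.span A {e}) (y y' : Submodule.span Aᵐᵒᵖ {e}),
      (x' : A) = x * (e * a * e) → (y' : A) = (e * a * e) * y → Φ x' y = Φ x y'

variable (A)

/-- `A` is gendo-symmetric: it has dominant dimension at least `2`, and for the minimal faithful
projective-injective module `Ae` one has `Ae ≅ D(eA)` as `(A, eAe)`-bimodules. -/
def IsGendoSymmetric : Prop :=
  DomDimAtLeast 2 (ModuleCat.of A A) ∧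
  ∃ e : A, IsIdempotentElem e ∧ IsMinFaithfulProjInj e ∧ BimoduleIsoDual K e

end Algebra

end

end FinDimAlg

/-!
Identifying `Ae` with `D(eA)` gives a linear functional on `A` that is a trace form on `eAe` and
induces a perfect pairing between `Ae` and `eA`; dominant dimension at least `2` says that
`A = End_{eAe}(Ae)`. This yields a natural map `D(M) → Hom(M, A)`, bijective precisely when `M` has
codominant dimension at least `2`, and a trace duality `Hom(P, Z) ≅ D Hom(Z, P)` for `P` in
`add Ae`. A module is Gorenstein projective-injective if and only if it has infinite dominant and
codominant dimension. For such a module `M` all terms of a minimal projective or injective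
resolution lie in `add Ae`, so `τ M = Ω² M` and the class of these modules is closed under `Ω`,
`Ω⁻¹`, extensions and direct summands. Hence it contains the whole almost split sequences that start
or end in a nonprojective one of its members.

A component can leave the nonprojective modules of the class only through an indecomposable
projective-injective `P`. The irreducible maps into and out of `P` are `rad P → P` and
`P → P / soc P`, with `soc P ≅ P / rad P`, so `P` occurs exactly when its top belongs to the class.
The modules of the class, with only these projectives admitted, are therefore closed under
irreducible maps.

If there are finitely many of them up to isomorphism, then a nonzero map from one of them to an
indecomposable module outside factors through left almost split maps arbitrarily often,
contradicting the nilpotency of the radical of the endomorphism ring of their direct sum. By trace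
duality there is no nonzero map in the other direction to one of the projectives either. So these
projectives split off a block of `A`; since `A` is connected, every indecomposable projective is one
of them, and `A` is selfinjective.
-/

namespace FinDimAlg

noncomputable section

section Extensions

variable {R : Type u} [Ring R]

/-- `0 → K → P → M → 0` is a short exact sequence of modules, with maps `i` and `p`. -/
structure IsShortExact {K P M : Type*} [AddCommGroup K] [AddCommGroup P] [AddCommGroup M]
    [Module R K] [Module R P] [Module R M] (i : K →ₗ[R] P) (p : P →ₗ[R] M) : Prop where
  inj : Function.Injective i
  surj : Function.Surjective p
  exact : Function.Exact i p

theorem isShortExact_ker {P M : Type*} [AddCommGroup P] [AddCommGroup M] [Module R P]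
    [Module R M] {p : P →ₗ[R] M} (hp : Function.Surjective p) :
    IsShortExact (LinearMap.ker p).subtype p :=
  ⟨Subtype.val_injective, hp, LinearMap.exact_subtype_ker_map p⟩

theorem isShortExact_mkQ {P : Type*} [AddCommGroup P] [Module R P] (N : Submodule R P) :
    IsShortExact N.subtype N.mkQ :=
  ⟨Subtype.val_injective, N.mkQ_surjective, LinearMap.exact_subtype_mkQ N⟩

theorem isShortExact_range {K P : Type*} [AddCommGroup K] [AddCommGroup P] [Module R K]
    [Module R P] {i : K →ₗ[R] P} (hi : Function.Injective i) :
    IsShortExact i (LinearMap.range i).mkQ :=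
  ⟨hi, Submodule.mkQ_surjective _, LinearMap.exact_map_mkQ_range i⟩

variable {K P M X Y Z : ModuleCat.{u} R}

theorem IsShortExact.shortExact {i : K →ₗ[R] P} {p : P →ₗ[R] M} (h : IsShortExact i p) :
    (ShortComplex.mk (ModuleCat.ofHom i) (ModuleCat.ofHom p)
      (by ext x; exact h.exact.apply_apply_eq_zero x)).ShortExact where
  exact := (ShortComplex.ShortExact.moduleCat_exact_iff_function_exact _).2 h.exact
  mono_f := (ModuleCat.mono_iff_injective _).2 h.inj
  epi_g := (ModuleCat.epi_iff_surjective _).2 h.surj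

/-- `Extⁱ(M, Y) = 0` for all `i ≥ 1`. -/
def ExtVanish (M Y : ModuleCat.{u} R) : Prop :=
  ∀ i : ℕ, 1 ≤ i → Subsingleton (Abelian.Ext M Y i)

theorem ExtVanish.of_retract (h : ExtVanish M Y) (i : X →ₗ[R] M) (r : M →ₗ[R] X)
    (hri : ∀ x, r (i x) = x) : ExtVanish X Y := by
  intro n hn
  have := h n hn
  refine subsingleton_of_forall_eq 0 fun a => ?_
  have hid : ModuleCat.ofHom i ≫ ModuleCat.ofHom r = 𝟙 X := by ext x; exact hri x
  rw [← Abelian.Ext.mk₀_id_comp a, ← hid, ← Abelian.Ext.mk₀_comp_mk₀_assoc,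
    Subsingleton.elim ((Abelian.Ext.mk₀ (ModuleCat.ofHom r)).comp a (zero_add n)) 0,
    Abelian.Ext.comp_zero]

theorem ExtVanish.of_linearEquiv (h : ExtVanish M Y) (i : X ≃ₗ[R] M) : ExtVanish X Y :=
  h.of_retract i.toLinearMap i.symm.toLinearMap (by simp)

theorem ExtVanish.of_coeff_linearEquiv (h : ExtVanish M Y) (i : Z ≃ₗ[R] Y) : ExtVanish M Z := by
  intro n hn
  have := h n hn
  refine subsingleton_of_forall_eq 0 fun a => ?_
  have hid : ModuleCat.ofHom i.toLinearMap ≫ ModuleCat.ofHom i.symm.toLinearMap = 𝟙 Z := by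
    ext x; simp
  rw [← Abelian.Ext.comp_mk₀_id a, ← hid, ← Abelian.Ext.mk₀_comp_mk₀,
    ← Abelian.Ext.comp_assoc_of_second_deg_zero,
    Subsingleton.elim (a.comp (Abelian.Ext.mk₀ (ModuleCat.ofHom i.toLinearMap)) (add_zero n)) 0,
    Abelian.Ext.zero_comp]

theorem extVanish_of_projective [Module.Projective R P] : ExtVanish P Y := by
  intro n hn
  obtain ⟨m, rfl⟩ := Nat.exists_eq_add_of_le' hn
  have : Projective P := (IsProjective.iff_projective P).1 inferInstance
  exact Abelian.Ext.subsingleton_of_projective _ _ _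

theorem ExtVanish.exists_extension {i : K →ₗ[R] P} {p : P →ₗ[R] M} (hM : ExtVanish M Y)
    (h : IsShortExact i p) (φ : K →ₗ[R] Y) : ∃ ψ : P →ₗ[R] Y, ∀ k, ψ (i k) = φ k := by
  have := hM 1 le_rfl
  obtain ⟨x, hx⟩ := Abelian.Ext.contravariant_sequence_exact₁ h.shortExact Y
    (Abelian.Ext.mk₀ (ModuleCat.ofHom φ)) (n₁ := 1) rfl (Subsingleton.elim _ _)
  obtain ⟨ψ, rfl⟩ := (Abelian.Ext.mk₀_bijective _ _).2 x
  rw [Abelian.Ext.mk₀_comp_mk₀] at hx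
  exact ⟨ψ.hom, fun k => congrArg (fun f => f.hom k) ((Abelian.Ext.mk₀_bijective _ _).1 hx)⟩

theorem ExtVanish.ker {i : K →ₗ[R] P} {p : P →ₗ[R] M} (hM : ExtVanish M Y) (hP : ExtVanish P Y)
    (h : IsShortExact i p) : ExtVanish K Y := by
  intro n hn
  have := hM (1 + n) (by omega)
  have := hP n hn
  refine subsingleton_of_forall_eq 0 fun a => ?_
  obtain ⟨x, rfl⟩ := Abelian.Ext.contravariant_sequence_exact₁ h.shortExact Y a rfl
    (Subsingleton.elim _ _)
  rw [Subsingleton.elim x 0, Abelian.Ext.comp_zero]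

theorem ExtVanish.coker {i : K →ₗ[R] P} {p : P →ₗ[R] M} (hK : ExtVanish K Y)
    (hP : ExtVanish P Y) (h : IsShortExact i p)
    (hext : ∀ φ : K →ₗ[R] Y, ∃ ψ : P →ₗ[R] Y, ∀ k, ψ (i k) = φ k) : ExtVanish M Y := by
  have exists_lift : ∀ (m : ℕ) (x : Abelian.Ext K Y m), ∃ y : Abelian.Ext P Y m,
      x = (Abelian.Ext.mk₀ (ModuleCat.ofHom i)).comp y (zero_add m) := by
    rintro (_ | m) x
    · obtain ⟨φ, rfl⟩ := (Abelian.Ext.mk₀_bijective _ _).2 x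
      obtain ⟨ψ, hψ⟩ := hext φ.hom
      refine ⟨Abelian.Ext.mk₀ (ModuleCat.ofHom ψ), ?_⟩
      rw [Abelian.Ext.mk₀_comp_mk₀]
      exact congrArg _ (by ext k; exact (hψ k).symm)
    · have := hK (m + 1) (by omega)
      exact ⟨0, Subsingleton.elim _ _⟩
  intro n hn
  have := hP n hn
  obtain ⟨m, rfl⟩ := Nat.exists_eq_add_of_le hn
  refine subsingleton_of_forall_eq 0 fun a => ?_
  obtain ⟨x, rfl⟩ := Abelian.Ext.contravariant_sequence_exact₃ h.shortExact Y a
    (Subsingleton.elim _ _) (n₀ := m) rfl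
  obtain ⟨y, rfl⟩ := exists_lift m x
  exact h.shortExact.extClass_comp_assoc y

theorem ExtVanish.extension {i : K →ₗ[R] P} {p : P →ₗ[R] M} (hK : ExtVanish K Y)
    (hM : ExtVanish M Y) (h : IsShortExact i p) : ExtVanish P Y := by
  intro n hn
  have := hK n hn
  have := hM n hn
  refine subsingleton_of_forall_eq 0 fun a => ?_
  obtain ⟨x, rfl⟩ := Abelian.Ext.contravariant_sequence_exact₂ h.shortExact Y a
    (Subsingleton.elim _ _)
  rw [Subsingleton.elim x 0, Abelian.Ext.comp_zero]

theorem ExtVanish.of_ringEquiv {S : Type u} [Ring S] (σ : R ≃+* S) {N : ModuleCat.{u} S}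
    (h : ExtVanish ((ModuleCat.restrictScalars σ.toRingHom).obj N) (ModuleCat.of R R)) :
    ExtVanish N (ModuleCat.of S S) := by
  let F := ModuleCat.restrictScalars.{u} σ.toRingHom
  have : F.IsEquivalence :=
    (ModuleCat.restrictScalarsEquivalenceOfRingEquiv σ).isEquivalence_functor
  let regular : F.obj (ModuleCat.of S S) ≃ₗ[R] ModuleCat.of R R :=
    { σ.symm.toAddEquiv with
      map_smul' := fun r s =>
        (map_mul σ.symm (σ r) s).trans (congrArg (· * σ.symm s) (σ.symm_apply_apply r)) }
  intro n hn
  have := h.of_coeff_linearEquiv regular n hn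
  exact (F.mapExt_bijective_of_preservesProjectiveObjects N (ModuleCat.of S S) n).1.subsingleton

end Extensions

open scoped ModuleCat

section Duality

theorem exists_factor {S : Type*} [Ring S] {P M X : Type*} [AddCommGroup P] [AddCommGroup M]
    [AddCommGroup X] [Module S P] [Module S M] [Module S X] (p : P →ₗ[S] M)
    (hp : Function.Surjective p) (f : P →ₗ[S] X) (hf : ∀ x, p x = 0 → f x = 0) :
    ∃ g : M →ₗ[S] X, ∀ x, g (p x) = f x :=
  ⟨(LinearMap.ker p).liftQ f hf ∘ₗ (p.quotKerEquivOfSurjective hp).symm.toLinearMap, fun x => by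
    simpa using Submodule.liftQ_apply _ f x⟩

theorem IsShortExact.exists_factor {S : Type*} [Ring S] {X P M Y : Type*} [AddCommGroup X]
    [AddCommGroup P] [AddCommGroup M] [AddCommGroup Y] [Module S X] [Module S P] [Module S M]
    [Module S Y] {i : X →ₗ[S] P} {p : P →ₗ[S] M} (h : IsShortExact i p) (f : P →ₗ[S] Y)
    (hf : ∀ x, f (i x) = 0) : ∃ g : M →ₗ[S] Y, ∀ x, g (p x) = f x :=
  FinDimAlg.exists_factor p h.surj f fun x hx => by
    obtain ⟨y, rfl⟩ := (h.exact x).1 hx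
    exact hf y

theorem IsShortExact.exists_lift {S : Type*} [Ring S] {X P M Z : Type*} [AddCommGroup X]
    [AddCommGroup P] [AddCommGroup M] [AddCommGroup Z] [Module S X] [Module S P] [Module S M]
    [Module S Z] {i : X →ₗ[S] P} {p : P →ₗ[S] M} (h : IsShortExact i p) (f : Z →ₗ[S] P)
    (hf : ∀ z, p (f z) = 0) : ∃ g : Z →ₗ[S] X, ∀ z, i (g z) = f z :=
  ⟨(LinearEquiv.ofInjective i h.inj).symm.toLinearMap ∘ₗ
      f.codRestrict (LinearMap.range i) fun z => (h.exact _).1 (hf z), fun _ =>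
    congrArg Subtype.val ((LinearEquiv.ofInjective i h.inj).apply_symm_apply _)⟩

theorem exists_extend_functional {K V W : Type*} [Field K] [AddCommGroup V] [AddCommGroup W]
    [Module K V] [Module K W] (i : V →ₗ[K] W) (hi : Function.Injective i) (f : V →ₗ[K] K) :
    ∃ g : W →ₗ[K] K, ∀ x, g (i x) = f x :=
  (LinearMap.dualMap_surjective_of_injective hi f).imp fun _ hg => LinearMap.congr_fun hg

theorem IsShortExact.exact_lcomp (K : Type*) {S : Type*} [Semiring K] [Ring S]
    {X P M N : Type*} [AddCommGroup X] [AddCommGroup P] [AddCommGroup M] [AddCommGroup N]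
    [Module S X] [Module S P] [Module S M] [Module S N] [Module K N] [SMulCommClass S K N]
    {i : X →ₗ[S] P} {p : P →ₗ[S] M} (h : IsShortExact i p) :
    Function.Exact (p.lcomp K N) (i.lcomp K N) := fun f => by
  constructor
  · intro hf
    obtain ⟨g, hg⟩ := h.exists_factor f (LinearMap.congr_fun hf)
    exact ⟨g, LinearMap.ext hg⟩
  · rintro ⟨g, rfl⟩
    ext x
    simp [h.exact.apply_apply_eq_zero]

variable (K : Type u) [Field K] {R : Type u} [Ring R] [Algebra K R]

/-- Elements of `D(M)` are linear functionals on `M`. -/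
def dEquiv (M : ModuleCat.{u} R) : D K M ≃ₗ[K] (M →ₗ[K] K) :=
  { (AddEquiv.refl (M →ₗ[K] K) : D K M ≃+ (M →ₗ[K] K)) with
    map_smul' := fun k f => LinearMap.ext fun m => by
      change (show M →ₗ[K] K from f) ((algebraMap K R k) • m) = k • (show M →ₗ[K] K from f) m
      rw [algebraMap_smul, map_smul] }

theorem dEquiv_smul {M : ModuleCat.{u} R} (r : Rᵐᵒᵖ) (F : D K M) (m : M) :
    dEquiv K M (r • F) m = dEquiv K M F (r.unop • m) := rfl

theorem dual_ext {M : ModuleCat.{u} R} {F G : D K M}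
    (h : ∀ m, dEquiv K M F m = dEquiv K M G m) : F = G :=
  (dEquiv K M).injective (LinearMap.ext h)

/-- The duality `D` on morphisms. -/
def dMap {M N : ModuleCat.{u} R} (f : M →ₗ[R] N) : D K N →ₗ[Rᵐᵒᵖ] D K M where
  toFun F := (dEquiv K M).symm (dEquiv K N F ∘ₗ f.restrictScalars K)
  map_add' F G := dual_ext K fun m => by simp
  map_smul' r F := dual_ext K fun m => by simp [dEquiv_smul]

theorem dEquiv_dMap {M N : ModuleCat.{u} R} (f : M →ₗ[R] N) (F : D K N) (m : M) :
    dEquiv K M (dMap K f F) m = dEquiv K N F (f m) := by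
  simp [dMap]

theorem IsShortExact.restrictScalars {X P M : ModuleCat.{u} R} {i : X →ₗ[R] P} {p : P →ₗ[R] M}
    (h : IsShortExact i p) : IsShortExact (i.restrictScalars K) (p.restrictScalars K) :=
  ⟨h.inj, h.surj, h.exact⟩

theorem IsShortExact.dual {X P M : ModuleCat.{u} R} {i : X →ₗ[R] P} {p : P →ₗ[R] M}
    (h : IsShortExact i p) : IsShortExact (dMap K p) (dMap K i) where
  inj F G hFG := dual_ext K fun m => by
    obtain ⟨x, rfl⟩ := h.surj m
    rw [← dEquiv_dMap, hFG, dEquiv_dMap]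
  surj F := by
    obtain ⟨g, hg⟩ := exists_extend_functional (i.restrictScalars K) h.inj (dEquiv K X F)
    exact ⟨(dEquiv K P).symm g, dual_ext K fun m => by simpa [dEquiv_dMap] using hg m⟩
  exact F := by
    constructor
    · intro hF
      obtain ⟨g, hg⟩ := (h.restrictScalars K).exists_factor (dEquiv K P F) fun x => by
        rw [LinearMap.restrictScalars_apply, ← dEquiv_dMap, hF, map_zero, LinearMap.zero_apply]
      exact ⟨(dEquiv K M).symm g, dual_ext K fun m => by simpa [dEquiv_dMap] using hg m⟩
    · rintro ⟨G, rfl⟩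
      exact dual_ext K fun m => by simp [dEquiv_dMap, h.exact.apply_apply_eq_zero]

/-- The evaluation map `M → D(D(M))`. -/
def evalDual (M : ModuleCat.{u} R) : M →ₗ[K] D K (D K M) :=
  (dEquiv K (D K M)).symm.toLinearMap ∘ₗ (dEquiv K M).toLinearMap.flip

theorem dEquiv_evalDual {M : ModuleCat.{u} R} (m : M) (F : D K M) :
    dEquiv K (D K M) (evalDual K M m) F = dEquiv K M F m := by
  simp [evalDual]

theorem evalDual_smul {M : ModuleCat.{u} R} (r : R) (m : M) :
    evalDual K M (r • m) = MulOpposite.op (MulOpposite.op r) • evalDual K M m := by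
  refine dual_ext K fun F => ?_
  rw [dEquiv_evalDual, dEquiv_smul, dEquiv_evalDual, dEquiv_smul]
  rfl

section Finite

variable [FiniteDimensional K R]

theorem finiteDimensional_of_finite (M : ModuleCat.{u} R) [Module.Finite R M] :
    FiniteDimensional K M := Module.Finite.trans R M

theorem finiteDimensional_hom (M N : ModuleCat.{u} R) [Module.Finite R M] [Module.Finite R N] :
    FiniteDimensional K (M →ₗ[R] N) :=
  have := finiteDimensional_of_finite K M
  have := finiteDimensional_of_finite K N
  .of_injective (LinearMap.restrictScalarsₗ K R M N K) (LinearMap.restrictScalars_injective K)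

theorem evalDual_bijective (M : ModuleCat.{u} R) [Module.Finite R M] :
    Function.Bijective (evalDual K M) := by
  have := finiteDimensional_of_finite K M
  have heval : evalDual K M = ((Module.evalEquiv K M).trans
      ((dEquiv K M).dualMap.trans (dEquiv K (D K M)).symm)).toLinearMap := rfl
  rw [heval]
  exact LinearEquiv.bijective _

instance finite_dual (M : ModuleCat.{u} R) [Module.Finite R M] : Module.Finite Rᵐᵒᵖ (D K M) := by
  have := finiteDimensional_of_finite K M
  have : Module.Finite K (D K M) := Module.Finite.equiv (dEquiv K M).symm
  exact Module.Finite.of_restrictScalars_finite K Rᵐᵒᵖ (D K M)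

end Finite

end Duality

section SymmetricIdempotent

variable {K : Type u} [Field K] {R : Type u} [Ring R] [Algebra K R]

/-- The functional `lam` is a trace form on `eRe` that induces a perfect pairing between `Re` and
`eR`, and the module `Re` is faithful. -/
structure IsSymmPairing (e : R) (lam : R →ₗ[K] K) : Prop where
  idem : e * e = e
  supp : ∀ z, lam z = lam (e * z * e)
  symm : ∀ a q, lam (e * a * e * q) = lam (q * (e * a * e))
  nondeg_left : ∀ x, x * e = x → (∀ y, lam (y * x) = 0) → x = 0
  nondeg_right : ∀ y, e * y = y → (∀ x, lam (y * x) = 0) → y = 0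
  faithful_left : ∀ a, (∀ x, a * x * e = 0) → a = 0

/-- The idempotent `e` and the functional `lam` exhibit `R` as a gendo-symmetric algebra: besides
the properties of a symmetric pairing, `R` is the endomorphism ring of `Re` over `eRe`, in the sense
that the balanced bilinear forms on `Re × eR` are the forms `(x, y) ↦ lam (y a x)`.
Forms on `Re × eR` are encoded as forms on `R × R` that factor through `x ↦ xe` and `y ↦ ey`. -/
structure IsSymmIdempotent (e : R) (lam : R →ₗ[K] K) : Prop extends IsSymmPairing e lam where
  exists_form : ∀ γ : R →ₗ[K] R →ₗ[K] K, (∀ x y, γ (x * e) (e * y) = γ x y) →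
    (∀ a x y, γ (x * (e * a * e)) y = γ x (e * a * e * y)) → ∃ a, ∀ x y, γ x y = lam (y * a * x)

variable {e : R} {lam : R →ₗ[K] K}

namespace IsSymmPairing

variable (hs : IsSymmPairing e lam)
include hs

theorem lam_mul_e (z : R) : lam (z * e) = lam z := by
  rw [hs.supp, hs.supp z, mul_assoc, mul_assoc, hs.idem, ← mul_assoc]

theorem lam_e_mul (z : R) : lam (e * z) = lam z := by
  rw [hs.supp, hs.supp z, ← mul_assoc e e, hs.idem]

theorem faithful_right (a : R) (ha : ∀ y, e * y * a = 0) : a = 0 :=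
  hs.faithful_left a fun x => hs.nondeg_left _ (by rw [mul_assoc, hs.idem]) fun y => by
    rw [← hs.lam_e_mul, ← mul_assoc, ← mul_assoc, ← mul_assoc, ha, zero_mul, zero_mul, map_zero]

end IsSymmPairing

namespace IsSymmIdempotent

theorem lam_comm (hs : IsSymmIdempotent e lam) {p : R} (hp : e * p = p) (hp' : p * e = p)
    (q : R) : lam (p * q) = lam (q * p) := by
  have := hs.symm p q
  rwa [hp, hp'] at this

theorem op (hs : IsSymmIdempotent e lam) : IsSymmIdempotent (MulOpposite.op e)
    (lam ∘ₗ (MulOpposite.opLinearEquiv K).symm.toLinearMap) where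
  idem := congrArg MulOpposite.op hs.idem
  supp z := by simpa [mul_assoc] using hs.supp z.unop
  symm a q := by simpa [mul_assoc] using (hs.symm a.unop q.unop).symm
  nondeg_left x hx hl := MulOpposite.unop_injective <|
    hs.nondeg_right x.unop (congrArg MulOpposite.unop hx) fun y => by
      simpa using hl (MulOpposite.op y)
  nondeg_right x hx hl := MulOpposite.unop_injective <|
    hs.nondeg_left x.unop (congrArg MulOpposite.unop hx) fun y => by
      simpa using hl (MulOpposite.op y)
  faithful_left a ha := MulOpposite.unop_injective <| hs.faithful_right a.unop fun y => by
    simpa [mul_assoc] using congrArg MulOpposite.unop (ha (MulOpposite.op y))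
  exists_form γ hγ hbal := by
    let ι := (MulOpposite.opLinearEquiv K : R ≃ₗ[K] Rᵐᵒᵖ).toLinearMap
    obtain ⟨a, ha⟩ := hs.exists_form (γ.compl₁₂ ι ι).flip
      (fun x y => by simpa [ι] using hγ (MulOpposite.op y) (MulOpposite.op x))
      (fun a x y => by
        simpa [ι, mul_assoc] using
          (hbal (MulOpposite.op a) (MulOpposite.op y) (MulOpposite.op x)).symm)
    exact ⟨MulOpposite.op a, fun x y => by simpa [ι, mul_assoc] using ha y.unop x.unop⟩

theorem eq_of_lam_eq (hs : IsSymmIdempotent e lam) {a b : R}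
    (h : ∀ x y, lam (y * a * x) = lam (y * b * x)) : a = b := by
  refine sub_eq_zero.1 (hs.faithful_right _ fun y => ?_)
  refine hs.nondeg_right _ (by simp only [← mul_assoc, hs.idem]) fun x => ?_
  rw [mul_sub, sub_mul, map_sub, h, sub_self]

theorem eq_of_lam_mul_eq (hs : IsSymmIdempotent e lam) {a b : R} (ha : a * e = a)
    (hb : b * e = b) (h : ∀ y, lam (y * a) = lam (y * b)) : a = b :=
  sub_eq_zero.1 <| hs.nondeg_left _ (by rw [sub_mul, ha, hb]) fun y => by
    rw [mul_sub, map_sub, h, sub_self]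

theorem exists_lam_eq (hs : IsSymmIdempotent e lam) (g : R →ₗ[K] K) :
    ∃ a : R, ∀ x y, lam (y * a * x) = g (x * e * y) := by
  let γ : R →ₗ[K] R →ₗ[K] K := (LinearMap.mul K R).compl₁₂ (LinearMap.mulRight K e) .id |>.compr₂ g
  have hγ : ∀ x y, γ x y = g (x * e * y) := fun x y => rfl
  have absorb : ∀ z, e * (e * z) = e * z := fun z => by rw [← mul_assoc, hs.idem]
  obtain ⟨a, ha⟩ := hs.exists_form γ (fun x y => by simp only [hγ, mul_assoc, absorb])
    (fun a x y => by simp only [hγ, mul_assoc, absorb])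
  exact ⟨a, fun x y => (ha x y).symm⟩

/-- The bimodule map `D(R) → R` sending `g` to the element `a` with `lam (y a x) = g (x e y)`. -/
def dualToRing (hs : IsSymmIdempotent e lam) : (R →ₗ[K] K) →ₗ[K] R where
  toFun g := (hs.exists_lam_eq g).choose
  map_add' g g' := hs.eq_of_lam_eq fun x y => by
    rw [(hs.exists_lam_eq _).choose_spec, mul_add, add_mul, map_add,
      (hs.exists_lam_eq g).choose_spec, (hs.exists_lam_eq g').choose_spec, LinearMap.add_apply]
  map_smul' k g := hs.eq_of_lam_eq fun x y => by
    rw [(hs.exists_lam_eq _).choose_spec, mul_smul_comm, smul_mul_assoc, map_smul,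
      RingHom.id_apply, (hs.exists_lam_eq g).choose_spec, LinearMap.smul_apply]

theorem lam_mul_dualToRing_mul (hs : IsSymmIdempotent e lam) (g : R →ₗ[K] K) (x y : R) :
    lam (y * hs.dualToRing g * x) = g (x * e * y) :=
  (hs.exists_lam_eq g).choose_spec x y

/-- The natural map `D(M) → Hom(M, R)`. -/
def dualToHom (hs : IsSymmIdempotent e lam) (M : ModuleCat.{u} R) :
    (M →ₗ[K] K) →ₗ[K] (M →ₗ[R] R) where
  toFun f :=
    { toFun := fun m => hs.dualToRing (f ∘ₗ (LinearMap.toSpanSingleton R M m).restrictScalars K)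
      map_add' := fun m n => hs.eq_of_lam_eq fun x y => by
        simp [mul_add, add_mul, lam_mul_dualToRing_mul]
      map_smul' := fun r m => hs.eq_of_lam_eq fun x y => by
        rw [RingHom.id_apply, smul_eq_mul, ← mul_assoc y r, lam_mul_dualToRing_mul,
          lam_mul_dualToRing_mul]
        simp [mul_smul] }
  map_add' f g := LinearMap.ext fun m => map_add hs.dualToRing
    (f ∘ₗ (LinearMap.toSpanSingleton R M m).restrictScalars K)
    (g ∘ₗ (LinearMap.toSpanSingleton R M m).restrictScalars K)
  map_smul' k f := LinearMap.ext fun m => map_smul hs.dualToRing k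
    (f ∘ₗ (LinearMap.toSpanSingleton R M m).restrictScalars K)

variable {M N : ModuleCat.{u} R}

theorem lam_mul_dualToHom_mul (hs : IsSymmIdempotent e lam) (f : M →ₗ[K] K) (m : M) (x y : R) :
    lam (y * hs.dualToHom M f m * x) = f ((x * e * y) • m) :=
  hs.lam_mul_dualToRing_mul (f ∘ₗ (LinearMap.toSpanSingleton R M m).restrictScalars K) x y

theorem dualToHom_eq_iff (hs : IsSymmIdempotent e lam) {f : M →ₗ[K] K} {φ : M →ₗ[R] R} :
    hs.dualToHom M f = φ ↔ ∀ x m, lam (φ m * x) = f ((x * e) • m) := by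
  constructor
  · rintro rfl x m
    simpa using hs.lam_mul_dualToHom_mul f m x 1
  · refine fun h => LinearMap.ext fun m => hs.eq_of_lam_eq fun x y => ?_
    rw [lam_mul_dualToHom_mul, mul_smul, ← h, map_smul, smul_eq_mul]

theorem dualToHom_eq_zero_iff (hs : IsSymmIdempotent e lam) {f : M →ₗ[K] K} :
    hs.dualToHom M f = 0 ↔ ∀ x m, f ((x * e) • m) = 0 := by
  rw [dualToHom_eq_iff]
  simp [eq_comm]

theorem dualToHom_comp (hs : IsSymmIdempotent e lam) (f : N →ₗ[K] K) (g : M →ₗ[R] N) :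
    hs.dualToHom M (f ∘ₗ g.restrictScalars K) = hs.dualToHom N f ∘ₗ g :=
  hs.dualToHom_eq_iff.2 fun x m => by simp [hs.dualToHom_eq_iff.1 rfl]

theorem lam_mul_dualToHom (hs : IsSymmIdempotent e lam) (f : M →ₗ[K] K) (m : M) (y : R) :
    lam (y * hs.dualToHom M f m) = f ((e * y) • m) := by
  simpa using hs.lam_mul_dualToHom_mul f m 1 y

theorem dualToHom_lam_comp_mul_e (hs : IsSymmIdempotent e lam) (φ : M →ₗ[R] R) (m : M) :
    hs.dualToHom M (lam ∘ₗ φ.restrictScalars K) m * e = φ m * e :=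
  hs.eq_of_lam_mul_eq (by rw [mul_assoc, hs.idem]) (by rw [mul_assoc, hs.idem]) fun y => by
    rw [← mul_assoc, hs.lam_mul_e, lam_mul_dualToHom, ← mul_assoc, hs.lam_mul_e]
    simp [mul_assoc, hs.lam_e_mul]

theorem lcomp_comp_dualToHom (hs : IsSymmIdempotent e lam) (g : M →ₗ[R] N) :
    g.lcomp K R ∘ₗ hs.dualToHom N = hs.dualToHom M ∘ₗ (g.restrictScalars K).lcomp K K :=
  LinearMap.ext fun f => (hs.dualToHom_comp f g).symm

end IsSymmIdempotent

/-- The natural map `D(M) → Hom(M, R)` is bijective. Equivalently, `M` has codominant dimension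
at least `2`. -/
def DualIsHom (hs : IsSymmIdempotent e lam) (M : ModuleCat.{u} R) : Prop :=
  Function.Bijective (hs.dualToHom M)

variable {hs : IsSymmIdempotent e lam} {X P M : ModuleCat.{u} R}

/-- The isomorphism `D(M) ≅ Hom(M, R)` of right modules given by a bijective natural map. -/
def DualIsHom.dualEquivHom (hM : DualIsHom hs M) : D K M ≃ₗ[Rᵐᵒᵖ] (M →ₗ[R] R) :=
  LinearEquiv.ofBijective
    { toFun := fun F => hs.dualToHom M (dEquiv K M F)
      map_add' := fun F G => by simp
      map_smul' := fun r F => hs.dualToHom_eq_iff.2 fun x m => by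
        rw [dEquiv_smul, ← mul_smul, ← mul_assoc, ← hs.dualToHom_eq_iff.1 rfl]
        simp [mul_assoc] }
    (hM.comp (dEquiv K M).bijective)

theorem DualIsHom.of_retract (hM : DualIsHom hs M) (i : X →ₗ[R] M) (r : M →ₗ[R] X)
    (hri : ∀ x, r (i x) = x) : DualIsHom hs X := by
  have hid : r ∘ₗ i = LinearMap.id := LinearMap.ext hri
  constructor
  · intro f g hfg
    have := hM.1 (a₁ := f ∘ₗ r.restrictScalars K) (a₂ := g ∘ₗ r.restrictScalars K) (by
      rw [hs.dualToHom_comp, hs.dualToHom_comp, hfg])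
    ext x
    simpa [hri] using LinearMap.congr_fun this (i x)
  · intro φ
    obtain ⟨f, hf⟩ := hM.2 (φ ∘ₗ r)
    exact ⟨f ∘ₗ i.restrictScalars K, by
      rw [hs.dualToHom_comp, hf, LinearMap.comp_assoc, hid, LinearMap.comp_id]⟩

theorem DualIsHom.exists_extension {i : X →ₗ[R] P} (hX : DualIsHom hs X)
    (hi : Function.Injective i) (φ : X →ₗ[R] R) : ∃ ψ : P →ₗ[R] R, ∀ x, ψ (i x) = φ x := by
  obtain ⟨f, rfl⟩ := hX.2 φ
  obtain ⟨g, hg⟩ := exists_extend_functional (i.restrictScalars K) hi f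
  obtain rfl : g ∘ₗ i.restrictScalars K = f := LinearMap.ext hg
  exact ⟨hs.dualToHom P g, fun x => (LinearMap.congr_fun (hs.dualToHom_comp g i) x).symm⟩

theorem DualIsHom.coker {i : X →ₗ[R] P} {p : P →ₗ[R] M} (hX : DualIsHom hs X)
    (hP : DualIsHom hs P) (h : IsShortExact i p) : DualIsHom hs M :=
  LinearMap.bijective_of_bijective_of_injective_of_left_exact _ _ _ _ _ _ _
    (hs.lcomp_comp_dualToHom p) (hs.lcomp_comp_dualToHom i) ((h.restrictScalars K).exact_lcomp K)
    (h.exact_lcomp K) hP hX.1 (LinearMap.lcomp_injective_of_surjective _ h.surj)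
    (LinearMap.lcomp_injective_of_surjective _ h.surj)

theorem DualIsHom.ker {i : X →ₗ[R] P} {p : P →ₗ[R] M} (hM : DualIsHom hs M)
    (hP : DualIsHom hs P) (h : IsShortExact i p)
    (hext : ∀ φ : X →ₗ[R] R, ∃ ψ : P →ₗ[R] R, ∀ x, ψ (i x) = φ x) : DualIsHom hs X :=
  LinearMap.bijective_of_surjective_of_bijective_of_right_exact _ _ _ _ _ _ _
    (hs.lcomp_comp_dualToHom p) (hs.lcomp_comp_dualToHom i) ((h.restrictScalars K).exact_lcomp K)
    (h.exact_lcomp K) hM.2 hP (LinearMap.dualMap_surjective_of_injective h.inj)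
    fun φ => (hext φ).imp fun _ => LinearMap.ext

theorem DualIsHom.extension {i : X →ₗ[R] P} {p : P →ₗ[R] M} (hX : DualIsHom hs X)
    (hM : DualIsHom hs M) (h : IsShortExact i p) : DualIsHom hs P := by
  have hcomm (f : M →ₗ[K] K) := hs.dualToHom_comp f p
  constructor
  · refine (injective_iff_map_eq_zero _).2 fun f hf => ?_
    have hfi : f ∘ₗ i.restrictScalars K = 0 := hX.1 (by
      rw [hs.dualToHom_comp, hf, LinearMap.zero_comp, map_zero])
    obtain ⟨g, rfl⟩ := ((h.restrictScalars K).exact_lcomp K f).1 hfi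
    have : hs.dualToHom M g = 0 := LinearMap.lcomp_injective_of_surjective (S := K) p h.surj
      ((hcomm g).symm.trans (hf.trans (map_zero _).symm))
    rw [hM.1 (this.trans (map_zero _).symm), map_zero]
  · intro ψ
    obtain ⟨f, hf⟩ := hX.2 (ψ ∘ₗ i)
    obtain ⟨F, rfl⟩ := LinearMap.dualMap_surjective_of_injective
      (f := i.restrictScalars K) h.inj f
    obtain ⟨χ, hχ⟩ := (h.exact_lcomp K (ψ - hs.dualToHom P F)).1 <| sub_eq_zero.2 <|
      hf.symm.trans (hs.dualToHom_comp F i)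
    obtain ⟨g, rfl⟩ := hM.2 χ
    exact ⟨F + g ∘ₗ p.restrictScalars K, by
      rw [map_add, hcomm]
      exact (eq_sub_iff_add_eq'.1 hχ)⟩

end SymmetricIdempotent

section AddIdempotent

theorem exists_eq_of_forall_apply_eq_zero {K V W : Type*} [Field K] [AddCommGroup V]
    [AddCommGroup W] [Module K V] [Module K W] [FiniteDimensional K V] (T : W →ₗ[K] V →ₗ[K] K)
    (g : V →ₗ[K] K) (hg : ∀ v, (∀ w, T w v = 0) → g v = 0) : ∃ w, T w = g := by
  have : g ∈ (LinearMap.range T).dualCoannihilator.dualAnnihilator := by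
    rw [Submodule.mem_dualAnnihilator]
    intro v hv
    rw [Submodule.mem_dualCoannihilator] at hv
    exact hg v fun w => hv _ ⟨w, rfl⟩
  rwa [Subspace.dualCoannihilator_dualAnnihilator_eq] at this

variable {K : Type u} [Field K] {R : Type u} [Ring R] [Algebra K R]

/-- A dual basis of `P` exhibiting `P` as a direct summand of a power of `Re`. -/
structure DualBasis (e : R) (P : ModuleCat.{u} R) where
  n : ℕ
  gen : Fin n → P
  coord : Fin n → (P →ₗ[R] R)
  e_smul_gen : ∀ i, e • gen i = gen i
  coord_mul_e : ∀ i x, coord i x * e = coord i x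
  sum_coord : ∀ x, ∑ i, coord i x • gen i = x

variable {e : R} {lam : R →ₗ[K] K} {P Q X Z M : ModuleCat.{u} R}

namespace DualBasis

/-- The dual basis of the power `(Re)ⁿ`. -/
def pi (he : e * e = e) (n : ℕ) :
    DualBasis e (ModuleCat.of R (Fin n → Submodule.span R {e})) where
  n := n
  gen i := Pi.single i ⟨e, Submodule.mem_span_singleton_self e⟩
  coord i := (Submodule.span R {e}).subtype ∘ₗ LinearMap.proj i
  e_smul_gen i := (Pi.single_smul i e _).symm.trans (congrArg _ (Subtype.ext he))
  coord_mul_e i x := by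
    obtain ⟨a, ha⟩ := Submodule.mem_span_singleton.1 (x i).2
    simp [← ha, mul_assoc, he]
  sum_coord x := by
    ext j
    obtain ⟨a, ha⟩ := Submodule.mem_span_singleton.1 (x j).2
    simp [Finset.sum_apply, Pi.single_apply, ← ha, mul_assoc, he]

/-- A direct summand of `P` inherits a dual basis. -/
def ofRetract (b : DualBasis e P) (i : X →ₗ[R] P) (r : P →ₗ[R] X) (hri : ∀ x, r (i x) = x) :
    DualBasis e X where
  n := b.n
  gen j := r (b.gen j)
  coord j := b.coord j ∘ₗ i
  e_smul_gen j := by rw [← map_smul, b.e_smul_gen]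
  coord_mul_e j x := b.coord_mul_e j (i x)
  sum_coord x := by
    conv_rhs => rw [← hri x, ← b.sum_coord (i x)]
    simp

theorem projective (b : DualBasis e P) : Module.Projective R P :=
  Module.Projective.of_split (LinearMap.pi b.coord)
    (Fintype.linearCombination R b.gen) (LinearMap.ext fun x => by
      simpa [Fintype.linearCombination_apply] using b.sum_coord x)

theorem finite (b : DualBasis e P) : Module.Finite R P :=
  Module.Finite.of_surjective (Fintype.linearCombination R b.gen) fun x =>
    ⟨fun i => b.coord i x, by simpa [Fintype.linearCombination_apply] using b.sum_coord x⟩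

theorem apply_eq_sum (b : DualBasis e P) {N : Type*} [AddCommGroup N] [Module R N]
    (φ : P →ₗ[R] N) (x : P) : φ x = ∑ i, b.coord i x • φ (b.gen i) := by
  conv_lhs => rw [← b.sum_coord x]
  simp

theorem eq_sum_coord (b : DualBasis e P) (φ : P →ₗ[R] R) :
    ∑ i, MulOpposite.op (φ (b.gen i)) • b.coord i = φ := by
  ext x
  rw [b.apply_eq_sum φ x]
  simp

theorem e_mul_apply (b : DualBasis e P) (φ : P →ₗ[R] R) (i : Fin b.n) :
    e * φ (b.gen i) = φ (b.gen i) := by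
  conv_rhs => rw [← b.e_smul_gen, map_smul, smul_eq_mul]

theorem dualIsHom (hs : IsSymmIdempotent e lam) (b : DualBasis e P) : DualIsHom hs P := by
  refine ⟨(injective_iff_map_eq_zero _).2 fun f hf => ?_, fun φ => ?_⟩
  · ext x
    rw [← b.sum_coord x, map_sum, LinearMap.zero_apply]
    refine Finset.sum_eq_zero fun i _ => ?_
    rw [← b.coord_mul_e, hs.dualToHom_eq_zero_iff.1 hf]
  · refine ⟨∑ i, lam ∘ₗ LinearMap.mulLeft K (φ (b.gen i)) ∘ₗ (b.coord i).restrictScalars K,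
      hs.dualToHom_eq_iff.2 fun x m => ?_⟩
    have move (i : Fin b.n) :
        lam (b.coord i m * φ (b.gen i) * x) = lam (φ (b.gen i) * (x * e * b.coord i m)) := by
      have := hs.lam_comm (p := φ (b.gen i) * x * e)
        (by rw [← mul_assoc, ← mul_assoc, b.e_mul_apply]) (by rw [mul_assoc, hs.idem])
        (b.coord i m)
      rw [← hs.lam_mul_e]
      simpa only [mul_assoc] using this.symm
    rw [b.apply_eq_sum φ m, Finset.sum_mul, map_sum]
    simpa using Finset.sum_congr rfl fun i _ => move i

/-- The dual basis of `Hom(P, R)`. -/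
def hom (b : DualBasis e P) :
    DualBasis (MulOpposite.op e) (ModuleCat.of Rᵐᵒᵖ (P →ₗ[R] R)) where
  n := b.n
  gen := b.coord
  coord i :=
    { toFun := fun φ => MulOpposite.op (φ (b.gen i))
      map_add' := fun _ _ => rfl
      map_smul' := fun _ _ => rfl }
  e_smul_gen i := LinearMap.ext (b.coord_mul_e i)
  coord_mul_e i φ := congrArg MulOpposite.op (b.e_mul_apply φ i)
  sum_coord φ := b.eq_sum_coord φ

/-- The dual basis of `D(P)`. -/
def dual (hs : IsSymmIdempotent e lam) (b : DualBasis e P) :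
    DualBasis (MulOpposite.op e) (D K P) :=
  b.hom.ofRetract (b.dualIsHom hs).dualEquivHom.toLinearMap
    (b.dualIsHom hs).dualEquivHom.symm.toLinearMap (LinearEquiv.symm_apply_apply _)

/-- The trace form on the endomorphisms of `P`. -/
def trace (lam : R →ₗ[K] K) (b : DualBasis e P) (f : P →ₗ[R] P) : K :=
  ∑ i, lam (b.coord i (f (b.gen i)))

theorem trace_comm (hs : IsSymmIdempotent e lam) (b : DualBasis e P) (c : DualBasis e Q)
    (f : P →ₗ[R] Q) (g : Q →ₗ[R] P) : b.trace lam (g ∘ₗ f) = c.trace lam (f ∘ₗ g) := by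
  have hgf : b.trace lam (g ∘ₗ f) = ∑ i, ∑ j,
      lam (c.coord j (f (b.gen i)) * b.coord i (g (c.gen j))) := by
    refine Finset.sum_congr rfl fun i _ => ?_
    rw [LinearMap.comp_apply, c.apply_eq_sum g]
    simp
  have hfg : c.trace lam (f ∘ₗ g) = ∑ j, ∑ i,
      lam (b.coord i (g (c.gen j)) * c.coord j (f (b.gen i))) := by
    refine Finset.sum_congr rfl fun j _ => ?_
    rw [LinearMap.comp_apply, b.apply_eq_sum f]
    simp
  rw [hgf, hfg, Finset.sum_comm]
  refine Finset.sum_congr rfl fun j _ => Finset.sum_congr rfl fun i _ => ?_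
  exact hs.lam_comm (b.e_mul_apply (c.coord j ∘ₗ f) i) (c.coord_mul_e _ _) _

theorem trace_toSpanSingleton_comp (hs : IsSymmIdempotent e lam) (b : DualBasis e P)
    (φ : P →ₗ[R] R) {x : P} (hx : e • x = x) :
    b.trace lam (LinearMap.toSpanSingleton R P x ∘ₗ φ) = lam (φ x) := by
  rw [b.apply_eq_sum φ x, map_sum]
  refine Finset.sum_congr rfl fun k _ => ?_
  have he : e * b.coord k x = b.coord k x := by rw [← smul_eq_mul, ← map_smul, hx]
  simpa using (hs.lam_comm he (b.coord_mul_e k x) (φ (b.gen k))).symm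

theorem left_eq_zero_of_trace (hs : IsSymmIdempotent e lam) (b : DualBasis e P)
    (u : Z →ₗ[R] P) (hu : ∀ v : P →ₗ[R] Z, b.trace lam (u ∘ₗ v) = 0) : u = 0 := by
  have lam_coord (i : Fin b.n) (z : Z) (hz : e • z = z) : lam (b.coord i (u z)) = 0 := by
    rw [← b.trace_toSpanSingleton_comp hs (b.coord i) (by rw [← map_smul, hz]),
      ← hu (LinearMap.toSpanSingleton R Z z ∘ₗ b.coord i), ← LinearMap.comp_assoc,
      LinearMap.comp_toSpanSingleton]
  ext z
  rw [LinearMap.zero_apply, ← b.sum_coord (u z)]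
  refine Finset.sum_eq_zero fun i _ => ?_
  have : b.coord i (u z) = 0 := hs.nondeg_left _ (b.coord_mul_e _ _) fun y => by
    rw [← hs.lam_e_mul, ← mul_assoc, ← smul_eq_mul, ← map_smul, ← map_smul]
    exact lam_coord i _ (by rw [← mul_smul, ← mul_assoc, hs.idem])
  rw [this, zero_smul]

theorem right_eq_zero_of_trace (hs : IsSymmIdempotent e lam) (b : DualBasis e P)
    (v : P →ₗ[R] Z) (hv : ∀ u : Z →ₗ[R] P, b.trace lam (u ∘ₗ v) = 0) : v = 0 := by
  have apply_gen (i : Fin b.n) : v (b.gen i) = 0 :=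
    (Module.forall_dual_apply_eq_zero_iff K _).1 fun F => by
      rw [← hv (LinearMap.toSpanSingleton R P (b.gen i) ∘ₗ hs.dualToHom Z F),
        LinearMap.comp_assoc, b.trace_toSpanSingleton_comp hs _ (b.e_smul_gen i)]
      simpa [← map_smul, b.e_smul_gen] using (hs.lam_mul_dualToHom F (v (b.gen i)) 1).symm
  ext x
  rw [b.apply_eq_sum v x]
  simp [apply_gen]

/-- The pairing `Hom(Z, P) × Hom(P, Z) → K` given by the trace form. -/
def pairing (lam : R →ₗ[K] K) (b : DualBasis e P) (Z : ModuleCat.{u} R) :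
    (Z →ₗ[R] P) →ₗ[K] (P →ₗ[R] Z) →ₗ[K] K :=
  LinearMap.mk₂ K (fun u v => b.trace lam (u ∘ₗ v))
    (fun u u' v => by simp [trace, Finset.sum_add_distrib])
    (fun k u v => by simp [trace, Finset.mul_sum])
    (fun u v v' => by simp [trace, Finset.sum_add_distrib])
    (fun k u v => by simp [trace, Finset.mul_sum])

theorem pairing_apply (b : DualBasis e P) (u : Z →ₗ[R] P) (v : P →ₗ[R] Z) :
    b.pairing lam Z u v = b.trace lam (u ∘ₗ v) := rfl

theorem exists_pairing_eq (hs : IsSymmIdempotent e lam) [FiniteDimensional K R]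
    (b : DualBasis e P) [Module.Finite R Z] (g : (P →ₗ[R] Z) →ₗ[K] K) :
    ∃ u : Z →ₗ[R] P, ∀ v, b.trace lam (u ∘ₗ v) = g v := by
  have := b.finite
  have := finiteDimensional_hom K P Z
  obtain ⟨u, hu⟩ := exists_eq_of_forall_apply_eq_zero (b.pairing lam Z) g fun v hv => by
    rw [b.right_eq_zero_of_trace hs v hv, map_zero]
  exact ⟨u, fun v => LinearMap.congr_fun hu v⟩

end DualBasis

theorem IsSymmIdempotent.exists_extension (hs : IsSymmIdempotent e lam) {i : X →ₗ[R] Z}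
    (hi : Function.Injective i) (φ : X →ₗ[R] R) (hφ : ∀ x, φ x * e = φ x) :
    ∃ ψ : Z →ₗ[R] R, ∀ x, ψ (i x) = φ x := by
  obtain ⟨F, hF⟩ := exists_extend_functional (i.restrictScalars K) hi (lam ∘ₗ φ.restrictScalars K)
  have hFi : F ∘ₗ i.restrictScalars K = lam ∘ₗ φ.restrictScalars K := LinearMap.ext hF
  refine ⟨LinearMap.toSpanSingleton R R e ∘ₗ hs.dualToHom Z F, fun x => ?_⟩
  rw [← hφ, ← hs.dualToHom_lam_comp_mul_e, ← hFi, hs.dualToHom_comp]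
  rfl

theorem DualBasis.injective (hs : IsSymmIdempotent e lam) (b : DualBasis e P) :
    Module.Injective R P where
  out X Y _ _ _ _ i hi g := by
    choose ξ hξ using fun j => hs.exists_extension (X := ModuleCat.of R X)
      (Z := ModuleCat.of R Y) (i := i) hi (b.coord j ∘ₗ g) fun x => b.coord_mul_e j (g x)
    refine ⟨∑ j, LinearMap.toSpanSingleton R P (b.gen j) ∘ₗ ξ j, fun x => ?_⟩
    rw [← b.sum_coord (g x)]
    simp [hξ]

theorem nonempty_dualBasis_of_span (K : Type u) [Field K] [Algebra K R] [FiniteDimensional K R]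
    [Module.Finite R P] [Module.Projective R P] (he : e * e = e)
    (hP : Submodule.span R (Set.range fun x : P => e • x) = ⊤) : Nonempty (DualBasis e P) := by
  have := finiteDimensional_of_finite K P
  let B := Module.finBasis K P
  have hsurj : Function.Surjective (Fintype.linearCombination R fun i => e • B i) := by
    rw [← LinearMap.range_eq_top, Fintype.range_linearCombination, eq_top_iff, ← hP,
      Submodule.span_le]
    rintro _ ⟨x, rfl⟩
    change e • x ∈ Submodule.span R _
    rw [← B.sum_repr x, Finset.smul_sum]
    refine Submodule.sum_mem _ fun i _ => ?_
    rw [smul_comm]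
    exact Submodule.smul_of_tower_mem _ _ (Submodule.subset_span ⟨i, rfl⟩)
  obtain ⟨t, ht⟩ := Module.projective_lifting_property _ LinearMap.id hsurj
  refine ⟨⟨_, fun i => e • B i, fun i => LinearMap.toSpanSingleton R R e ∘ₗ LinearMap.proj i ∘ₗ t,
    fun i => ?_, fun i x => ?_, fun x => ?_⟩⟩
  · rw [← mul_smul, he]
  · simp [mul_assoc, he]
  · conv_rhs => rw [← LinearMap.id_apply (R := R) x, ← ht, LinearMap.comp_apply,
      Fintype.linearCombination_apply]
    exact Finset.sum_congr rfl fun i _ => by simp [← mul_smul, mul_assoc, he]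

theorem exists_embedding (hs : IsSymmIdempotent e lam) [FiniteDimensional K R]
    [Module.Finite R M] (hM : ∀ m : M, (∀ y, (e * y) • m = 0) → m = 0) :
    ∃ (Q : ModuleCat.{u} R) (_ : DualBasis e Q) (i : M →ₗ[R] Q), Function.Injective i := by
  have := finiteDimensional_of_finite K M
  let B := Module.finBasis K M
  let ξ (i) : M →ₗ[R] Submodule.span R {e} :=
    LinearMap.toSpanSingleton R _ ⟨e, Submodule.mem_span_singleton_self e⟩ ∘ₗ
      hs.dualToHom M (B.coord i)
  refine ⟨_, DualBasis.pi hs.idem _, LinearMap.pi ξ,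
    (injective_iff_map_eq_zero _).2 fun m hm => hM m fun y => B.ext_elem fun i => ?_⟩
  have hξ : hs.dualToHom M (B.coord i) m * e = 0 := congrArg Subtype.val (congrFun hm i)
  have := hs.lam_mul_dualToHom (B.coord i) m y
  rw [← hs.lam_mul_e, mul_assoc, hξ, mul_zero, map_zero] at this
  rw [map_zero]
  exact this.symm

end AddIdempotent

section GorensteinProjInj

variable {K : Type u} [Field K] {R : Type u} [Ring R] [Algebra K R] {e : R} {lam : R →ₗ[K] K}

/-- `M` has infinite dominant and codominant dimension. The fields `hom` and `ext` encode infinite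
codominant dimension, the first one for the terms of index `0` and `1`; infinite dominant dimension
is the same condition on `D(M)`. -/
structure IsBiperfect (hs : IsSymmIdempotent e lam) (M : ModuleCat.{u} R) : Prop where
  ext : ExtVanish M (ModuleCat.of R R)
  hom : DualIsHom hs M
  ext_dual : ExtVanish (D K M) (ModuleCat.of Rᵐᵒᵖ Rᵐᵒᵖ)
  hom_dual : DualIsHom hs.op (D K M)

namespace IsBiperfect

variable {hs : IsSymmIdempotent e lam} {X P M : ModuleCat.{u} R}

theorem ker {i : X →ₗ[R] P} {p : P →ₗ[R] M} (hM : IsBiperfect hs M) (h : IsShortExact i p)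
    (b : DualBasis e P) : IsBiperfect hs X := by
  have hP := b.projective
  have hDP := (b.dual hs).projective
  have hd := h.dual K
  exact {
    ext := hM.ext.ker extVanish_of_projective h
    hom := hM.hom.ker (b.dualIsHom hs) h (hM.ext.exists_extension h)
    ext_dual := hM.ext_dual.coker extVanish_of_projective hd (hM.hom_dual.exists_extension hd.inj)
    hom_dual := hM.hom_dual.coker ((b.dual hs).dualIsHom hs.op) hd }

theorem coker {i : X →ₗ[R] P} {p : P →ₗ[R] M} (hX : IsBiperfect hs X) (h : IsShortExact i p)
    (b : DualBasis e P) : IsBiperfect hs M := by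
  have hP := b.projective
  have hDP := (b.dual hs).projective
  have hd := h.dual K
  exact {
    ext := hX.ext.coker extVanish_of_projective h (hX.hom.exists_extension h.inj)
    hom := hX.hom.coker (b.dualIsHom hs) h
    ext_dual := hX.ext_dual.ker extVanish_of_projective hd
    hom_dual := hX.hom_dual.ker ((b.dual hs).dualIsHom hs.op) hd
      (hX.ext_dual.exists_extension hd) }

theorem extension {i : X →ₗ[R] P} {p : P →ₗ[R] M} (hX : IsBiperfect hs X)
    (hM : IsBiperfect hs M) (h : IsShortExact i p) : IsBiperfect hs P where
  ext := hX.ext.extension hM.ext h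
  hom := hX.hom.extension hM.hom h
  ext_dual := hM.ext_dual.extension hX.ext_dual (h.dual K)
  hom_dual := hM.hom_dual.extension hX.hom_dual (h.dual K)

theorem of_retract (hM : IsBiperfect hs M) (i : X →ₗ[R] M) (r : M →ₗ[R] X)
    (hri : ∀ x, r (i x) = x) : IsBiperfect hs X := by
  have hd (F) : dMap K i (dMap K r F) = F := dual_ext K fun x => by
    rw [dEquiv_dMap, dEquiv_dMap, hri]
  exact {
    ext := hM.ext.of_retract i r hri
    hom := hM.hom.of_retract i r hri
    ext_dual := hM.ext_dual.of_retract _ _ hd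
    hom_dual := hM.hom_dual.of_retract _ _ hd }

theorem of_linearEquiv (hM : IsBiperfect hs M) (i : X ≃ₗ[R] M) : IsBiperfect hs X :=
  hM.of_retract i.toLinearMap i.symm.toLinearMap (by simp)

end IsBiperfect

theorem IsSymmIdempotent.dualToHom_flip_eq_iff (hs : IsSymmIdempotent e lam) {M : ModuleCat.{u} R}
    {m : M} {φ : D K M →ₗ[Rᵐᵒᵖ] Rᵐᵒᵖ} :
    hs.op.dualToHom (D K M) ((dEquiv K M).toLinearMap.flip m) = φ ↔
      ∀ y F, lam (y * (φ F).unop) = dEquiv K M F ((e * y) • m) := by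
  rw [dualToHom_eq_iff]
  exact ⟨fun h y F => h (MulOpposite.op y) F, fun h x F => h x.unop F⟩

theorem IsBiperfect.e_faithful {hs : IsSymmIdempotent e lam} {M : ModuleCat.{u} R}
    (hM : IsBiperfect hs M) (m : M) (hm : ∀ y, (e * y) • m = 0) : m = 0 := by
  have heval : (dEquiv K M).toLinearMap.flip m = 0 :=
    hM.hom_dual.1 <| (hs.dualToHom_flip_eq_iff (φ := 0)).2 (by simp [hm]) |>.trans
      (map_zero _).symm
  refine (Module.forall_dual_apply_eq_zero_iff K m).1 fun f => ?_
  simpa using LinearMap.congr_fun heval ((dEquiv K M).symm f)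

theorem DualIsHom.of_ringEquiv {hs : IsSymmIdempotent e lam} {M : ModuleCat.{u} R}
    (h : DualIsHom hs M) {S : Type u} [Ring S] [Algebra K S] {e' : S} {lam' : S →ₗ[K] K}
    (hs' : IsSymmIdempotent e' lam') (σ : R ≃+* S) (he : σ e = e')
    (hlam : ∀ r, lam' (σ r) = lam r) {N : ModuleCat.{u} S} (E : M ≃ₗ[K] N)
    (hE : ∀ (r : R) m, E (r • m) = σ r • E m) : DualIsHom hs' N := by
  constructor
  · refine (injective_iff_map_eq_zero _).2 fun f hf => ?_
    have : f ∘ₗ E.toLinearMap = 0 := h.1 <| (hs.dualToHom_eq_zero_iff.2 fun x m => by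
      rw [LinearMap.comp_apply, LinearEquiv.coe_coe, hE, map_mul, he,
        hs'.dualToHom_eq_zero_iff.1 hf]).trans (map_zero _).symm
    ext n
    simpa using LinearMap.congr_fun this (E.symm n)
  · intro φ
    obtain ⟨F, hF⟩ := h.2
      { toFun := fun m => σ.symm (φ (E m))
        map_add' := fun a b => by simp
        map_smul' := fun r a => by simp [hE] }
    refine ⟨F ∘ₗ E.symm.toLinearMap, hs'.dualToHom_eq_iff.2 fun x n => ?_⟩
    obtain ⟨x, rfl⟩ := σ.surjective x
    obtain ⟨m, rfl⟩ := E.surjective n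
    rw [← he, ← map_mul, ← hE, LinearMap.comp_apply, LinearEquiv.coe_coe,
      LinearEquiv.symm_apply_apply, ← hs.dualToHom_eq_iff.1 hF, ← hlam]
    simp

section Bidual

variable [FiniteDimensional K R] {hs : IsSymmIdempotent e lam} {M : ModuleCat.{u} R}
  [Module.Finite R M]

theorem dualIsHom_bidual : DualIsHom hs.op.op (D K (D K M)) ↔ DualIsHom hs M := by
  obtain ⟨E, hE⟩ : ∃ E : M ≃ₗ[K] D K (D K M), ∀ m, E m = evalDual K M m :=
    ⟨LinearEquiv.ofBijective (evalDual K M) (evalDual_bijective K M), fun _ => rfl⟩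
  have hsmul (r : R) (m : M) : E (r • m) = RingEquiv.opOp R r • E m := by
    rw [hE, hE, evalDual_smul]; rfl
  refine ⟨fun h => ?_, fun h => h.of_ringEquiv _ (RingEquiv.opOp R) rfl (fun _ => rfl) E hsmul⟩
  refine h.of_ringEquiv _ (RingEquiv.opOp R).symm rfl (fun _ => rfl) E.symm fun r F => ?_
  rw [LinearEquiv.symm_apply_eq, hsmul, RingEquiv.apply_symm_apply, LinearEquiv.apply_symm_apply]

theorem IsBiperfect.dual (hM : IsBiperfect hs M) : IsBiperfect hs.op (D K M) where
  ext := hM.ext_dual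
  hom := hM.hom_dual
  ext_dual := by
    refine ExtVanish.of_ringEquiv (RingEquiv.opOp R) ?_
    let E : M ≃ₗ[R] (ModuleCat.restrictScalars (RingEquiv.opOp R).toRingHom).obj (D K (D K M)) :=
      { (LinearEquiv.ofBijective (evalDual K M) (evalDual_bijective K M)).toAddEquiv with
        map_smul' := fun r m => evalDual_smul K r m }
    exact hM.ext.of_linearEquiv E.symm
  hom_dual := dualIsHom_bidual.2 hM.hom

end Bidual

/-- The natural map `M → Hom_{eRe}(eR, eM)` is bijective. A homomorphism `eR → eM` is encoded as a
`K`-linear map on `R` that factors through `y ↦ ey`. -/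
structure HomIsSelf (K : Type u) [Field K] [Algebra K R] (e : R) (M : ModuleCat.{u} R) : Prop where
  inj : ∀ m : M, (∀ y, (e * y) • m = 0) → m = 0
  surj : ∀ h : R →ₗ[K] M, (∀ y, h (e * y) = h y) → (∀ a y, h (e * a * e * y) = (e * a * e) • h y) →
    ∃ m, ∀ y, h y = (e * y) • m

section HomIsSelf

variable {M : ModuleCat.{u} R}

theorem exists_flip_eq [FiniteDimensional K M] (G : D K M →ₗ[K] K) :
    ∃ m, (dEquiv K M).toLinearMap.flip m = G := by
  obtain ⟨m, hm⟩ := (Module.evalEquiv K M).surjective (G ∘ₗ (dEquiv K M).symm.toLinearMap)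
  exact ⟨m, LinearMap.ext fun F => by simpa using LinearMap.congr_fun hm (dEquiv K M F)⟩

theorem IsSymmIdempotent.exists_dEquiv_apply_eq_lam (hs : IsSymmIdempotent e lam)
    [FiniteDimensional K M] (φ : D K M →ₗ[Rᵐᵒᵖ] Rᵐᵒᵖ) :
    ∃ h : R →ₗ[K] M, (∀ y F, dEquiv K M F (h y) = lam (e * y * (φ F).unop)) ∧
      (∀ y, h (e * y) = h y) ∧ ∀ a y, h (e * a * e * y) = (e * a * e) • h y := by
  let T : R →ₗ[K] (M →ₗ[K] K) →ₗ[K] K := LinearMap.mk₂ K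
    (fun y f => lam (e * y * (φ ((dEquiv K M).symm f)).unop))
    (fun y y' f => by simp [mul_add, add_mul])
    (fun k y f => by simp)
    (fun y f f' => by simp [mul_add])
    (fun k y f => by
      rw [map_smul, ← algebraMap_smul Rᵐᵒᵖ k, map_smul, algebraMap_smul]
      simp)
  let h : R →ₗ[K] M := (Module.evalEquiv K M).symm.toLinearMap ∘ₗ T
  have hh (y F) : dEquiv K M F (h y) = lam (e * y * (φ F).unop) := by
    have : Module.evalEquiv K M (h y) = T y := by simp [h]
    simpa [T] using LinearMap.congr_fun this (dEquiv K M F)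
  have separated {m n : M} (hmn : ∀ F : D K M, dEquiv K M F m = dEquiv K M F n) : m = n :=
    sub_eq_zero.1 <| (Module.forall_dual_apply_eq_zero_iff K _).1 fun f => by
      simpa [sub_eq_zero] using hmn ((dEquiv K M).symm f)
  have absorb (z) : e * (e * z) = e * z := by rw [← mul_assoc, hs.idem]
  refine ⟨h, hh, fun y => separated fun F => ?_, fun a y => separated fun F => ?_⟩
  · rw [hh, hh, absorb]
  · have : dEquiv K M F ((e * a * e) • h y) = dEquiv K M (MulOpposite.op (e * a * e) • F) (h y) :=
      rfl
    rw [this, hh, hh, map_smul, smul_eq_mul, MulOpposite.unop_mul, MulOpposite.unop_op,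
      ← mul_assoc (e * y), ← hs.symm]
    simp only [mul_assoc, absorb]

theorem HomIsSelf.dualIsHom (hs : IsSymmIdempotent e lam) [FiniteDimensional K M]
    (hM : HomIsSelf K e M) : DualIsHom hs.op (D K M) := by
  constructor
  · refine (injective_iff_map_eq_zero _).2 fun G hG => ?_
    obtain ⟨m, rfl⟩ := exists_flip_eq G
    have : m = 0 := hM.inj m fun y => (Module.forall_dual_apply_eq_zero_iff K _).1 fun f => by
      simpa using (hs.dualToHom_flip_eq_iff.1 hG y ((dEquiv K M).symm f)).symm
    rw [this, map_zero]
  · intro φ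
    obtain ⟨h, hh, h_e, h_smul⟩ := hs.exists_dEquiv_apply_eq_lam φ
    obtain ⟨m, hm⟩ := hM.surj h h_e h_smul
    exact ⟨_, hs.dualToHom_flip_eq_iff.2 fun y F => by
      rw [← hm, hh, mul_assoc, hs.lam_e_mul]⟩

theorem IsSymmIdempotent.exists_mul (hs : IsSymmIdempotent e lam) (h : R →ₗ[K] R)
    (h_e : ∀ y, h (e * y) = h y) (h_mul : ∀ a y, h (e * a * e * y) = e * a * e * h y) :
    ∃ a, ∀ y, h y = e * y * a := by
  let γ : R →ₗ[K] R →ₗ[K] K := (((LinearMap.mul K R).comp h).compr₂ lam).flip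
  have hγ (x y) : γ x y = lam (h y * x) := rfl
  obtain ⟨a, ha⟩ := hs.exists_form γ
    (fun x y => by rw [hγ, hγ, h_e, ← mul_assoc, hs.lam_mul_e])
    (fun a x y => by rw [hγ, hγ, h_mul, ← mul_assoc, ← hs.symm, ← mul_assoc])
  have e_mul (y) : e * h y = h y := by
    have := h_mul 1 y
    rwa [mul_one, hs.idem, h_e, eq_comm] at this
  refine ⟨a, fun y => sub_eq_zero.1 (hs.nondeg_right (h y - e * y * a) ?_ fun x => ?_)⟩
  · rw [mul_sub, e_mul, ← mul_assoc, ← mul_assoc, hs.idem]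
  · rw [sub_mul, map_sub, ← hγ, ha, mul_assoc e, mul_assoc e, hs.lam_e_mul, sub_self]

/-- The natural map `M → Hom(Hom(M, R), R)` is bijective. -/
structure IsReflexive (M : ModuleCat.{u} R) : Prop where
  inj : ∀ m : M, (∀ φ : M →ₗ[R] R, φ m = 0) → m = 0
  surj : ∀ χ : (M →ₗ[R] R) →ₗ[Rᵐᵒᵖ] R, ∃ m, ∀ φ, χ φ = φ m

theorem IsReflexive.homIsSelf (hs : IsSymmIdempotent e lam) (hM : IsReflexive M) :
    HomIsSelf K e M := by
  refine ⟨fun m hm => hM.inj m fun φ => hs.faithful_right _ fun y => ?_, fun h h_e h_smul => ?_⟩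
  · rw [← smul_eq_mul, ← map_smul, hm, map_zero]
  have exists_mul (φ : M →ₗ[R] R) : ∃ a : R, ∀ y, φ (h y) = e * y * a :=
    hs.exists_mul (φ.restrictScalars K ∘ₗ h) (fun y => by simp [h_e])
      (fun a y => by simp [h_smul])
  choose a ha using exists_mul
  have eq_of_forall_mul {x y : R} (hxy : ∀ z, e * z * x = e * z * y) : x = y :=
    sub_eq_zero.1 (hs.faithful_right _ fun z => by rw [mul_sub, hxy, sub_self])
  obtain ⟨m, hm⟩ := hM.surj
    { toFun := a
      map_add' := fun φ ψ => eq_of_forall_mul fun z => by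
        rw [← ha, LinearMap.add_apply, ha, ha, mul_add]
      map_smul' := fun r φ => eq_of_forall_mul fun z => by
        rw [← ha, LinearMap.smul_apply, ha]
        simp [mul_assoc] }
  change ∀ φ, a φ = φ m at hm
  refine ⟨m, fun y => sub_eq_zero.1 (hM.inj _ fun φ => ?_)⟩
  rw [map_sub, ha, hm, map_smul, smul_eq_mul, sub_self]

end HomIsSelf

section Transpose

variable {P M : ModuleCat.{u} R}

theorem DualBasis.exists_eval (b : DualBasis e P) (χ : (P →ₗ[R] R) →ₗ[Rᵐᵒᵖ] R) :
    ∃ x : P, ∀ φ, χ φ = φ x := by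
  refine ⟨∑ i, χ (b.coord i) • b.gen i, fun φ => ?_⟩
  conv_lhs => rw [← b.eq_sum_coord φ]
  simp

theorem DualBasis.eq_of_forall_apply (b : DualBasis e P) {x y : P}
    (h : ∀ φ : P →ₗ[R] R, φ x = φ y) : x = y := by
  rw [← b.sum_coord x, ← b.sum_coord y]
  exact Finset.sum_congr rfl fun i _ => by rw [h]

theorem IsSuperfluous.eq_top_of_map_eq_top {P M : Type u} [AddCommGroup P] [Module R P]
    [AddCommGroup M] [Module R M] {π : P →ₗ[R] M} (h : IsSuperfluous (LinearMap.ker π))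
    {N : Submodule R P} (hN : N.map π = ⊤) : N = ⊤ :=
  h N (by rw [sup_comm, ← Submodule.comap_map_eq, hN, Submodule.comap_top])

theorem IsSuperfluous.finite [Module.Finite R M] {π : P →ₗ[R] M}
    (h : IsSuperfluous (LinearMap.ker π)) (hπ : Function.Surjective π) : Module.Finite R P := by
  obtain ⟨n, g, hg⟩ := Module.Finite.exists_fin' R M
  obtain ⟨k, rfl⟩ := Module.projective_lifting_property π g hπ
  have : LinearMap.range k = ⊤ := h.eq_top_of_map_eq_top (by
    rw [← LinearMap.range_comp, LinearMap.range_eq_top.2 hg])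
  exact Module.Finite.of_surjective k (LinearMap.range_eq_top.1 this)

theorem nonempty_dualBasis_one (K : Type u) [Field K] [Algebra K R] [FiniteDimensional K R]
    [Module.Finite R P] [Module.Projective R P] : Nonempty (DualBasis (1 : R) P) :=
  nonempty_dualBasis_of_span K (one_mul 1) (by simp)

theorem ExtVanish.exists_factor_and_exists_extension {X Q₀ Q₁ Y : ModuleCat.{u} R}
    {ι : X →ₗ[R] Q₀} {δ : Q₀ →ₗ[R] Q₁} [Module.Projective R Q₁] (hι : Function.Injective ι)
    (hιδ : Function.Exact ι δ)
    (h : ExtVanish (ModuleCat.of R (Q₁ ⧸ LinearMap.range δ)) Y) :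
    (∀ χ : Q₀ →ₗ[R] Y, (∀ x, χ (ι x) = 0) → ∃ Ψ : Q₁ →ₗ[R] Y, ∀ q, Ψ (δ q) = χ q) ∧
      ∀ χ : X →ₗ[R] Y, ∃ Ψ : Q₀ →ₗ[R] Y, ∀ x, Ψ (ι x) = χ x := by
  have hrange := isShortExact_mkQ (LinearMap.range δ)
  have hker : IsShortExact ι δ.rangeRestrict := ⟨hι, δ.surjective_rangeRestrict, fun q => by
    rw [← hιδ q]
    exact Subtype.ext_iff⟩
  refine ⟨fun χ hχ => ?_, ?_⟩
  · obtain ⟨g, hg⟩ := hker.exists_factor χ hχ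
    obtain ⟨Ψ, hΨ⟩ := h.exists_extension (K := ModuleCat.of R (LinearMap.range δ)) hrange g
    exact ⟨Ψ, fun q => (hΨ (δ.rangeRestrict q)).trans (hg q)⟩
  · exact (h.ker (K := ModuleCat.of R (LinearMap.range δ)) extVanish_of_projective
      hrange).exists_extension hker

namespace MinProjPresentation

theorem function_exact (p : MinProjPresentation M) : Function.Exact p.d.hom p.π.hom :=
  LinearMap.exact_iff.2 p.exact.symm

theorem homToRing_exact (p : MinProjPresentation M) :
    Function.Exact (homToRing p.π) (homToRing p.d) := by
  refine fun φ => ⟨fun hφ => ?_, ?_⟩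
  · obtain ⟨ψ, hψ⟩ := exists_factor p.π.hom p.surjective φ fun x hx => by
      obtain ⟨y, rfl⟩ := (p.function_exact x).1 hx
      exact LinearMap.congr_fun hφ y
    exact ⟨ψ, LinearMap.ext hψ⟩
  · rintro ⟨ψ, rfl⟩
    ext x
    exact (congrArg ψ (p.function_exact.apply_apply_eq_zero x)).trans (map_zero ψ)

theorem homToRing_injective (p : MinProjPresentation M) : Function.Injective (homToRing p.π) :=
  fun _ _ h => LinearMap.ext <| p.surjective.forall.2 (LinearMap.congr_fun h)

variable [Module.Finite R M]

theorem finite₀ (p : MinProjPresentation M) : Module.Finite R p.P₀ :=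
  p.superfluous₀.finite p.surjective

theorem finite₁ (K : Type u) [Field K] [Algebra K R] [FiniteDimensional K R]
    (p : MinProjPresentation M) : Module.Finite R p.P₁ := by
  have := p.finite₀
  have := IsNoetherianRing.of_finite K R
  refine IsSuperfluous.finite (M := ModuleCat.of R (LinearMap.range p.d.hom))
    (π := p.d.hom.rangeRestrict) ?_ p.d.hom.surjective_rangeRestrict
  rw [LinearMap.ker_rangeRestrict]
  exact p.superfluous₁

theorem isReflexive (K : Type u) [Field K] [Algebra K R] [FiniteDimensional K R]
    (p : MinProjPresentation M) (h : ExtVanish p.Tr (ModuleCat.of Rᵐᵒᵖ R)) : IsReflexive M := by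
  have := p.finite₀
  have := p.finite₁ K
  have := p.projective₀
  have := p.projective₁
  obtain ⟨b₀⟩ := nonempty_dualBasis_one K (P := p.P₀)
  obtain ⟨b₁⟩ := nonempty_dualBasis_one K (P := p.P₁)
  have := b₁.hom.projective
  obtain ⟨factor, extend⟩ := ExtVanish.exists_factor_and_exists_extension
    (X := ModuleCat.of Rᵐᵒᵖ (M →ₗ[R] R)) (Q₀ := ModuleCat.of Rᵐᵒᵖ (p.P₀ →ₗ[R] R))
    (Q₁ := ModuleCat.of Rᵐᵒᵖ (p.P₁ →ₗ[R] R)) (Y := ModuleCat.of Rᵐᵒᵖ R)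
    p.homToRing_injective p.homToRing_exact h
  refine ⟨p.surjective.forall.2 fun q hq => ?_, fun χ => ?_⟩
  · obtain ⟨Ψ, hΨ⟩ := factor (LinearMap.applyₗ' Rᵐᵒᵖ q) hq
    obtain ⟨q₁, hq₁⟩ := b₁.exists_eval Ψ
    have : q = p.d.hom q₁ := b₀.eq_of_forall_apply fun φ =>
      (hΨ φ).symm.trans (hq₁ (homToRing p.d φ))
    rw [this, p.function_exact.apply_apply_eq_zero]
  · obtain ⟨Ψ, hΨ⟩ := extend χ
    obtain ⟨q, hq⟩ := b₀.exists_eval Ψ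
    exact ⟨p.π.hom q, fun φ => (hΨ φ).symm.trans (hq (homToRing p.π φ))⟩

end MinProjPresentation

variable [FiniteDimensional K R] [Module.Finite R M]

theorem IsGorensteinProjective.dualIsHom_dual (hs : IsSymmIdempotent e lam)
    (hM : IsGorensteinProjective M) : DualIsHom hs.op (D K M) := by
  obtain ⟨-, p, hp⟩ := hM
  have := finiteDimensional_of_finite K M
  exact ((p.isReflexive K hp).homIsSelf hs).dualIsHom hs

theorem IsGorensteinProjInj.isBiperfect (hs : IsSymmIdempotent e lam)
    (hM : IsGorensteinProjInj K M) : IsBiperfect hs M where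
  ext := hM.1.1
  hom := dualIsHom_bidual.1 (hM.2.dualIsHom_dual hs.op)
  ext_dual := hM.2.1
  hom_dual := hM.1.dualIsHom_dual hs

end Transpose

end GorensteinProjInj

section Covers

variable {R : Type*} [Ring R] {P M : Type*} [AddCommGroup P] [Module R P] [AddCommGroup M]
  [Module R M]

theorem exists_isCompl_ker_pow_range_pow [IsArtinian R M] [IsNoetherian R M] (f : M →ₗ[R] M) :
    ∃ n, 0 < n ∧ IsCompl (LinearMap.ker (f ^ n)) (LinearMap.range (f ^ n)) :=
  ((Filter.eventually_gt_atTop 0).and f.eventually_isCompl_ker_pow_range_pow).exists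

theorem exists_retraction {U V : Submodule R M} (h : IsCompl U V) :
    ∃ r : M →ₗ[R] V, (∀ v : V, r v = v) ∧ ∀ u ∈ U, r u = 0 :=
  ⟨V.projectionOnto U h.symm, fun v => Submodule.projectionOnto_apply_left h.symm v,
    fun u hu => Submodule.projectionOnto_apply_right h.symm ⟨u, hu⟩⟩

theorem exists_summand_le_ker [IsArtinian R P] [IsNoetherian R P] [Module.Projective R P]
    (p : P →ₗ[R] M) {L : Submodule R P} (hL : LinearMap.ker p ⊔ L = ⊤) (hL' : L ≠ ⊤) :
    ∃ U V : Submodule R P, IsCompl U V ∧ U ≤ LinearMap.ker p ∧ U ≠ ⊥ := by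
  let q : L →ₗ[R] LinearMap.range p := p.rangeRestrict ∘ₗ L.subtype
  have hq : Function.Surjective q := by
    rintro ⟨_, x, rfl⟩
    obtain ⟨k, hk, l, hl, rfl⟩ := Submodule.mem_sup.1 (hL ▸ Submodule.mem_top : x ∈ _ ⊔ L)
    exact ⟨⟨l, hl⟩, Subtype.ext (by simp [q, LinearMap.mem_ker.1 hk])⟩
  obtain ⟨t, ht⟩ := Module.projective_lifting_property q p.rangeRestrict hq
  -- The Fitting decomposition of an endomorphism of `P` over `M` with image in `L`.
  let α : P →ₗ[R] P := L.subtype ∘ₗ t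
  have p_pow (n) (x) : p ((α ^ n) x) = p x := by
    induction n with
    | zero => rfl
    | succ n ih =>
      rw [pow_succ', Module.End.mul_apply, ← ih]
      exact congrArg Subtype.val (LinearMap.congr_fun ht _)
  obtain ⟨n, hn, hc⟩ := exists_isCompl_ker_pow_range_pow α
  refine ⟨_, _, hc, fun x hx => ?_, fun h0 => hL' (eq_top_iff.2 ?_)⟩
  · rw [LinearMap.mem_ker, ← p_pow n, LinearMap.mem_ker.1 hx, map_zero]
  · rw [← eq_top_of_bot_isCompl (h0 ▸ hc), LinearMap.range_le_iff_comap, eq_top_iff]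
    intro x _
    rw [Submodule.mem_comap, ← Nat.succ_pred_eq_of_pos hn, pow_succ']
    exact (t _).2

theorem exists_summand_ge_range {Q M : Type u} [AddCommGroup Q] [Module R Q] [AddCommGroup M]
    [Module R M] [IsArtinian R Q]
    [IsNoetherian R Q] [Module.Injective R Q] {i : M →ₗ[R] Q} (hi : Function.Injective i)
    {L : Submodule R Q} (hL : LinearMap.range i ⊓ L = ⊥) (hL' : L ≠ ⊥) :
    ∃ U V : Submodule R Q, IsCompl U V ∧ LinearMap.range i ≤ V ∧ U ≠ ⊥ := by
  have hinj : Function.Injective (L.mkQ ∘ₗ i) := by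
    rw [← LinearMap.ker_eq_bot, LinearMap.ker_comp, Submodule.ker_mkQ, eq_bot_iff]
    intro m hm
    have : i m ∈ LinearMap.range i ⊓ L := ⟨⟨m, rfl⟩, hm⟩
    rw [hL, Submodule.mem_bot] at this
    exact hi (this.trans (map_zero i).symm)
  obtain ⟨β, hβ⟩ := Module.Injective.out (L.mkQ ∘ₗ i) hinj i
  -- The Fitting decomposition of an endomorphism of `Q` under `M` vanishing on `L`.
  let α : Q →ₗ[R] Q := β ∘ₗ L.mkQ
  have pow_i (n) (m) : (α ^ n) (i m) = i m := by
    induction n with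
    | zero => rfl
    | succ n ih => rw [pow_succ', Module.End.mul_apply, ih]; exact hβ m
  obtain ⟨n, hn, hc⟩ := exists_isCompl_ker_pow_range_pow α
  refine ⟨_, _, hc, ?_, fun h0 => hL' (eq_bot_iff.2 (h0 ▸ fun x hx => ?_))⟩
  · rintro _ ⟨m, rfl⟩
    exact ⟨i m, pow_i n m⟩
  · have : α x = 0 := by simp [α, (Submodule.Quotient.mk_eq_zero L).2 hx]
    rw [LinearMap.mem_ker, ← Nat.succ_pred_eq_of_pos hn, pow_succ, Module.End.mul_apply, this,
      map_zero]

end Covers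

section MinimalPresentation

variable {R : Type u} [Ring R] {M : ModuleCat.{u} R}

theorem surjective_comp_subtype_of_isCompl {P : ModuleCat.{u} R} {π : P →ₗ[R] M}
    {U V : Submodule R P} (hUV : IsCompl U V) (hU : U ≤ LinearMap.ker π)
    (hπ : Function.Surjective π) : Function.Surjective (π ∘ₗ V.subtype) := by
  rw [← LinearMap.range_eq_top, LinearMap.range_comp, Submodule.range_subtype, eq_top_iff,
    ← LinearMap.range_eq_top.2 hπ, LinearMap.range_eq_map, ← hUV.sup_eq_top, Submodule.map_sup,
    (LinearMap.le_ker_iff_map ..).1 hU, bot_sup_eq]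

variable [IsArtinianRing R]

theorem exists_isSuperfluous_ker (P : ModuleCat.{u} R) [Module.Finite R P]
    [Module.Projective R P] {π : P →ₗ[R] M} (hπ : Function.Surjective π) :
    ∃ (Q : ModuleCat.{u} R) (ρ : Q →ₗ[R] M), Module.Finite R Q ∧ Module.Projective R Q ∧
      Function.Surjective ρ ∧ IsSuperfluous (LinearMap.ker ρ) := by
  induction hn : Module.length R P using WellFoundedLT.induction generalizing P with | ind n ih
  by_cases h : IsSuperfluous (LinearMap.ker π)
  · exact ⟨P, π, ‹_›, ‹_›, hπ, h⟩
  simp only [IsSuperfluous, not_forall] at h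
  obtain ⟨L, hL, hL'⟩ := h
  obtain ⟨U, V, hUV, hU, hU'⟩ := exists_summand_le_ker π hL hL'
  obtain ⟨r, hr, -⟩ := exists_retraction hUV
  have := Module.Finite.of_surjective r fun v => ⟨v, hr v⟩
  have := Module.Projective.of_split V.subtype r (LinearMap.ext hr)
  have hV : V ≠ ⊤ := fun hV => hU' (eq_bot_of_isCompl_top (hV ▸ hUV))
  exact ih _ (hn ▸ Submodule.length_lt hV) (ModuleCat.of R V)
    (surjective_comp_subtype_of_isCompl hUV hU hπ) rfl

variable [Module.Finite R M]

variable (M) in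
theorem exists_projectiveCover :
    ∃ (P : ModuleCat.{u} R) (π : P →ₗ[R] M), Module.Finite R P ∧ Module.Projective R P ∧
      Function.Surjective π ∧ IsSuperfluous (LinearMap.ker π) := by
  obtain ⟨n, f, hf⟩ := Module.Finite.exists_fin' R M
  have : Module.Finite R (ModuleCat.of R (Fin n → R)) :=
    inferInstanceAs (Module.Finite R (Fin n → R))
  have : Module.Projective R (ModuleCat.of R (Fin n → R)) :=
    inferInstanceAs (Module.Projective R (Fin n → R))
  exact exists_isSuperfluous_ker (ModuleCat.of R (Fin n → R)) hf

variable (M) in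
theorem nonempty_minProjPresentation : Nonempty (MinProjPresentation M) := by
  obtain ⟨P₀, π, _, hP₀, hπ, hs⟩ := exists_projectiveCover M
  obtain ⟨P₁, ρ, -, hP₁, hρ, hs'⟩ := exists_projectiveCover (ModuleCat.of R (LinearMap.ker π))
  have hker : LinearMap.ker ((LinearMap.ker π).subtype ∘ₗ ρ) = LinearMap.ker ρ :=
    LinearMap.ker_comp_of_ker_eq_bot _ (Submodule.ker_subtype _)
  have hrange : LinearMap.range ((LinearMap.ker π).subtype ∘ₗ ρ) = LinearMap.ker π := by
    rw [LinearMap.range_comp_of_range_eq_top _ (LinearMap.range_eq_top.2 hρ),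
      Submodule.range_subtype]
  exact ⟨P₁, P₀, ModuleCat.ofHom ((LinearMap.ker π).subtype ∘ₗ ρ), ModuleCat.ofHom π, hP₁, hP₀,
    hπ, hrange, hs, hker.symm ▸ hs'⟩

end MinimalPresentation

section Syzygy

variable {K : Type u} [Field K] {R : Type u} [Ring R] [Algebra K R] {e : R} {lam : R →ₗ[K] K}
  {hs : IsSymmIdempotent e lam} {M P : ModuleCat.{u} R}

theorem DualIsHom.span_eq_top (hM : DualIsHom hs M) :
    Submodule.span R (Set.range fun x : M => e • x) = ⊤ := by
  by_contra h
  have h' : (Submodule.span R (Set.range fun x : M => e • x)).restrictScalars K < ⊤ := by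
    rw [lt_top_iff_ne_top]
    simpa using h
  obtain ⟨f, hf, hle⟩ := Submodule.exists_le_ker_of_lt_top _ h'
  refine hf (hM.1 ((hs.dualToHom_eq_zero_iff.2 fun x m => hle ?_).trans (map_zero _).symm))
  rw [mul_smul]
  exact Submodule.smul_mem _ x (Submodule.subset_span ⟨m, rfl⟩)

theorem IsSuperfluous.span_eq_top {π : P →ₗ[R] M} (h : IsSuperfluous (LinearMap.ker π))
    (hπ : Function.Surjective π) (hM : Submodule.span R (Set.range fun x : M => e • x) = ⊤) :
    Submodule.span R (Set.range fun x : P => e • x) = ⊤ := by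
  refine h.eq_top_of_map_eq_top ?_
  rw [Submodule.map_span, ← Set.range_comp, ← hM, ← hπ.range_comp]
  simp only [Function.comp_def, map_smul]

theorem DualIsHom.nonempty_dualBasis [FiniteDimensional K R] [Module.Finite R M]
    [Module.Projective R P] (hM : DualIsHom hs M) {π : P →ₗ[R] M}
    (h : IsSuperfluous (LinearMap.ker π)) (hπ : Function.Surjective π) :
    Nonempty (DualBasis e P) := by
  have := h.finite hπ
  exact nonempty_dualBasis_of_span K hs.idem (h.span_eq_top hπ hM.span_eq_top)

theorem dMap_exact {L P₀ P₁ : ModuleCat.{u} R} {ι : L →ₗ[R] P₁} {d : P₁ →ₗ[R] P₀}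
    (h : Function.Exact ι d) : Function.Exact (dMap K d) (dMap K ι) := by
  have : Function.Exact (d.restrictScalars K).dualMap (ι.restrictScalars K).dualMap := by
    rw [LinearMap.exact_iff, LinearMap.ker_dualMap_eq_dualAnnihilator_range,
      LinearMap.range_dualMap_eq_dualAnnihilator_ker]
    exact (congrArg Submodule.dualAnnihilator ((LinearMap.exact_iff
      (f := ι.restrictScalars K) (g := d.restrictScalars K)).1 h)).symm
  exact this

theorem nonempty_coker_equiv_dual {P₀ P₁ L : ModuleCat.{u} R} (h₀ : DualIsHom hs P₀)
    (h₁ : DualIsHom hs P₁) (d : P₁ ⟶ P₀) {ι : L →ₗ[R] P₁} (hι : Function.Injective ι)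
    (hex : Function.Exact ι d.hom) :
    Nonempty (((P₁ →ₗ[R] R) ⧸ LinearMap.range (homToRing d)) ≃ₗ[Rᵐᵒᵖ] D K L) := by
  have hcomm : h₁.dualEquivHom.toLinearMap ∘ₗ dMap K d.hom =
      homToRing d ∘ₗ h₀.dualEquivHom.toLinearMap :=
    LinearMap.ext fun F => hs.dualToHom_comp (dEquiv K P₀ F) d.hom
  have hrange : (LinearMap.range (dMap K d.hom)).map h₁.dualEquivHom.toLinearMap =
      LinearMap.range (homToRing d) := by
    rw [← LinearMap.range_comp, hcomm, LinearMap.range_comp_of_range_eq_top _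
      (LinearMap.range_eq_top.2 h₀.dualEquivHom.surjective)]
  exact ⟨((Submodule.Quotient.equiv _ _ h₁.dualEquivHom hrange).symm.trans
    (Submodule.quotEquivOfEq _ _ (LinearMap.exact_iff.1 (dMap_exact hex)).symm)).trans
    ((dMap K ι).quotKerEquivOfSurjective ((isShortExact_range hι).dual K
      (M := ModuleCat.of R (P₁ ⧸ LinearMap.range ι))).surj)⟩

namespace MinProjPresentation

/-- The projective cover `P₁ → ker (P₀ → M)`. -/
def toSyzygy (p : MinProjPresentation M) : p.P₁ →ₗ[R] LinearMap.ker p.π.hom :=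
  p.d.hom.codRestrict _ p.function_exact.apply_apply_eq_zero

theorem ker_toSyzygy (p : MinProjPresentation M) :
    LinearMap.ker p.toSyzygy = LinearMap.ker p.d.hom :=
  LinearMap.ker_codRestrict _ _ _

theorem toSyzygy_surjective (p : MinProjPresentation M) : Function.Surjective p.toSyzygy := by
  rintro ⟨y, hy⟩
  obtain ⟨x, rfl⟩ := (p.function_exact y).1 hy
  exact ⟨x, rfl⟩

theorem isShortExact_toSyzygy (p : MinProjPresentation M) :
    IsShortExact (LinearMap.ker p.d.hom).subtype p.toSyzygy :=
  p.ker_toSyzygy ▸ isShortExact_ker p.toSyzygy_surjective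

end MinProjPresentation

namespace IsBiperfect

variable [FiniteDimensional K R] [Module.Finite R M]

theorem nonempty_dualBasis₀ (hM : IsBiperfect hs M) (p : MinProjPresentation M) :
    Nonempty (DualBasis e p.P₀) :=
  have := p.projective₀
  hM.hom.nonempty_dualBasis p.superfluous₀ p.surjective

theorem ker_π (hM : IsBiperfect hs M) (p : MinProjPresentation M) :
    IsBiperfect hs (ModuleCat.of R (LinearMap.ker p.π.hom)) := by
  obtain ⟨b₀⟩ := hM.nonempty_dualBasis₀ p
  exact hM.ker (X := ModuleCat.of R (LinearMap.ker p.π.hom)) (isShortExact_ker p.surjective) b₀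

theorem nonempty_dualBasis₁ (hM : IsBiperfect hs M) (p : MinProjPresentation M) :
    Nonempty (DualBasis e p.P₁) := by
  have := IsNoetherianRing.of_finite K R
  have := p.projective₁
  have := p.finite₀
  exact (hM.ker_π p).hom.nonempty_dualBasis (π := p.toSyzygy)
    (p.ker_toSyzygy ▸ p.superfluous₁) p.toSyzygy_surjective

theorem ker_d (hM : IsBiperfect hs M) (p : MinProjPresentation M) :
    IsBiperfect hs (ModuleCat.of R (LinearMap.ker p.d.hom)) := by
  obtain ⟨b₁⟩ := hM.nonempty_dualBasis₁ p
  exact (hM.ker_π p).ker (X := ModuleCat.of R (LinearMap.ker p.d.hom)) p.isShortExact_toSyzygy b₁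

theorem nonempty_tr_equiv (hM : IsBiperfect hs M) (p : MinProjPresentation M) :
    Nonempty (p.Tr ≃ₗ[Rᵐᵒᵖ] D K (ModuleCat.of R (LinearMap.ker p.d.hom))) := by
  obtain ⟨b₀⟩ := hM.nonempty_dualBasis₀ p
  obtain ⟨b₁⟩ := hM.nonempty_dualBasis₁ p
  exact nonempty_coker_equiv_dual (L := ModuleCat.of R (LinearMap.ker p.d.hom))
    (b₀.dualIsHom hs) (b₁.dualIsHom hs) p.d (ι := (LinearMap.ker p.d.hom).subtype)
    Subtype.val_injective (LinearMap.exact_subtype_ker_map _)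

theorem isGorensteinProjective (hM : IsBiperfect hs M) : IsGorensteinProjective M := by
  have := IsArtinianRing.of_finite K R
  obtain ⟨p⟩ := nonempty_minProjPresentation M
  obtain ⟨E⟩ := hM.nonempty_tr_equiv p
  let op : R ≃ₗ[Rᵐᵒᵖ] Rᵐᵒᵖ :=
    { MulOpposite.opAddEquiv with map_smul' := fun r x => rfl }
  exact ⟨hM.ext, p, ((hM.ker_d p).ext_dual.of_linearEquiv E).of_coeff_linearEquiv
    (Z := ModuleCat.of Rᵐᵒᵖ R) op⟩

theorem isGorensteinProjInj (hM : IsBiperfect hs M) : IsGorensteinProjInj K M :=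
  ⟨hM.isGorensteinProjective, hM.dual.isGorensteinProjective⟩

theorem isTau (hM : IsBiperfect hs M) (p : MinProjPresentation M) :
    IsTau K M (ModuleCat.of R (LinearMap.ker p.d.hom)) := by
  have := IsNoetherianRing.of_finite K R
  have := p.finite₁ K
  obtain ⟨E⟩ := hM.nonempty_tr_equiv p
  generalize hL : ModuleCat.of R (LinearMap.ker p.d.hom) = L at E ⊢
  have : Module.Finite R L := hL ▸ inferInstanceAs (Module.Finite R (LinearMap.ker p.d.hom))
  let T : L →ₗ[R] (ModuleCat.restrictScalars (RingEquiv.opOp R).toRingHom).obj (D K p.Tr) :=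
    { toFun := fun l => dMap K E.toLinearMap (evalDual K L l)
      map_add' := fun a b => by rw [map_add, map_add]; rfl
      map_smul' := fun r a => by rw [evalDual_smul, map_smul]; rfl }
  have hE : Function.Bijective (dMap K E.toLinearMap) :=
    Function.bijective_iff_has_inverse.2 ⟨dMap K E.symm.toLinearMap,
      fun F => dual_ext K fun x => by simp [dEquiv_dMap],
      fun F => dual_ext K fun x => by simp [dEquiv_dMap]⟩
  exact ⟨p, ⟨LinearEquiv.toModuleIso
    (LinearEquiv.ofBijective T (hE.comp (evalDual_bijective K L)))⟩⟩

end IsBiperfect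

end Syzygy

section LocalModules

variable {R : Type u} [Ring R] {M N P Q X : Type u} [AddCommGroup M] [Module R M]
  [AddCommGroup N] [Module R N] [AddCommGroup P] [Module R P] [AddCommGroup Q] [Module R Q]
  [AddCommGroup X] [Module R X]

/-- The linear map `f` is a split monomorphism. -/
def HasRetraction (f : M →ₗ[R] N) : Prop := ∃ r : N →ₗ[R] M, ∀ x, r (f x) = x

/-- The linear map `f` is a split epimorphism. -/
def HasSection (f : M →ₗ[R] N) : Prop := ∃ s : N →ₗ[R] M, ∀ x, f (s x) = x

theorem isSplitMono_iff {M N : ModuleCat.{u} R} (f : M ⟶ N) :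
    IsSplitMono f ↔ HasRetraction f.hom := by
  constructor
  · rintro ⟨⟨s⟩⟩
    exact ⟨s.retraction.hom, fun x => congrArg (fun g => g.hom x) s.id⟩
  · rintro ⟨r, hr⟩
    exact ⟨⟨⟨ModuleCat.ofHom r, by ext x; exact hr x⟩⟩⟩

theorem isSplitEpi_iff {M N : ModuleCat.{u} R} (f : M ⟶ N) :
    IsSplitEpi f ↔ HasSection f.hom := by
  constructor
  · rintro ⟨⟨s⟩⟩
    exact ⟨s.section_.hom, fun x => congrArg (fun g => g.hom x) s.id⟩
  · rintro ⟨r, hr⟩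
    exact ⟨⟨⟨ModuleCat.ofHom r, by ext x; exact hr x⟩⟩⟩

variable (R M) in
/-- The module `M` is nonzero, and each of its endomorphisms is nilpotent or bijective. By
Fitting's lemma these are the indecomposable modules among the modules of finite length. -/
def IsLocalModule : Prop :=
  Nontrivial M ∧ ∀ f : Module.End R M, IsNilpotent f ∨ Function.Bijective f

theorem isNilpotent_of_injective {i : P →ₗ[R] M} (hi : Function.Injective i)
    {f : Module.End R P} {g : Module.End R M} (h : g ∘ₗ i = i ∘ₗ f) (hg : IsNilpotent g) :
    IsNilpotent f := by
  obtain ⟨n, hn⟩ := hg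
  refine ⟨n, LinearMap.ext fun x => hi ?_⟩
  rw [← LinearMap.comp_apply, ← Module.End.commute_pow_left_of_commute h, hn]
  simp

theorem isNilpotent_of_surjective {p : P →ₗ[R] M} (hp : Function.Surjective p)
    {f : Module.End R P} {g : Module.End R M} (h : g ∘ₗ p = p ∘ₗ f) (hf : IsNilpotent f) :
    IsNilpotent g := by
  obtain ⟨n, hn⟩ := hf
  refine ⟨n, LinearMap.ext fun x => ?_⟩
  obtain ⟨x, rfl⟩ := hp x
  rw [← LinearMap.comp_apply, Module.End.commute_pow_left_of_commute h, hn]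
  simp

namespace IsLocalModule

theorem of_linearEquiv (E : M ≃ₗ[R] N) (h : IsLocalModule R M) : IsLocalModule R N := by
  refine ⟨have := h.1; E.symm.toEquiv.nontrivial, fun f => ?_⟩
  have hf : f ∘ₗ E.toLinearMap = E.toLinearMap ∘ₗ (E.symm.toLinearMap ∘ₗ f ∘ₗ E.toLinearMap) := by
    ext x
    simp
  refine (h.2 (E.symm.toLinearMap ∘ₗ f ∘ₗ E.toLinearMap)).imp
    (isNilpotent_of_surjective E.surjective hf) fun hb => ?_
  have := E.bijective.comp hb
  rw [← LinearEquiv.coe_coe, ← LinearMap.coe_comp, ← hf] at this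
  exact (Function.Bijective.of_comp_iff f E.bijective).1 this

theorem bijective_of_retract (h : IsLocalModule R M) [Nontrivial X] {i : X →ₗ[R] M}
    {r : M →ₗ[R] X} (hri : ∀ x, r (i x) = x) : Function.Bijective i := by
  have hi : Function.Injective i := Function.LeftInverse.injective hri
  refine ⟨hi, (h.2 (i ∘ₗ r)).elim (fun hnil => ?_) fun hb => .of_comp hb.2⟩
  have h₁ : IsNilpotent (1 : Module.End R X) :=
    isNilpotent_of_injective hi (LinearMap.ext fun x => congrArg i (hri x)) hnil
  exact absurd h₁ not_isNilpotent_one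

theorem isLocalRing (h : IsLocalModule R M) : IsLocalRing (Module.End R M) :=
  have := h.1
  .of_isUnit_or_isUnit_one_sub_self fun f =>
    (h.2 f).symm.imp (Module.End.isUnit_iff f).2 IsNilpotent.isUnit_one_sub

theorem add_not_bijective (h : IsLocalModule R M) {f g : Module.End R M}
    (hf : ¬ Function.Bijective f) (hg : ¬ Function.Bijective g) :
    ¬ Function.Bijective (f + g) := by
  have := h.isLocalRing
  rw [← Module.End.isUnit_iff] at *
  exact IsLocalRing.nonunits_add hf hg

end IsLocalModule

theorem indecomposable_of_isIdempotentElem {M : ModuleCat.{u} R} [Nontrivial M]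
    (h : ∀ f : Module.End R M, IsIdempotentElem f → f = 0 ∨ f = 1) : Indecomposable M := by
  refine ⟨fun hz => ?_, fun Y Z φ => ?_⟩
  · have := ModuleCat.subsingleton_of_isZero hz
    exact not_subsingleton M this
  let f := φ.hom ≫ Limits.biprod.fst ≫ Limits.biprod.inl ≫ φ.inv
  have hf : f ≫ f = f := by simp [f]
  rcases h f.hom (congrArg ModuleCat.Hom.hom hf) with h | h
  · left
    have hf₀ : f = 0 := ModuleCat.hom_ext h
    have hY : Limits.biprod.inl ≫ φ.inv ≫ f ≫ φ.hom ≫ Limits.biprod.fst = 𝟙 Y := by simp [f]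
    rw [Limits.IsZero.iff_id_eq_zero, ← hY, hf₀]
    simp
  · right
    have hf₁ : f = 𝟙 M := ModuleCat.hom_ext h
    have hZ : Limits.biprod.inr ≫ φ.inv ≫ f ≫ φ.hom ≫ Limits.biprod.snd = (0 : Z ⟶ Z) := by
      simp [f]
    rw [hf₁] at hZ
    rw [Limits.IsZero.iff_id_eq_zero]
    simpa using hZ

theorem eq_zero_or_eq_one_of_isIdempotentElem {M : ModuleCat.{u} R} (h : Indecomposable M)
    {f : Module.End R M} (hf : IsIdempotentElem f) : f = 0 ∨ f = 1 := by
  let E := (Submodule.prodEquivOfIsCompl _ _ (LinearMap.IsIdempotentElem.isCompl hf)).symm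
  refine (h.2 (ModuleCat.of R (LinearMap.range f)) (ModuleCat.of R (LinearMap.ker f))
    (E.toModuleIso ≪≫ (ModuleCat.biprodIsoProd (ModuleCat.of R (LinearMap.range f))
      (ModuleCat.of R (LinearMap.ker f))).symm)).imp (fun h => ?_) fun h => ?_
  · have : Subsingleton (LinearMap.range f) := ModuleCat.subsingleton_of_isZero h
    exact LinearMap.range_eq_bot.1 (Submodule.subsingleton_iff_eq_bot.1 this)
  · have : Subsingleton (LinearMap.ker f) := ModuleCat.subsingleton_of_isZero h
    have hker := LinearMap.ker_eq_bot.1 (Submodule.subsingleton_iff_eq_bot.1 this)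
    exact LinearMap.ext fun x => hker (LinearMap.congr_fun hf x)

theorem IsLocalModule.indecomposable {M : ModuleCat.{u} R} (h : IsLocalModule R M) :
    Indecomposable M :=
  have := h.1
  indecomposable_of_isIdempotentElem fun f hf => (h.2 f).imp hf.eq_zero_of_isNilpotent fun hb =>
    LinearMap.ext fun x => hb.1 (LinearMap.congr_fun hf x)

theorem isLocalModule_of_indecomposable {M : ModuleCat.{u} R} [IsArtinian R M] [IsNoetherian R M]
    (h : Indecomposable M) : IsLocalModule R M := by
  refine ⟨not_subsingleton_iff_nontrivial.1 fun hM => h.1 (ModuleCat.isZero_of_subsingleton M),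
    fun f => ?_⟩
  obtain ⟨n, hn, hc⟩ := exists_isCompl_ker_pow_range_pow f
  obtain ⟨r, hr, hr'⟩ := exists_retraction hc
  have hidem : IsIdempotentElem
      ((LinearMap.range (f ^ n)).subtype ∘ₗ r : Module.End R M) :=
    LinearMap.ext fun x => congrArg Subtype.val (hr (r x))
  rcases eq_zero_or_eq_one_of_isIdempotentElem h hidem with h | h
  · refine .inl ⟨n, LinearMap.ext fun x => ?_⟩
    exact (congrArg Subtype.val (hr ⟨_, x, rfl⟩)).symm.trans (LinearMap.congr_fun h _)
  · refine .inr (IsArtinian.bijective_of_injective_endomorphism f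
      ((injective_iff_map_eq_zero f).2 fun x hx => ?_))
    have hx' : x ∈ LinearMap.ker (f ^ n) := by
      rw [LinearMap.mem_ker, ← Nat.succ_pred_eq_of_pos hn, pow_succ, Module.End.mul_apply, hx,
        map_zero]
    rw [← Module.End.one_apply (R := R) x, ← h, LinearMap.comp_apply, hr' x hx', map_zero]

namespace IsSuperfluous

variable {π : P →ₗ[R] M} {g : Module.End R P} {k : Module.End R M}

theorem isNilpotent [IsArtinian R P] [IsNoetherian R P] (hπ : IsSuperfluous (LinearMap.ker π))
    (h : k ∘ₗ π = π ∘ₗ g) (hk : IsNilpotent k) : IsNilpotent g := by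
  obtain ⟨m, hm⟩ := hk
  obtain ⟨n, hmn, hc⟩ :=
    ((Filter.eventually_ge_atTop m).and g.eventually_isCompl_ker_pow_range_pow).exists
  refine ⟨n, LinearMap.ker_eq_top.1 (hπ _ (eq_top_iff.2 ?_))⟩
  rw [← hc.sup_eq_top, sup_comm]
  refine sup_le_sup_right (LinearMap.range_le_ker_iff.2 ?_) _
  rw [← Module.End.commute_pow_left_of_commute h, pow_eq_zero_of_le hmn hm, LinearMap.zero_comp]

theorem surjective (hπ : IsSuperfluous (LinearMap.ker π)) (hsurj : Function.Surjective π)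
    (h : k ∘ₗ π = π ∘ₗ g) (hk : Function.Surjective k) : Function.Surjective g := by
  refine LinearMap.range_eq_top.1 (hπ.eq_top_of_map_eq_top ?_)
  rw [← LinearMap.range_comp, ← h, LinearMap.range_comp_of_range_eq_top _
    (LinearMap.range_eq_top.2 hsurj), LinearMap.range_eq_top.2 hk]

end IsSuperfluous

namespace IsEssential

variable {i : M →ₗ[R] Q} {f : Module.End R M} {g : Module.End R Q}

theorem isNilpotent [IsArtinian R Q] [IsNoetherian R Q] (hi : IsEssential (LinearMap.range i))
    (h : g ∘ₗ i = i ∘ₗ f) (hf : IsNilpotent f) : IsNilpotent g := by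
  obtain ⟨m, hm⟩ := hf
  obtain ⟨n, hmn, hc⟩ :=
    ((Filter.eventually_ge_atTop m).and g.eventually_isCompl_ker_pow_range_pow).exists
  refine ⟨n, LinearMap.range_eq_bot.1 (hi _ (eq_bot_iff.2 ?_))⟩
  rw [← hc.inf_eq_bot]
  refine inf_le_inf_right _ (LinearMap.range_le_ker_iff.2 ?_)
  rw [Module.End.commute_pow_left_of_commute h, pow_eq_zero_of_le hmn hm, LinearMap.comp_zero]

theorem injective (hi : IsEssential (LinearMap.range i)) (hinj : Function.Injective i)
    (h : g ∘ₗ i = i ∘ₗ f) (hf : Function.Injective f) : Function.Injective g := by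
  refine LinearMap.ker_eq_bot.1 (hi _ (eq_bot_iff.2 ?_))
  rintro _ ⟨⟨m, rfl⟩, hx⟩
  have hm : i (f m) = i (f 0) := by
    rw [map_zero f, map_zero]
    exact (LinearMap.congr_fun h m).symm.trans hx
  rw [hf (hinj hm), map_zero]
  exact Submodule.zero_mem _

end IsEssential

variable [IsArtinianRing R]

theorem IsLocalModule.syzygy [Module.Finite R P] [Module.Finite R X] [Module.Injective R P]
    [Nontrivial X] {i : X →ₗ[R] P} {π : P →ₗ[R] M} (h : IsShortExact i π)
    (hπ : IsSuperfluous (LinearMap.ker π)) (hM : IsLocalModule R M) : IsLocalModule R X := by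
  refine ⟨inferInstance, fun f => ?_⟩
  obtain ⟨g, hg⟩ := Module.Injective.out i h.inj (i ∘ₗ f)
  obtain ⟨k, hk⟩ := h.exists_factor (π ∘ₗ g) fun x => by
    rw [LinearMap.comp_apply, hg]
    exact h.exact.apply_apply_eq_zero _
  have hgi : g ∘ₗ i = i ∘ₗ f := LinearMap.ext hg
  have hkπ : k ∘ₗ π = π ∘ₗ g := LinearMap.ext hk
  refine (hM.2 k).imp (fun hnil => isNilpotent_of_injective h.inj hgi (hπ.isNilpotent hkπ hnil))
    fun hb => IsArtinian.bijective_of_injective_endomorphism f ?_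
  have hgb := IsNoetherian.bijective_of_surjective_endomorphism g
    (hπ.surjective h.surj hkπ hb.2)
  have := hgb.1.comp h.inj
  rw [← LinearMap.coe_comp, hgi, LinearMap.coe_comp] at this
  exact this.of_comp

theorem IsLocalModule.cosyzygy [Module.Finite R Q] [Module.Projective R Q] [Nontrivial N]
    {i : M →ₗ[R] Q} {p : Q →ₗ[R] N} (h : IsShortExact i p)
    (hi : IsEssential (LinearMap.range i)) (hM : IsLocalModule R M) : IsLocalModule R N := by
  have : Module.Finite R N := Module.Finite.of_surjective p h.surj
  refine ⟨inferInstance, fun f => ?_⟩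
  obtain ⟨g, hg⟩ := Module.projective_lifting_property p (f ∘ₗ p) h.surj
  obtain ⟨k, hk⟩ := h.exists_lift (g ∘ₗ i) fun m => by
    rw [LinearMap.comp_apply, ← LinearMap.comp_apply p, hg, LinearMap.comp_apply,
      h.exact.apply_apply_eq_zero, map_zero]
  have hik : g ∘ₗ i = i ∘ₗ k := LinearMap.ext fun m => (hk m).symm
  refine (hM.2 k).imp (fun hnil => isNilpotent_of_surjective h.surj hg.symm
    (hi.isNilpotent hik hnil)) fun hb => IsNoetherian.bijective_of_surjective_endomorphism f ?_
  have hgs := IsArtinian.surjective_of_injective_endomorphism g (hi.injective h.inj hik hb.1)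
  have := h.surj.comp hgs
  rw [← LinearMap.coe_comp, hg, LinearMap.coe_comp] at this
  exact this.of_comp

end LocalModules

section AlmostSplit

variable {R : Type u} [Ring R]

/-- An almost split sequence `0 → L → E → M → 0` of modules, among the finitely generated ones. -/
structure IsAlmostSplit {L E M : ModuleCat.{u} R} (l : L →ₗ[R] E) (q : E →ₗ[R] M) : Prop where
  ses : IsShortExact l q
  finite : Module.Finite R E
  no_section : ¬ HasSection q
  no_retraction : ¬ HasRetraction l
  right : ∀ (Z : ModuleCat.{u} R) (h : Z →ₗ[R] M), Module.Finite R Z → ¬ HasSection h →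
    ∃ t : Z →ₗ[R] E, ∀ z, q (t z) = h z
  left : ∀ (Y : ModuleCat.{u} R) (f : L →ₗ[R] Y), Module.Finite R Y → ¬ HasRetraction f →
    ∃ t : E →ₗ[R] Y, ∀ x, t (l x) = f x

variable {L E M : ModuleCat.{u} R} {l : L →ₗ[R] E} {q : E →ₗ[R] M}

namespace IsShortExact

theorem hasSection_of_hasRetraction (h : IsShortExact l q) (hl : HasRetraction l) :
    HasSection q := by
  obtain ⟨r, hr⟩ := hl
  obtain ⟨s, hs⟩ := h.exists_factor (LinearMap.id - l ∘ₗ r) fun x => by simp [hr]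
  refine ⟨s, fun x => ?_⟩
  obtain ⟨y, rfl⟩ := h.surj x
  rw [hs]
  simp [h.exact.apply_apply_eq_zero]

theorem hasRetraction_of_hasSection (h : IsShortExact l q) (hq : HasSection q) :
    HasRetraction l := by
  obtain ⟨s, hs⟩ := hq
  obtain ⟨r, hr⟩ := h.exists_lift (LinearMap.id - s ∘ₗ q) fun x => by simp [hs]
  exact ⟨r, fun x => h.inj (by rw [hr]; simp [h.exact.apply_apply_eq_zero])⟩

theorem exists_pushout (h : IsShortExact l q) {Y : ModuleCat.{u} R} (f : L →ₗ[R] Y)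
    [Module.Finite R Y] [Module.Finite R E] :
    ∃ (E' : ModuleCat.{u} R) (l' : Y →ₗ[R] E') (q' : E' →ₗ[R] M) (c : E →ₗ[R] E'),
      Module.Finite R E' ∧ IsShortExact l' q' ∧ l' ∘ₗ f = c ∘ₗ l ∧ q' ∘ₗ c = q := by
  let N : Submodule R (Y × E) := LinearMap.range (f.prod (-l))
  let q' : (Y × E) ⧸ N →ₗ[R] M := N.liftQ (q ∘ₗ LinearMap.snd R Y E) (by
    rintro _ ⟨x, rfl⟩
    simp [h.exact.apply_apply_eq_zero])
  let l' : Y →ₗ[R] (Y × E) ⧸ N := N.mkQ ∘ₗ LinearMap.inl R Y E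
  let c : E →ₗ[R] (Y × E) ⧸ N := N.mkQ ∘ₗ LinearMap.inr R Y E
  have hc (x) : l' (f x) = c (l x) := (Submodule.Quotient.eq N).2 ⟨x, by simp⟩
  refine ⟨ModuleCat.of R ((Y × E) ⧸ N), l', q', c, inferInstanceAs (Module.Finite R (_ ⧸ N)),
    ⟨(injective_iff_map_eq_zero l').2 fun y hy => ?_, fun m => ?_, fun z => ⟨fun hz => ?_, ?_⟩⟩,
    LinearMap.ext hc, rfl⟩
  · obtain ⟨x, hx⟩ := (Submodule.Quotient.mk_eq_zero N).1 hy
    have hfx : f x = y := congrArg Prod.fst hx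
    have hlx : -l x = 0 := congrArg Prod.snd hx
    rw [← hfx, h.inj ((neg_eq_zero.1 hlx).trans (map_zero l).symm), map_zero]
  · obtain ⟨x, rfl⟩ := h.surj m
    exact ⟨c x, rfl⟩
  · obtain ⟨⟨y, x⟩, rfl⟩ := N.mkQ_surjective z
    obtain ⟨w, rfl⟩ := (h.exact x).1 hz
    refine ⟨y + f w, ?_⟩
    rw [map_add, hc]
    refine (map_add N.mkQ (y, 0) (0, l w)).symm.trans ?_
    rw [Prod.mk_add_mk, add_zero, zero_add]
  · rintro ⟨y, rfl⟩
    exact map_zero q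

theorem hasSection_of_isNilpotent (h : IsShortExact l q) {φ : Module.End R E}
    {ψ : Module.End R L} (hq : q ∘ₗ φ = q) (hl : φ ∘ₗ l = l ∘ₗ ψ) (hψ : IsNilpotent ψ) :
    HasSection q := by
  obtain ⟨n, hn⟩ := hψ
  obtain ⟨s, hs⟩ := h.exists_factor (φ ^ n) fun y => by
    rw [← LinearMap.comp_apply, Module.End.commute_pow_left_of_commute hl, hn]
    simp
  have hqn : q ∘ₗ (φ ^ n : Module.End R E) = q := by
    rw [← Module.End.commute_pow_left_of_commute (g₂ := (1 : Module.End R M)) hq.symm, one_pow]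
    rfl
  refine ⟨s, fun m => ?_⟩
  obtain ⟨x, rfl⟩ := h.surj m
  rw [hs]
  exact LinearMap.congr_fun hqn x

theorem hasRetraction_of_isNilpotent (h : IsShortExact l q) {φ : Module.End R E}
    {ψ : Module.End R M} (hl : φ ∘ₗ l = l) (hq : ψ ∘ₗ q = q ∘ₗ φ) (hψ : IsNilpotent ψ) :
    HasRetraction l := by
  obtain ⟨n, hn⟩ := hψ
  obtain ⟨r, hr⟩ := h.exists_lift (φ ^ n) fun x => by
    rw [← LinearMap.comp_apply, ← Module.End.commute_pow_left_of_commute hq, hn]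
    simp
  have hln : (φ ^ n : Module.End R E) ∘ₗ l = l := by
    rw [Module.End.commute_pow_left_of_commute (g := (1 : Module.End R L)) hl, one_pow]
    rfl
  exact ⟨r, fun x => h.inj ((hr _).trans (LinearMap.congr_fun hln x))⟩

/-- If the pushout of the sequence along `f` did not split, its projection to `M` would lift
to `E`; the induced endomorphism of `L` would be neither nilpotent nor bijective. -/
theorem isAlmostSplit (h : IsShortExact l q) [Module.Finite R E] (hq : ¬ HasSection q)
    (hL : IsLocalModule R L)
    (hr : ∀ (Z : ModuleCat.{u} R) (h : Z →ₗ[R] M), Module.Finite R Z → ¬ HasSection h →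
      ∃ t : Z →ₗ[R] E, ∀ z, q (t z) = h z) : IsAlmostSplit l q := by
  refine ⟨h, ‹_›, hq, fun hl => hq (h.hasSection_of_hasRetraction hl), hr, fun Y f hY hf => ?_⟩
  obtain ⟨E', l', q', c, hE', h', hlc, hqc⟩ := h.exists_pushout f
  by_cases hs : HasSection q'
  · obtain ⟨r, hr⟩ := h'.hasRetraction_of_hasSection hs
    refine ⟨r ∘ₗ c, fun x => ?_⟩
    rw [LinearMap.comp_apply, ← LinearMap.comp_apply c, ← hlc, LinearMap.comp_apply, hr]
  · obtain ⟨t, ht⟩ := hr E' q' hE' hs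
    have hqt : q ∘ₗ t = q' := LinearMap.ext ht
    obtain ⟨g, hg⟩ := h.exists_lift (t ∘ₗ l') fun y =>
      (ht (l' y)).trans (h'.exact.apply_apply_eq_zero y)
    have hlg : l ∘ₗ g = t ∘ₗ l' := LinearMap.ext hg
    have hqtc : q ∘ₗ t ∘ₗ c = q := by rw [← LinearMap.comp_assoc, hqt, hqc]
    have hltc : (t ∘ₗ c) ∘ₗ l = l ∘ₗ g ∘ₗ f := by
      rw [LinearMap.comp_assoc, ← hlc, ← LinearMap.comp_assoc, ← LinearMap.comp_assoc, hlg]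
    refine ((hL.2 (g ∘ₗ f)).elim (fun hn => hq (h.hasSection_of_isNilpotent hqtc hltc hn))
      fun hb => hf ?_).elim
    exact ⟨(LinearEquiv.ofBijective _ hb).symm.toLinearMap ∘ₗ g,
      (LinearEquiv.ofBijective _ hb).symm_apply_apply⟩

end IsShortExact

variable [IsArtinianRing R]

theorem IsAlmostSplit.left_minimal (h : IsAlmostSplit l q) (hM : IsLocalModule R M)
    {φ : Module.End R E} (hφ : φ ∘ₗ l = l) : Function.Bijective φ := by
  have := h.finite
  obtain ⟨ψ, hψ⟩ := h.ses.exists_factor (q ∘ₗ φ) fun y => by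
    rw [LinearMap.comp_apply, ← LinearMap.comp_apply φ, hφ, h.ses.exact.apply_apply_eq_zero]
  have hψ' := (hM.2 ψ).resolve_left fun hn =>
    h.no_retraction (h.ses.hasRetraction_of_isNilpotent hφ (LinearMap.ext hψ) hn)
  refine IsArtinian.bijective_of_injective_endomorphism φ
    ((injective_iff_map_eq_zero φ).2 fun x hx => ?_)
  have hqx : ψ (q x) = 0 := by rw [hψ, LinearMap.comp_apply, hx, map_zero]
  obtain ⟨y, rfl⟩ := (h.ses.exact x).1 (hψ'.1 (hqx.trans (map_zero ψ).symm))
  exact (LinearMap.congr_fun hφ y).symm.trans hx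

theorem IsAlmostSplit.isIrreducibleMor (h : IsAlmostSplit l q) (hM : IsLocalModule R M)
    (hL : IsLocalModule R L) {X : ModuleCat.{u} R} [Nontrivial X] (s : X →ₗ[R] E)
    (r : E →ₗ[R] X) (hrs : ∀ x, r (s x) = x) : IsIrreducibleMor (ModuleCat.ofHom (r ∘ₗ l)) := by
  have hret : ¬ HasRetraction (r ∘ₗ l) := fun ⟨t, ht⟩ => h.no_retraction ⟨t ∘ₗ r, ht⟩
  refine ⟨mt (isSplitMono_iff _).1 hret, fun hsec => ?_, fun Z g k hZ hgk => ?_⟩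
  · obtain ⟨t, ht⟩ := (isSplitEpi_iff _).1 hsec
    refine hret ⟨t, fun x => ?_⟩
    obtain ⟨y, rfl⟩ := (hL.bijective_of_retract (i := t) (r := r ∘ₗ l) ht).2 x
    exact congrArg t (ht y)
  refine or_iff_not_imp_left.2 fun hg => ?_
  obtain ⟨t, ht⟩ := h.left Z g.hom hZ (mt (isSplitMono_iff g).2 hg)
  have hkg (x) : k.hom (g.hom x) = r (l x) := congrArg (fun f => f.hom x) hgk
  -- `φ` replaces the component `r` on the summand `X` of `E` by `k ∘ t`.
  let φ : Module.End R E := LinearMap.id - s ∘ₗ r + s ∘ₗ k.hom ∘ₗ t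
  have hφ : φ ∘ₗ l = l := LinearMap.ext fun x => by simp [φ, ht, hkg]
  have hkt (y) : k.hom (t y) = r (φ y) := by simp [φ, hrs]
  let Φ := LinearEquiv.ofBijective φ (h.left_minimal hM hφ)
  have hΦ (x) : φ (Φ.symm (s x)) = s x := Φ.apply_symm_apply (s x)
  refine (isSplitEpi_iff k).2 ⟨t ∘ₗ Φ.symm.toLinearMap ∘ₗ s, fun x => ?_⟩
  exact (hkt _).trans ((congrArg r (hΦ x)).trans (hrs x))

end AlmostSplit

section Core

namespace IsShortExact

variable {S : Type*} [Ring S] {X P M : Type*} [AddCommGroup X] [AddCommGroup P] [AddCommGroup M]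
  [Module S X] [Module S P] [Module S M] {i : X →ₗ[S] P} {p : P →ₗ[S] M}

theorem bijective_of_subsingleton_left (h : IsShortExact i p) [Subsingleton X] :
    Function.Bijective p :=
  ⟨(injective_iff_map_eq_zero p).2 fun x hx => by
    obtain ⟨y, rfl⟩ := (h.exact x).1 hx
    rw [Subsingleton.elim y 0, map_zero], h.surj⟩

theorem bijective_of_subsingleton_right (h : IsShortExact i p) [Subsingleton M] :
    Function.Bijective i :=
  ⟨h.inj, fun x => (h.exact x).1 (Subsingleton.elim _ _)⟩

end IsShortExact

theorem IsShortExact.not_hasRetraction {R X P M : Type u} [Ring R] [AddCommGroup X]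
    [AddCommGroup P] [AddCommGroup M] [Module R X] [Module R P] [Module R M] [Nontrivial X]
    {i : X →ₗ[R] P} {p : P →ₗ[R] M} (h : IsShortExact i p)
    (hp : IsSuperfluous (LinearMap.ker p)) : ¬ HasRetraction i := by
  rintro ⟨r, hr⟩
  have hker : LinearMap.ker r = ⊤ := hp _ <| eq_top_iff.2 fun x _ => by
    rw [← add_sub_cancel (i (r x)) x]
    exact Submodule.add_mem_sup (h.exact.apply_apply_eq_zero _) (by simp [hr])
  obtain ⟨x, hx⟩ := exists_ne (0 : X)
  exact hx ((hr x).symm.trans (LinearMap.congr_fun (LinearMap.ker_eq_top.1 hker) (i x)))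

theorem IsShortExact.exists_pullback {R : Type u} [Ring R] [IsNoetherianRing R]
    {L P₁ P₀ M : ModuleCat.{u} R} [Module.Finite R P₁] [Module.Finite R M] {ι : L →ₗ[R] P₁}
    {d : P₁ →ₗ[R] P₀} (hι : Function.Injective ι) (hd : Function.Exact ι d) {u : M →ₗ[R] P₀}
    (hu : ∀ m, ∃ y, d y = u m) :
    ∃ (E : ModuleCat.{u} R) (l : L →ₗ[R] E) (q : E →ₗ[R] M) (f : E →ₗ[R] P₁),
      Module.Finite R E ∧ IsShortExact l q ∧ d ∘ₗ f = u ∘ₗ q ∧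
      ∀ (Z : ModuleCat.{u} R) (s : Z →ₗ[R] P₁) (h : Z →ₗ[R] M), d ∘ₗ s = u ∘ₗ h →
        ∃ t : Z →ₗ[R] E, ∀ z, q (t z) = h z := by
  let N : Submodule R (P₁ × M) :=
    LinearMap.eqLocus (d ∘ₗ LinearMap.fst R P₁ M) (u ∘ₗ LinearMap.snd R P₁ M)
  let l : L →ₗ[R] N := (LinearMap.inl R P₁ M ∘ₗ ι).codRestrict N fun y => by
    simp [N, hd.apply_apply_eq_zero]
  refine ⟨ModuleCat.of R N, l, LinearMap.snd R P₁ M ∘ₗ N.subtype,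
    LinearMap.fst R P₁ M ∘ₗ N.subtype, inferInstanceAs (Module.Finite R N),
    ⟨fun a b hab => hι (congrArg (fun z : N => z.1.1) hab), fun m => ?_, ?_⟩,
    LinearMap.ext fun x => x.2, fun Z s h hsh =>
      ⟨(s.prod h).codRestrict N (LinearMap.congr_fun hsh), fun _ => rfl⟩⟩
  · obtain ⟨y, hy⟩ := hu m
    exact ⟨⟨(y, m), hy⟩, rfl⟩
  · rintro ⟨⟨y, m⟩, hx⟩
    constructor
    · rintro (rfl : m = 0)
      obtain ⟨z, rfl⟩ := (hd y).1 (hx.trans (map_zero u))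
      exact ⟨z, rfl⟩
    · rintro ⟨z, hz⟩
      exact (congrArg (fun z : N => z.1.2) hz).symm

variable {K : Type u} [Field K] {R : Type u} [Ring R] [Algebra K R] {e : R} {lam : R →ₗ[K] K}

/-- `M` is a finitely generated indecomposable nonprojective module of infinite dominant and
codominant dimension. -/
structure IsCore (hs : IsSymmIdempotent e lam) (M : ModuleCat.{u} R) : Prop where
  finite : Module.Finite R M
  isLocal : IsLocalModule R M
  nonproj : ¬ Module.Projective R M
  biperfect : IsBiperfect hs M

variable {hs : IsSymmIdempotent e lam} {M X P P₀ P₁ L Z : ModuleCat.{u} R}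

theorem IsLocalModule.exists_functional (K : Type u) [Field K] [Algebra K R]
    (hM : IsLocalModule R M) :
    ∃ ξ : (M →ₗ[R] M) →ₗ[K] K, ξ ≠ 0 ∧ ∀ w : M →ₗ[R] M, ¬ Function.Bijective w → ξ w = 0 := by
  have := hM.1
  have hzero : ¬ Function.Bijective (0 : M →ₗ[R] M) := fun h => by
    obtain ⟨x, hx⟩ := exists_ne (0 : M)
    exact hx (h.1 rfl)
  let J : Submodule K (M →ₗ[R] M) :=
    { carrier := {f | ¬ Function.Bijective f}
      add_mem' := fun hf hg => hM.add_not_bijective hf hg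
      zero_mem' := hzero
      smul_mem' := fun k f hf hkf => by
        rcases eq_or_ne k 0 with rfl | hk
        · exact hzero (zero_smul K f ▸ hkf)
        · exact hf ((Module.End.isUnit_iff f).1 <|
            (isUnit_smul_iff (Units.mk0 k hk) (f : Module.End R M)).1 <|
              (Module.End.isUnit_iff (k • f)).2 hkf) }
  have hJ : J < ⊤ := lt_top_iff_ne_top.2 fun h =>
    (h ▸ Submodule.mem_top : LinearMap.id ∈ J) Function.bijective_id
  obtain ⟨ξ, hξ, hξJ⟩ := Submodule.exists_le_ker_of_lt_top J hJ
  exact ⟨ξ, hξ, fun w hw => hξJ hw⟩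

variable [FiniteDimensional K R]

theorem IsBiperfect.nonempty_dualBasis (hM : IsBiperfect hs M) [Module.Finite R M]
    [Module.Projective R M] : Nonempty (DualBasis e M) :=
  hM.hom.nonempty_dualBasis (π := LinearMap.id)
    (by rw [LinearMap.ker_id]; exact fun L hL => by rwa [bot_sup_eq] at hL) Function.surjective_id

theorem exists_isEssential_range (b : DualBasis e P) (hs : IsSymmIdempotent e lam)
    {i : M →ₗ[R] P} (hi : Function.Injective i) :
    ∃ (Q : ModuleCat.{u} R) (_ : DualBasis e Q) (j : M →ₗ[R] Q), Function.Injective j ∧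
      IsEssential (LinearMap.range j) := by
  have := IsArtinianRing.of_finite K R
  have := b.finite
  induction hn : Module.length R P using WellFoundedLT.induction generalizing P with | ind n ih
  by_cases h : IsEssential (LinearMap.range i)
  · exact ⟨P, b, i, hi, h⟩
  simp only [IsEssential, not_forall] at h
  obtain ⟨L, hL, hL'⟩ := h
  have := b.injective hs
  obtain ⟨U, V, hUV, hV, hU⟩ := exists_summand_ge_range hi hL hL'
  obtain ⟨r, hr, -⟩ := exists_retraction hUV
  have hVtop : V ≠ ⊤ := fun hV => hU (eq_bot_of_isCompl_top (hV ▸ hUV))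
  let b' : DualBasis e (ModuleCat.of R V) := b.ofRetract V.subtype r hr
  exact ih _ (hn ▸ Submodule.length_lt hVtop) b'
    (i := i.codRestrict V fun m => hV ⟨m, rfl⟩)
    (fun a c hac => hi (congrArg Subtype.val hac)) b'.finite rfl

theorem IsLocalModule.isSuperfluous_ker [IsArtinianRing R] {i : M →ₗ[R] P} {p : P →ₗ[R] X}
    [Module.Finite R P] [Module.Projective R P]
    (hM : IsLocalModule R M) (hM' : ¬ Module.Projective R M) (h : IsShortExact i p) :
    IsSuperfluous (LinearMap.ker p) := fun L hL => by_contra fun hL' => by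
  obtain ⟨U, V, hUV, hU, hU'⟩ := exists_summand_le_ker p hL hL'
  obtain ⟨r, hr, -⟩ := exists_retraction hUV.symm
  obtain ⟨j, hj⟩ := h.exists_lift U.subtype fun u => hU u.2
  have : Nontrivial U := Submodule.nontrivial_iff_ne_bot.2 hU'
  have hb : Function.Bijective j :=
    hM.bijective_of_retract (r := r ∘ₗ i) fun u => by rw [LinearMap.comp_apply, hj]; exact hr u
  have : Module.Projective R U := Module.Projective.of_split U.subtype r (LinearMap.ext hr)
  exact hM' (Module.Projective.of_equiv (LinearEquiv.ofBijective j hb))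

theorem IsCore.syzygy (hM : IsCore hs M) (b : DualBasis e P) {i : X →ₗ[R] P} {π : P →ₗ[R] M}
    (h : IsShortExact i π) (hπ : IsSuperfluous (LinearMap.ker π)) : IsCore hs X := by
  have := IsArtinianRing.of_finite K R
  have := b.finite
  have := b.projective
  have := b.injective hs
  have hX : IsBiperfect hs X := hM.biperfect.ker h b
  have : Module.Finite R X := Module.Finite.of_injective i h.inj
  have : Nontrivial X := not_subsingleton_iff_nontrivial.1 fun _ =>
    hM.nonproj (.of_equiv (LinearEquiv.ofBijective π h.bijective_of_subsingleton_left))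
  refine ⟨‹_›, hM.isLocal.syzygy h hπ, fun _ => h.not_hasRetraction hπ ?_, hX⟩
  obtain ⟨c⟩ := hX.nonempty_dualBasis
  have := c.injective hs
  exact Module.Injective.out i h.inj LinearMap.id

theorem IsCore.exists_cosyzygy (hM : IsCore hs M) :
    ∃ (Q N : ModuleCat.{u} R) (_ : DualBasis e Q) (i : M →ₗ[R] Q) (p : Q →ₗ[R] N),
      IsShortExact i p ∧ IsSuperfluous (LinearMap.ker p) ∧ IsCore hs N := by
  have := IsArtinianRing.of_finite K R
  have := hM.finite
  obtain ⟨P, b', j, hj⟩ := exists_embedding hs hM.biperfect.e_faithful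
  obtain ⟨Q, b, i, hi, hess⟩ := exists_isEssential_range b' hs hj
  let N := ModuleCat.of R (Q ⧸ LinearMap.range i)
  let p : Q →ₗ[R] N := (LinearMap.range i).mkQ
  have h : IsShortExact i p := isShortExact_range hi
  have := b.finite
  have := b.projective
  have : Module.Finite R N := Module.Finite.of_surjective p h.surj
  have : Nontrivial N := not_subsingleton_iff_nontrivial.1 fun _ => hM.nonproj
    (.of_equiv (LinearEquiv.ofBijective i h.bijective_of_subsingleton_right).symm)
  refine ⟨Q, N, b, i, p, h, hM.isLocal.isSuperfluous_ker hM.nonproj h, ‹_›,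
    hM.isLocal.cosyzygy h hess, fun _ => ?_, hM.biperfect.coker h b⟩
  obtain ⟨s, hs'⟩ := Module.projective_lifting_property p LinearMap.id h.surj
  obtain ⟨r, hr⟩ := h.hasRetraction_of_hasSection ⟨s, LinearMap.congr_fun hs'⟩
  exact hM.nonproj (.of_split i r (LinearMap.ext hr))

theorem IsLocalModule.exists_trace_ne_zero (hM : IsLocalModule R M) [Module.Finite R M]
    (hs : IsSymmIdempotent e lam) (b : DualBasis e P) {π : P →ₗ[R] M}
    (hπ : Function.Surjective π) :
    ∃ u : M →ₗ[R] P, (∃ w : M →ₗ[R] M, b.trace lam (u ∘ₗ w ∘ₗ π) ≠ 0) ∧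
      ∀ w : M →ₗ[R] M, ¬ Function.Bijective w → b.trace lam (u ∘ₗ w ∘ₗ π) = 0 := by
  obtain ⟨ξ, hξ, hξ'⟩ := hM.exists_functional K
  have hinj : Function.Injective (LinearMap.lcomp K M π) := fun w w' h =>
    (LinearMap.cancel_right hπ).1 h
  obtain ⟨g, hg⟩ := exists_extend_functional _ hinj ξ
  obtain ⟨u, hu⟩ := b.exists_pairing_eq hs g
  have htrace (w : M →ₗ[R] M) : b.trace lam (u ∘ₗ w ∘ₗ π) = ξ w := (hu _).trans (hg w)
  refine ⟨u, ?_, fun w hw => (htrace w).trans (hξ' w hw)⟩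
  simpa only [htrace, ne_eq, LinearMap.ext_iff, LinearMap.zero_apply, not_forall] using hξ

theorem DualBasis.exists_comp_eq (hs : IsSymmIdempotent e lam) (b₀ : DualBasis e P₀)
    (b₁ : DualBasis e P₁) (d : P₁ →ₗ[R] P₀) [Module.Finite R Z] (f : Z →ₗ[R] P₀)
    (hf : ∀ v : P₀ →ₗ[R] Z, v ∘ₗ d = 0 → b₀.trace lam (f ∘ₗ v) = 0) :
    ∃ s : Z →ₗ[R] P₁, d ∘ₗ s = f := by
  have := b₀.finite
  have := finiteDimensional_hom K P₀ Z
  let T := b₀.pairing lam Z ∘ₗ LinearMap.compRight K (M := Z) d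
  obtain ⟨s, hsf⟩ := exists_eq_of_forall_apply_eq_zero T (b₀.pairing lam Z f) fun v hv =>
    hf v <| b₁.right_eq_zero_of_trace hs (v ∘ₗ d) fun s =>
      (b₁.trace_comm hs b₀ d (s ∘ₗ v)).trans (hv s)
  refine ⟨s, sub_eq_zero.1 <| b₀.left_eq_zero_of_trace hs _ fun v => ?_⟩
  rw [← DualBasis.pairing_apply, map_sub, LinearMap.sub_apply, sub_eq_zero]
  exact LinearMap.congr_fun hsf v

theorem IsCore.comp_eq_zero_of_trace (hM : IsCore hs M) (b : DualBasis e P) {π : P →ₗ[R] M}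
    {u : M →ₗ[R] P}
    (hu : ∀ w : M →ₗ[R] M, ¬ Function.Bijective w → b.trace lam (u ∘ₗ w ∘ₗ π) = 0) :
    π ∘ₗ u = 0 := by
  have := hM.finite
  obtain ⟨Q, c, i, hi⟩ := exists_embedding hs hM.biperfect.e_faithful
  have hiπu : i ∘ₗ π ∘ₗ u = 0 := c.left_eq_zero_of_trace hs _ fun v => by
    have htrace : c.trace lam ((i ∘ₗ π ∘ₗ u) ∘ₗ v) = b.trace lam (u ∘ₗ (v ∘ₗ i) ∘ₗ π) :=
      (b.trace_comm hs c (i ∘ₗ π) (u ∘ₗ v)).symm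
    refine htrace.trans (hu _ fun hvi => hM.nonproj ?_)
    have := c.projective
    exact .of_split i ((LinearEquiv.ofBijective _ hvi).symm.toLinearMap ∘ₗ v)
      (LinearMap.ext (LinearEquiv.ofBijective _ hvi).symm_apply_apply)
  exact LinearMap.ext fun m => hi ((LinearMap.congr_fun hiπu m).trans (map_zero i).symm)

/-- The sequence is the pullback of `L → P₁ → P₀` along a map `u : M → P₀` that represents, under
the trace pairing, a nonzero functional on `End M` vanishing on the radical. -/
theorem IsCore.exists_isAlmostSplit (hM : IsCore hs M) (b₀ : DualBasis e P₀)
    (b₁ : DualBasis e P₁) {ι : L →ₗ[R] P₁} {d : P₁ →ₗ[R] P₀} {π : P₀ →ₗ[R] M}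
    (hι : Function.Injective ι) (hd : Function.Exact ι d) (hπ : Function.Surjective π)
    (hπd : Function.Exact d π) (hL : IsLocalModule R L) :
    ∃ (E : ModuleCat.{u} R) (l : L →ₗ[R] E) (q : E →ₗ[R] M), IsAlmostSplit l q := by
  have := IsNoetherianRing.of_finite K R
  have := hM.finite
  have := b₁.finite
  obtain ⟨u, ⟨w, hw⟩, hu⟩ := hM.isLocal.exists_trace_ne_zero hs b₀ hπ
  have hπu := hM.comp_eq_zero_of_trace b₀ hu
  obtain ⟨E, l, q, f, _, h, hfq, hE⟩ := IsShortExact.exists_pullback hι hd fun m =>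
    (hπd _).1 (LinearMap.congr_fun hπu m)
  refine ⟨E, l, q, h.isAlmostSplit ?_ hL fun Z g _ hg => ?_⟩
  · rintro ⟨s, hqs⟩
    have hus : u = d ∘ₗ f ∘ₗ s := by
      have hqs' : q ∘ₗ s = LinearMap.id := LinearMap.ext hqs
      rw [← LinearMap.comp_assoc, hfq, LinearMap.comp_assoc, hqs', LinearMap.comp_id]
    have htrace : b₀.trace lam (u ∘ₗ w ∘ₗ π) = b₁.trace lam ((f ∘ₗ s ∘ₗ w) ∘ₗ π ∘ₗ d) := by
      rw [hus]
      exact (b₁.trace_comm hs b₀ d ((f ∘ₗ s) ∘ₗ w ∘ₗ π)).symm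
    refine hw (htrace.trans ?_)
    simp [DualBasis.trace, hπd.apply_apply_eq_zero]
  · obtain ⟨s, hds⟩ := b₀.exists_comp_eq hs b₁ d (u ∘ₗ g) fun v hv => by
      obtain ⟨w, hwπ⟩ := exists_factor π hπ v fun x hx => by
        obtain ⟨y, rfl⟩ := (hπd x).1 hx
        exact LinearMap.congr_fun hv y
      obtain rfl : w ∘ₗ π = v := LinearMap.ext hwπ
      refine hu (g ∘ₗ w) fun hgw => hg ?_
      exact ⟨w ∘ₗ (LinearEquiv.ofBijective _ hgw).symm.toLinearMap,
        (LinearEquiv.ofBijective _ hgw).apply_symm_apply⟩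
    exact hE Z s g hds

end Core

section SimpleTopAndSocle

variable {R : Type u} [Ring R] {P S X : Type u} [AddCommGroup P] [Module R P] [AddCommGroup S]
  [Module R S] [AddCommGroup X] [Module R X]

theorem exists_simple_quotient (R P : Type u) [Ring R] [AddCommGroup P] [Module R P]
    [Module.Finite R P] [Nontrivial P] :
    ∃ (S : ModuleCat.{u} R) (p : P →ₗ[R] S), IsSimpleModule R S ∧ Function.Surjective p := by
  obtain ⟨J, hJ⟩ := IsCoatomic.exists_coatom (Submodule R P)
  exact ⟨ModuleCat.of R (P ⧸ J), J.mkQ, isSimpleModule_iff_isCoatom.2 hJ, J.mkQ_surjective⟩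

namespace IsLocalModule

theorem le_ker_of_ne_top [Module.Projective R P] (hP : IsLocalModule R P) [IsSimpleModule R S]
    {p : P →ₗ[R] S} (hp : Function.Surjective p) {L : Submodule R P} (hL : L ≠ ⊤) :
    L ≤ LinearMap.ker p := by
  by_contra h
  have hmap : L.map p = ⊤ := (eq_bot_or_eq_top (L.map p)).resolve_left fun h0 =>
    h (LinearMap.le_ker_iff_map.2 h0)
  have hsurj : Function.Surjective (p ∘ₗ L.subtype) := by
    rw [← LinearMap.range_eq_top, LinearMap.range_comp, Submodule.range_subtype, hmap]
  obtain ⟨t, ht⟩ := Module.projective_lifting_property _ p hsurj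
  rcases hP.2 (L.subtype ∘ₗ t) with hnil | hb
  · have := IsSimpleModule.nontrivial R S
    have h₁ : IsNilpotent (1 : Module.End R S) := isNilpotent_of_surjective hp ht.symm hnil
    exact not_isNilpotent_one h₁
  · refine hL (eq_top_iff.2 fun x _ => ?_)
    obtain ⟨y, rfl⟩ := hb.2 x
    exact (t y).2

theorem range_le_of_ne_bot [Module.Injective R P] (hP : IsLocalModule R P) [IsSimpleModule R S]
    {j : S →ₗ[R] P} (hj : Function.Injective j) {N : Submodule R P} (hN : N ≠ ⊥) :
    LinearMap.range j ≤ N := by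
  rcases eq_bot_or_eq_top (N.comap j) with h | h
  · have hinj : Function.Injective (N.mkQ ∘ₗ j) := by
      rw [← LinearMap.ker_eq_bot, LinearMap.ker_comp, Submodule.ker_mkQ, h]
    obtain ⟨β, hβ⟩ := Module.Injective.out (N.mkQ ∘ₗ j) hinj j
    rcases hP.2 (β ∘ₗ N.mkQ) with hnil | hb
    · have := IsSimpleModule.nontrivial R S
      have h₁ : IsNilpotent (1 : Module.End R S) :=
        isNilpotent_of_injective hj (LinearMap.ext hβ) hnil
      exact (not_isNilpotent_one h₁).elim
    · refine (hN (eq_bot_iff.2 fun x hx => hb.1 ?_)).elim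
      rw [map_zero, LinearMap.comp_apply, Submodule.mkQ_apply,
        (Submodule.Quotient.mk_eq_zero N).2 hx, map_zero]
  · exact LinearMap.range_eq_map j ▸ Submodule.map_le_iff_le_comap.2 h.ge

theorem eq_top_or_eq_top_of_codisjoint [Module.Projective R P] (hP : IsLocalModule R P)
    [Module.Finite R P] {A B : Submodule R P} (h : Codisjoint A B) : A = ⊤ ∨ B = ⊤ := by
  by_contra! hAB
  have := hP.1
  obtain ⟨S, p, _, hp⟩ := exists_simple_quotient R P
  have hker : LinearMap.ker p = ⊤ := codisjoint_self.1
    (h.mono (hP.le_ker_of_ne_top hp hAB.1) (hP.le_ker_of_ne_top hp hAB.2))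
  have := IsSimpleModule.nontrivial R S
  exact LinearMap.ne_zero_of_surjective hp (LinearMap.ker_eq_top.1 hker)

theorem eq_bot_or_eq_bot_of_disjoint [Module.Injective R P] (hP : IsLocalModule R P)
    [IsSimpleModule R S] {j : S →ₗ[R] P} (hj : Function.Injective j) {A B : Submodule R P}
    (h : Disjoint A B) : A = ⊥ ∨ B = ⊥ := by
  by_contra! hAB
  have hrange : LinearMap.range j = ⊥ := disjoint_self.1
    (h.mono (hP.range_le_of_ne_bot hj hAB.1) (hP.range_le_of_ne_bot hj hAB.2))
  have := IsSimpleModule.nontrivial R S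
  exact LinearMap.ne_zero_of_injective hj (LinearMap.range_eq_bot.1 hrange)

theorem bijective_of_quotient_retract [Module.Projective R P] (hP : IsLocalModule R P)
    [Module.Finite R P] [Nontrivial X] {N : Submodule R P} {i : X →ₗ[R] P ⧸ N}
    {r : P ⧸ N →ₗ[R] X} (hri : ∀ x, r (i x) = x) : Function.Bijective i := by
  have hcod : Codisjoint ((LinearMap.range i).comap N.mkQ) (LinearMap.ker (r ∘ₗ N.mkQ)) :=
    codisjoint_iff_le_sup.2 fun y _ => by
      obtain ⟨w, hw⟩ := N.mkQ_surjective (i (r (N.mkQ y)))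
      exact Submodule.mem_sup.2 ⟨w, ⟨_, hw.symm⟩, y - w, by simp [-Submodule.mkQ_apply, hw, hri],
        add_sub_cancel w y⟩
  refine ⟨Function.LeftInverse.injective hri, LinearMap.range_eq_top.1 ?_⟩
  rcases hP.eq_top_or_eq_top_of_codisjoint hcod with h | h
  · rw [← Submodule.map_comap_eq_of_surjective N.mkQ_surjective (LinearMap.range i), h,
      Submodule.map_top, N.range_mkQ]
  · have hr : Function.Surjective (r ∘ₗ N.mkQ) :=
      (Function.LeftInverse.surjective hri).comp N.mkQ_surjective
    exact (LinearMap.ne_zero_of_surjective hr (LinearMap.ker_eq_top.1 h)).elim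

theorem bijective_of_submodule_retract [Module.Injective R P] (hP : IsLocalModule R P)
    [IsSimpleModule R S] {j : S →ₗ[R] P} (hj : Function.Injective j) [Nontrivial X]
    {N : Submodule R P} {i : X →ₗ[R] N} {r : N →ₗ[R] X} (hri : ∀ x, r (i x) = x) :
    Function.Bijective i := by
  have hi : Function.Injective i := Function.LeftInverse.injective hri
  have hdis : Disjoint (LinearMap.range i) (LinearMap.ker r) := Submodule.disjoint_def.2 <| by
    rintro _ ⟨x, rfl⟩ hx
    rw [← hri x, LinearMap.mem_ker.1 hx, map_zero]
  have hbot {A : Submodule R N} (hA : A.map N.subtype = ⊥) : A = ⊥ :=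
    Submodule.map_injective_of_injective N.injective_subtype (hA.trans (Submodule.map_bot _).symm)
  rcases hP.eq_bot_or_eq_bot_of_disjoint hj (Submodule.disjoint_map N.injective_subtype hdis)
    with h | h
  · exact (LinearMap.ne_zero_of_injective hi (LinearMap.range_eq_bot.1 (hbot h))).elim
  · exact ⟨hi, fun y => ⟨r y, LinearMap.ker_eq_bot.1 (hbot h) (hri (r y))⟩⟩

end IsLocalModule

end SimpleTopAndSocle

section Irreducible

variable {R : Type u} [Ring R] {X Y P S : ModuleCat.{u} R}

namespace IsIrreducibleMor

theorem not_surjective [Module.Projective R Y] {f : X ⟶ Y} (hf : IsIrreducibleMor f) :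
    ¬ Function.Surjective f.hom := fun h => by
  obtain ⟨s, hs⟩ := Module.projective_lifting_property f.hom LinearMap.id h
  exact hf.2.1 ((isSplitEpi_iff f).2 ⟨s, LinearMap.congr_fun hs⟩)

theorem not_injective [Module.Injective R X] {f : X ⟶ Y} (hf : IsIrreducibleMor f) :
    ¬ Function.Injective f.hom := fun h => by
  obtain ⟨r, hr⟩ := Module.Injective.out f.hom h (LinearMap.id : X →ₗ[R] X)
  exact hf.1 ((isSplitMono_iff f).2 ⟨r, hr⟩)

theorem hasRetraction_or_hasSection {f : X ⟶ Y} (hf : IsIrreducibleMor f) {Z : ModuleCat.{u} R}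
    [Module.Finite R Z] {g : X →ₗ[R] Z} {h : Z →ₗ[R] Y} (hgh : h ∘ₗ g = f.hom) :
    HasRetraction g ∨ HasSection h :=
  (hf.2.2 Z (ModuleCat.ofHom g) (ModuleCat.ofHom h) ‹_› (ModuleCat.hom_ext hgh)).imp
    (isSplitMono_iff _).1 (isSplitEpi_iff _).1

theorem exists_retract_ker [IsNoetherianRing R] [Module.Finite R P] [Module.Projective R P]
    [IsSimpleModule R S] (hP : IsLocalModule R P) {p : P →ₗ[R] S} (hp : Function.Surjective p)
    {f : Y ⟶ P} (hf : IsIrreducibleMor f) :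
    ∃ (g : Y →ₗ[R] LinearMap.ker p) (r : LinearMap.ker p →ₗ[R] Y),
      (LinearMap.ker p).subtype ∘ₗ g = f.hom ∧ ∀ y, r (g y) = y := by
  have hle : LinearMap.range f.hom ≤ LinearMap.ker p := hP.le_ker_of_ne_top hp fun h =>
    hf.not_surjective (LinearMap.range_eq_top.1 h)
  let g : Y →ₗ[R] ModuleCat.of R (LinearMap.ker p) := f.hom.codRestrict _ fun y => hle ⟨y, rfl⟩
  have : Module.Finite R (ModuleCat.of R (LinearMap.ker p)) :=
    inferInstanceAs (Module.Finite R (LinearMap.ker p))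
  rcases hf.hasRetraction_or_hasSection (g := g) (h := (LinearMap.ker p).subtype) rfl
    with ⟨r, hr⟩ | ⟨s, hs⟩
  · exact ⟨g, r, rfl, hr⟩
  · have hp0 : p = 0 := LinearMap.ext fun x => hs x ▸ (s x).2
    have := IsSimpleModule.nontrivial R S
    exact (LinearMap.ne_zero_of_surjective hp hp0).elim

theorem exists_retract_quotient [Module.Finite R P] [Module.Injective R P] [IsSimpleModule R S]
    (hP : IsLocalModule R P) {j : S →ₗ[R] P} (hj : Function.Injective j) {f : P ⟶ Y}
    (hf : IsIrreducibleMor f) :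
    ∃ (s : Y →ₗ[R] P ⧸ LinearMap.range j) (h : P ⧸ LinearMap.range j →ₗ[R] Y),
      h ∘ₗ (LinearMap.range j).mkQ = f.hom ∧ ∀ y, h (s y) = y := by
  have hle : LinearMap.range j ≤ LinearMap.ker f.hom := hP.range_le_of_ne_bot hj fun h =>
    hf.not_injective (LinearMap.ker_eq_bot.1 h)
  let h : ModuleCat.of R (P ⧸ LinearMap.range j) →ₗ[R] Y := (LinearMap.range j).liftQ f.hom hle
  have : Module.Finite R (ModuleCat.of R (P ⧸ LinearMap.range j)) :=
    inferInstanceAs (Module.Finite R (P ⧸ LinearMap.range j))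
  rcases hf.hasRetraction_or_hasSection (g := (LinearMap.range j).mkQ) (h := h) rfl
    with ⟨r, hr⟩ | ⟨s, hs⟩
  · have hj0 : j = 0 := LinearMap.ext fun x => by
      have hx : (LinearMap.range j).mkQ (j x) = 0 :=
        (isShortExact_range hj).exact.apply_apply_eq_zero x
      exact (hr (j x)).symm.trans ((congrArg r hx).trans (map_zero r))
    have := IsSimpleModule.nontrivial R S
    exact (LinearMap.ne_zero_of_injective hj hj0).elim
  · exact ⟨s, h, rfl, hs⟩

end IsIrreducibleMor

namespace IsAlmostSplit

variable {L E M : ModuleCat.{u} R} {l : L →ₗ[R] E} {q : E →ₗ[R] M}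

theorem exists_retract_of_irreducible_from (h : IsAlmostSplit l q) [Module.Finite R Y]
    {f : L ⟶ Y} (hf : IsIrreducibleMor f) :
    ∃ (s : Y →ₗ[R] E) (r : E →ₗ[R] Y), ∀ y, r (s y) = y := by
  have := h.finite
  obtain ⟨t, ht⟩ := h.left Y f.hom ‹_› (mt (isSplitMono_iff f).2 hf.1)
  obtain ⟨s, hs⟩ := (hf.hasRetraction_or_hasSection (LinearMap.ext ht)).resolve_left
    h.no_retraction
  exact ⟨s, t, hs⟩

theorem exists_retract_of_irreducible_to (h : IsAlmostSplit l q) [Module.Finite R Y]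
    {f : Y ⟶ M} (hf : IsIrreducibleMor f) :
    ∃ (s : Y →ₗ[R] E) (r : E →ₗ[R] Y), ∀ y, r (s y) = y := by
  have := h.finite
  obtain ⟨t, ht⟩ := h.right Y f.hom ‹_› (mt (isSplitEpi_iff f).2 hf.2.1)
  obtain ⟨r, hr⟩ := (hf.hasRetraction_or_hasSection (LinearMap.ext ht)).resolve_right
    h.no_section
  exact ⟨t, r, hr⟩

end IsAlmostSplit

end Irreducible

section Components

variable {K : Type u} [Field K] {R : Type u} [Ring R] [Algebra K R] {e : R} {lam : R →ₗ[K] K}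
  {hs : IsSymmIdempotent e lam} {M X Y P S : ModuleCat.{u} R}

/-- The indecomposable modules that can occur in the Auslander–Reiten component of an `IsCore`
module: those of infinite dominant and codominant dimension, where a projective one must also have
a simple quotient of infinite dominant and codominant dimension. -/
structure IsExtendedCore (hs : IsSymmIdempotent e lam) (M : ModuleCat.{u} R) : Prop where
  finite : Module.Finite R M
  isLocal : IsLocalModule R M
  biperfect : IsBiperfect hs M
  top : Module.Projective R M → ∃ (S : ModuleCat.{u} R) (p : M →ₗ[R] S), IsSimpleModule R S ∧
    Function.Surjective p ∧ IsBiperfect hs S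

theorem IsCore.isExtendedCore (hM : IsCore hs M) : IsExtendedCore hs M :=
  ⟨hM.finite, hM.isLocal, hM.biperfect, fun h => absurd h hM.nonproj⟩

theorem IsExtendedCore.isCore (hM : IsExtendedCore hs M) (h : ¬ Module.Projective R M) :
    IsCore hs M :=
  ⟨hM.finite, hM.isLocal, h, hM.biperfect⟩

theorem IsExtendedCore.of_linearEquiv (hM : IsExtendedCore hs M) (E : M ≃ₗ[R] X) :
    IsExtendedCore hs X where
  finite := have := hM.finite; Module.Finite.equiv E
  isLocal := hM.isLocal.of_linearEquiv E
  biperfect := hM.biperfect.of_linearEquiv E.symm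
  top hX := by
    obtain ⟨S, p, hS, hp, hb⟩ := hM.top (Module.Projective.of_equiv E.symm)
    exact ⟨S, p ∘ₗ E.symm.toLinearMap, hS, hp.comp E.symm.surjective, hb⟩

theorem DualBasis.exists_socle (hs : IsSymmIdempotent e lam) (b : DualBasis e P)
    [IsSimpleModule R S] {p : P →ₗ[R] S} (hp : Function.Surjective p) :
    ∃ j : S →ₗ[R] P, Function.Injective j := by
  have := IsSimpleModule.nontrivial R S
  by_contra! h
  refine LinearMap.ne_zero_of_surjective hp (b.right_eq_zero_of_trace hs p fun u => ?_)
  rw [(LinearMap.injective_or_eq_zero u).resolve_left (h u)]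
  simp [DualBasis.trace]

theorem IsCore.exists_top_of_irreducible_to (hX : IsCore hs X) (b : DualBasis e P)
    (hP : IsLocalModule R P) {f : P ⟶ X} (hf : IsIrreducibleMor f) :
    ∃ (S : ModuleCat.{u} R) (p : P →ₗ[R] S), IsSimpleModule R S ∧ Function.Surjective p ∧
      IsBiperfect hs S := by
  have := b.finite
  have := b.projective
  have := b.injective hs
  have := hP.1
  have := hX.isLocal.1
  obtain ⟨S, p, _, hp⟩ := exists_simple_quotient R P
  obtain ⟨j, hj⟩ := b.exists_socle hs hp
  obtain ⟨s, r, -, hrs⟩ := hf.exists_retract_quotient hP hj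
  let E := LinearEquiv.ofBijective s (hP.bijective_of_quotient_retract hrs)
  have hquot : IsBiperfect hs (ModuleCat.of R (P ⧸ LinearMap.range j)) :=
    hX.biperfect.of_linearEquiv E.symm
  exact ⟨S, p, ‹_›, hp, hquot.ker (isShortExact_range hj) b⟩

theorem DualBasis.isCore_of_retract_quotient (b : DualBasis e P) (hP : IsLocalModule R P)
    [Nontrivial S] {j : S →ₗ[R] P} (hj : Function.Injective j) (hS : IsBiperfect hs S)
    (hY : IsLocalModule R Y) {s : Y →ₗ[R] P ⧸ LinearMap.range j}
    {r : P ⧸ LinearMap.range j →ₗ[R] Y} (hrs : ∀ y, r (s y) = y) : IsCore hs Y := by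
  have := b.finite
  have hr : Function.Surjective (r ∘ₗ (LinearMap.range j).mkQ) :=
    (Function.LeftInverse.surjective hrs).comp (Submodule.mkQ_surjective _)
  refine ⟨.of_surjective _ hr, hY, fun _ => ?_, IsBiperfect.of_retract
    (M := ModuleCat.of R (P ⧸ LinearMap.range j)) (hS.coker (isShortExact_range hj) b) s r hrs⟩
  obtain ⟨t, ht⟩ := Module.projective_lifting_property _ LinearMap.id hr
  have := hY.1
  have ht' := (hP.bijective_of_retract (i := t)
    (r := r ∘ₗ (LinearMap.range j).mkQ) (LinearMap.congr_fun ht)).2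
  refine LinearMap.ne_zero_of_injective hj (LinearMap.ext fun x => ?_)
  obtain ⟨y, hy⟩ := ht' (j x)
  have hy0 : y = 0 := (LinearMap.congr_fun ht y).symm.trans <| by
    rw [LinearMap.comp_apply, hy, LinearMap.comp_apply,
      (isShortExact_range hj).exact.apply_apply_eq_zero, map_zero]
  rw [← hy, hy0, map_zero, LinearMap.zero_apply]

variable [FiniteDimensional K R]

namespace IsCore

theorem exists_tau (hM : IsCore hs M) :
    ∃ (L E : ModuleCat.{u} R) (l : L →ₗ[R] E) (q : E →ₗ[R] M),
      IsCore hs L ∧ IsTau K M L ∧ IsAlmostSplit l q := by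
  have := IsArtinianRing.of_finite K R
  have := hM.finite
  obtain ⟨p⟩ := nonempty_minProjPresentation M
  obtain ⟨b₀⟩ := hM.biperfect.nonempty_dualBasis₀ p
  obtain ⟨b₁⟩ := hM.biperfect.nonempty_dualBasis₁ p
  let L := ModuleCat.of R (LinearMap.ker p.d.hom)
  have hX : IsCore hs (ModuleCat.of R (LinearMap.ker p.π.hom)) :=
    hM.syzygy b₀ (isShortExact_ker p.surjective) p.superfluous₀
  have hL : IsCore hs L :=
    hX.syzygy b₁ p.isShortExact_toSyzygy (p.ker_toSyzygy ▸ p.superfluous₁)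
  obtain ⟨E, l, q, h⟩ := hM.exists_isAlmostSplit (L := L) b₀ b₁
    (ι := (LinearMap.ker p.d.hom).subtype) Subtype.val_injective
    (LinearMap.exact_subtype_ker_map _) p.surjective p.function_exact hL.isLocal
  exact ⟨L, E, l, q, hL, hM.biperfect.isTau p, h⟩

theorem exists_tauInv (hM : IsCore hs M) :
    ∃ (E N : ModuleCat.{u} R) (l : M →ₗ[R] E) (q : E →ₗ[R] N),
      IsCore hs N ∧ IsTau K N M ∧ IsAlmostSplit l q := by
  obtain ⟨Q₀, N₁, b₁, i₀, p₀, h₀, hs₀, hN₁⟩ := hM.exists_cosyzygy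
  obtain ⟨Q₁, N, b₀, i₁, p₁, h₁, hs₁, hN⟩ := hN₁.exists_cosyzygy
  have := hN.finite
  let d : Q₀ →ₗ[R] Q₁ := i₁ ∘ₗ p₀
  have hd : Function.Exact i₀ d := h₀.exact.comp_injective i₁ h₁.inj (map_zero i₁)
  have hp₁ : Function.Exact d p₁ := (h₀.surj.comp_exact_iff_exact).2 h₁.exact
  have hker : LinearMap.ker d = LinearMap.ker p₀ :=
    LinearMap.ker_comp_of_ker_eq_bot p₀ (LinearMap.ker_eq_bot.2 h₁.inj)
  let p : MinProjPresentation N :=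
    ⟨Q₀, Q₁, ModuleCat.ofHom d, ModuleCat.ofHom p₁, b₁.projective, b₀.projective, h₁.surj,
      hp₁.linearMap_ker_eq.symm, hs₁, hker.symm ▸ hs₀⟩
  let ι : M ≃ₗ[R] LinearMap.ker d := (LinearEquiv.ofInjective i₀ h₀.inj).trans
    (LinearEquiv.ofEq _ _ hd.linearMap_ker_eq.symm)
  obtain ⟨p', ⟨φ⟩⟩ := hN.biperfect.isTau p
  obtain ⟨E, l, q, h⟩ := hN.exists_isAlmostSplit b₀ b₁ h₀.inj hd h₁.surj hp₁ hM.isLocal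
  exact ⟨E, N, l, q, hN, ⟨p', ⟨(ι.toModuleIso (X₂ := LinearMap.ker d)) ≪≫ φ⟩⟩, h⟩

end IsCore

theorem IsExtendedCore.exists_socle (hX : IsExtendedCore hs X) [Module.Projective R X] :
    ∃ (S : ModuleCat.{u} R) (_ : DualBasis e X) (j : S →ₗ[R] X), IsSimpleModule R S ∧
      Function.Injective j ∧ IsBiperfect hs S := by
  have := hX.finite
  obtain ⟨S, p, _, hp, hS⟩ := hX.top ‹_›
  obtain ⟨b⟩ := hX.biperfect.nonempty_dualBasis
  obtain ⟨j, hj⟩ := b.exists_socle hs hp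
  exact ⟨S, b, j, ‹_›, hj, hS⟩

theorem DualBasis.isCore_of_retract_ker (b : DualBasis e P) (hP : IsLocalModule R P)
    [Nontrivial S] {p : P →ₗ[R] S} (hp : Function.Surjective p) (hS : IsBiperfect hs S)
    (hY : IsLocalModule R Y) {g : Y →ₗ[R] LinearMap.ker p} {r : LinearMap.ker p →ₗ[R] Y}
    (hrg : ∀ y, r (g y) = y) : IsCore hs Y := by
  have := IsNoetherianRing.of_finite K R
  have := b.finite
  have hg : Function.Injective ((LinearMap.ker p).subtype ∘ₗ g) :=
    Subtype.val_injective.comp (Function.LeftInverse.injective hrg)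
  have : Module.Finite R Y := .of_injective _ hg
  have hbY : IsBiperfect hs Y := IsBiperfect.of_retract (M := ModuleCat.of R (LinearMap.ker p))
    (hS.ker (isShortExact_ker hp) b) g r hrg
  refine ⟨‹_›, hY, fun _ => ?_, hbY⟩
  obtain ⟨c⟩ := hbY.nonempty_dualBasis
  have := c.injective hs
  obtain ⟨t, ht⟩ := Module.Injective.out _ hg LinearMap.id
  have := hY.1
  refine LinearMap.ne_zero_of_surjective hp (LinearMap.ext fun x => ?_)
  obtain ⟨y, rfl⟩ := (hP.bijective_of_retract ht).2 x
  exact (g y).2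

theorem IsCore.exists_top_of_irreducible_from (hX : IsCore hs X) (b : DualBasis e P)
    (hP : IsLocalModule R P) {f : X ⟶ P} (hf : IsIrreducibleMor f) :
    ∃ (S : ModuleCat.{u} R) (p : P →ₗ[R] S), IsSimpleModule R S ∧ Function.Surjective p ∧
      IsBiperfect hs S := by
  have := IsNoetherianRing.of_finite K R
  have := b.finite
  have := b.projective
  have := b.injective hs
  have := hP.1
  have := hX.isLocal.1
  obtain ⟨S, p, _, hp⟩ := exists_simple_quotient R P
  obtain ⟨j, hj⟩ := b.exists_socle hs hp
  obtain ⟨g, r, -, hrg⟩ := hf.exists_retract_ker hP hp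
  let E := LinearEquiv.ofBijective g (hP.bijective_of_submodule_retract hj hrg)
  have hker : IsBiperfect hs (ModuleCat.of R (LinearMap.ker p)) :=
    hX.biperfect.of_linearEquiv E.symm
  exact ⟨S, p, ‹_›, hp, hker.coker (isShortExact_ker hp) b⟩

namespace IsExtendedCore

theorem of_irreducible_from (hX : IsExtendedCore hs X) [Module.Finite R Y]
    (hY : IsLocalModule R Y) {f : X ⟶ Y} (hf : IsIrreducibleMor f) : IsExtendedCore hs Y := by
  have := hX.finite
  by_cases hproj : Module.Projective R X
  · obtain ⟨S, b, j, _, hj, hS⟩ := hX.exists_socle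
    have := b.injective hs
    have := IsSimpleModule.nontrivial R S
    obtain ⟨s, r, -, hrs⟩ := hf.exists_retract_quotient hX.isLocal hj
    exact (b.isCore_of_retract_quotient hX.isLocal hj hS hY hrs).isExtendedCore
  · obtain ⟨E, N, l, q, hN, -, h⟩ := (hX.isCore hproj).exists_tauInv
    obtain ⟨s, r, hrs⟩ := h.exists_retract_of_irreducible_from hf
    have hbY : IsBiperfect hs Y := (hX.biperfect.extension hN.biperfect h.ses).of_retract s r hrs
    refine ⟨‹_›, hY, hbY, fun _ => ?_⟩
    obtain ⟨b⟩ := hbY.nonempty_dualBasis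
    exact (hX.isCore hproj).exists_top_of_irreducible_from b hY hf

theorem of_irreducible_to (hX : IsExtendedCore hs X) [Module.Finite R Y]
    (hY : IsLocalModule R Y) {f : Y ⟶ X} (hf : IsIrreducibleMor f) : IsExtendedCore hs Y := by
  have := IsNoetherianRing.of_finite K R
  have := hX.finite
  by_cases hproj : Module.Projective R X
  · obtain ⟨S, p, _, hp, hS⟩ := hX.top hproj
    obtain ⟨b⟩ := hX.biperfect.nonempty_dualBasis
    have := IsSimpleModule.nontrivial R S
    obtain ⟨g, r, -, hrg⟩ := hf.exists_retract_ker hX.isLocal hp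
    exact (b.isCore_of_retract_ker hX.isLocal hp hS hY hrg).isExtendedCore
  · obtain ⟨L, E, l, q, hL, -, h⟩ := (hX.isCore hproj).exists_tau
    obtain ⟨s, r, hrs⟩ := h.exists_retract_of_irreducible_to hf
    have hbY : IsBiperfect hs Y := (hL.biperfect.extension hX.biperfect h.ses).of_retract s r hrs
    refine ⟨‹_›, hY, hbY, fun _ => ?_⟩
    obtain ⟨b⟩ := hbY.nonempty_dualBasis
    exact (hX.isCore hproj).exists_top_of_irreducible_to b hY hf

end IsExtendedCore

end Components

section Vertices

theorem exists_biinfinite_chain {T : Type*} {r : T → T → Prop} (hnext : ∀ x, ∃ y, r x y)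
    (hprev : ∀ x, ∃ y, r y x) (x₀ : T) : ∃ X : ℤ → T, X 0 = x₀ ∧ ∀ n, r (X n) (X (n + 1)) := by
  choose next hnext using hnext
  choose prev hprev using hprev
  let X : ℤ → T
    | Int.ofNat n => next^[n] x₀
    | Int.negSucc n => prev^[n + 1] x₀
  refine ⟨X, rfl, fun n => ?_⟩
  match n with
  | Int.ofNat n =>
    have : X (Int.ofNat n + 1) = next (X (Int.ofNat n)) := Function.iterate_succ_apply' next n x₀
    exact this ▸ hnext _
  | Int.negSucc 0 => exact hprev x₀
  | Int.negSucc (n + 1) =>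
    have h : X (Int.negSucc (n + 1)) = prev (X (Int.negSucc n)) :=
      Function.iterate_succ_apply' prev (n + 1) x₀
    have hn : Int.negSucc (n + 1) + 1 = Int.negSucc n := by omega
    exact hn ▸ h ▸ hprev _

variable {K : Type u} [Field K] {R : Type u} [Ring R] [Algebra K R] {e : R} {lam : R →ₗ[K] K}
  {hs : IsSymmIdempotent e lam}

theorem IsExtendedCore.of_iso {X Y : ModuleCat.{u} R} (hX : IsExtendedCore hs X) (φ : X ≅ Y) :
    IsExtendedCore hs Y :=
  hX.of_linearEquiv φ.toLinearEquiv

theorem IsStable.nonproj {M : IndMod R} (h : IsStable K M) : ¬ Module.Projective R M.1 := by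
  obtain ⟨X, rfl, hX, -⟩ := h
  exact hX 0

variable [FiniteDimensional K R]

variable (K) in
include K in
theorem IndMod.isLocalModule (X : IndMod R) : IsLocalModule R X.1 := by
  have := IsArtinianRing.of_finite K R
  have := IsNoetherianRing.of_finite K R
  have := X.2.1
  exact isLocalModule_of_indecomposable X.2.2

theorem AREdge.isExtendedCore_iff {X Y : IndMod R} (h : AREdge X Y) :
    IsExtendedCore hs X.1 ↔ IsExtendedCore hs Y.1 := by
  have := X.2.1
  have := Y.2.1
  obtain ⟨⟨φ⟩⟩ | ⟨f, hf⟩ := h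
  · exact ⟨fun h => h.of_iso φ, fun h => h.of_iso φ.symm⟩
  · exact ⟨fun h => h.of_irreducible_from (Y.isLocalModule K) hf,
      fun h => h.of_irreducible_to (X.isLocalModule K) hf⟩

theorem isExtendedCore_iff_of_eqvGen {X Y : IndMod R} (h : Relation.EqvGen AREdge X Y) :
    IsExtendedCore hs X.1 ↔ IsExtendedCore hs Y.1 := by
  induction h with
  | rel _ _ h => exact h.isExtendedCore_iff
  | refl => rfl
  | symm _ _ _ ih => exact ih.symm
  | trans _ _ _ _ _ ih₁ ih₂ => exact ih₁.trans ih₂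

theorem isCore_iff_of_eqvGen {X Y : IndMod R}
    (h : Relation.EqvGen (fun U V => IsStable K U ∧ IsStable K V ∧ AREdge U V) X Y) :
    IsCore hs X.1 ↔ IsCore hs Y.1 := by
  induction h with
  | rel _ _ h =>
    have hUV := h.2.2.isExtendedCore_iff (hs := hs)
    exact ⟨fun hX => (hUV.1 hX.isExtendedCore).isCore h.2.1.nonproj,
      fun hY => (hUV.2 hY.isExtendedCore).isCore h.1.nonproj⟩
  | refl => rfl
  | symm _ _ _ ih => exact ih.symm
  | trans _ _ _ _ _ ih₁ ih₂ => exact ih₁.trans ih₂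

theorem IsCore.isStable {M : IndMod R} (hM : IsCore hs M.1) : IsStable K M := by
  let T := {M : IndMod R // IsCore hs M.1}
  have hnext (M : T) : ∃ N : T, IsTau K M.1.1 N.1.1 := by
    obtain ⟨L, -, -, -, hL, hτ, -⟩ := M.2.exists_tau
    exact ⟨⟨⟨L, hL.finite, hL.isLocal.indecomposable⟩, hL⟩, hτ⟩
  have hprev (M : T) : ∃ N : T, IsTau K N.1.1 M.1.1 := by
    obtain ⟨-, L, -, -, hL, hτ, -⟩ := M.2.exists_tauInv
    exact ⟨⟨⟨L, hL.finite, hL.isLocal.indecomposable⟩, hL⟩, hτ⟩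
  obtain ⟨X, hX, hτ⟩ := exists_biinfinite_chain hnext hprev ⟨M, hM⟩
  exact ⟨fun n => (X n).1, congrArg Subtype.val hX, fun n => (X n).2.nonproj, hτ⟩

theorem IsGorensteinProjInj.isCore (hs : IsSymmIdempotent e lam) {M : IndMod R}
    (hM : IsGorensteinProjInj K M.1) (h : ¬ Module.Projective R M.1) : IsCore hs M.1 :=
  have := M.2.1
  ⟨M.2.1, M.isLocalModule K, h, hM.isBiperfect hs⟩

theorem gorensteinProjInj_of_component (hs : IsSymmIdempotent e lam) {C : Set (IndMod R)}
    (hC : IsARComponent C)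
    (hM : ∃ M ∈ C, ¬ Module.Projective R M.1 ∧ IsGorensteinProjInj K M.1) :
    ∀ N ∈ C, IsGorensteinProjInj K N.1 := by
  obtain ⟨X, rfl⟩ := hC
  obtain ⟨M, hXM, hp, hg⟩ := hM
  intro N hXN
  have hMN := (hXM.symm _ _).trans _ _ _ hXN
  have hN : IsExtendedCore hs N.1 :=
    (isExtendedCore_iff_of_eqvGen hMN).1 (hg.isCore hs hp).isExtendedCore
  have := N.2.1
  exact hN.biperfect.isGorensteinProjInj

theorem gorensteinProjInj_eq_sUnion (hs : IsSymmIdempotent e lam) :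
    ∃ S : Set (Set (IndMod R)), (∀ C ∈ S, IsStableARComponent K C) ∧
      {M : IndMod R | ¬ Module.Projective R M.1 ∧ IsGorensteinProjInj K M.1} = ⋃₀ S := by
  refine ⟨{C | ∃ X : IndMod R, IsCore hs X.1 ∧ C = {Y | Relation.EqvGen
    (fun U V => IsStable K U ∧ IsStable K V ∧ AREdge U V) X Y}}, ?_, Set.ext fun M => ⟨?_, ?_⟩⟩
  · rintro C ⟨X, hX, rfl⟩
    exact ⟨X, hX.isStable, rfl⟩
  · rintro ⟨hp, hg⟩
    exact ⟨_, ⟨M, hg.isCore hs hp, rfl⟩, Relation.EqvGen.refl _⟩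
  · rintro ⟨-, ⟨X, hX, rfl⟩, hXM⟩
    have hM := (isCore_iff_of_eqvGen hXM).1 hX
    have := hM.finite
    exact ⟨hM.nonproj, hM.biperfect.isGorensteinProjInj⟩

end Vertices

section Decomposition

variable {R : Type u} [Ring R]

/-- A finite decomposition of `M` into direct summands with local endomorphism rings. -/
structure LocalDecomposition (M : ModuleCat.{u} R) where
  κ : Type
  fintype : Fintype κ
  part : κ → ModuleCat.{u} R
  incl : ∀ k, part k →ₗ[R] M
  proj : ∀ k, M →ₗ[R] part k
  isLocal : ∀ k, IsLocalModule R (part k)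
  proj_incl : ∀ k x, proj k (incl k x) = x
  sum_incl : ∀ x, ∑ k, incl k (proj k x) = x

attribute [instance] LocalDecomposition.fintype

namespace LocalDecomposition

variable {M : ModuleCat.{u} R}

theorem finite_part (c : LocalDecomposition M) [Module.Finite R M] (k : c.κ) :
    Module.Finite R (c.part k) :=
  Module.Finite.of_surjective (c.proj k) fun x => ⟨_, c.proj_incl k x⟩

theorem exists_proj_comp_ne_zero (c : LocalDecomposition M) {X : Type*} [AddCommGroup X]
    [Module R X] {f : X →ₗ[R] M} (hf : f ≠ 0) : ∃ k, c.proj k ∘ₗ f ≠ 0 := by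
  by_contra! h
  refine hf (LinearMap.ext fun x => ?_)
  rw [← c.sum_incl (f x)]
  exact Finset.sum_eq_zero fun k _ => by rw [← LinearMap.comp_apply (c.proj k), h]; simp

theorem exists_comp_incl_ne_zero (c : LocalDecomposition M) {X : Type*} [AddCommGroup X]
    [Module R X] {f : M →ₗ[R] X} (hf : f ≠ 0) : ∃ k, f ∘ₗ c.incl k ≠ 0 := by
  by_contra! h
  refine hf (LinearMap.ext fun x => ?_)
  rw [← c.sum_incl x, map_sum]
  exact Finset.sum_eq_zero fun k _ => by rw [← LinearMap.comp_apply f, h]; simp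

theorem projective (c : LocalDecomposition M) (h : ∀ k, Module.Projective R (c.part k)) :
    Module.Projective R M := by
  refine .of_lifting_property'' fun f hf => ?_
  choose t ht using fun k => Module.projective_lifting_property f (c.incl k) hf
  refine ⟨∑ k, t k ∘ₗ c.proj k, LinearMap.ext fun x => ?_⟩
  have ht' (k) (y) : f (t k y) = c.incl k y := LinearMap.congr_fun (ht k) y
  simp only [LinearMap.comp_apply, LinearMap.sum_apply, map_sum, ht', c.sum_incl,
    LinearMap.id_apply]

theorem injective (c : LocalDecomposition M) (h : ∀ k, Module.Injective R (c.part k)) :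
    Module.Injective R M where
  out U V _ _ _ _ i hi f := by
    choose t ht using fun k => (h k).out i hi (c.proj k ∘ₗ f)
    refine ⟨∑ k, c.incl k ∘ₗ t k, fun x => ?_⟩
    simp only [LinearMap.sum_apply, LinearMap.comp_apply, ht, c.sum_incl]

open Classical in
/-- The endomorphism of `M` that projects onto the summands whose index satisfies `p`. -/
def projOn (c : LocalDecomposition M) (p : c.κ → Prop) : Module.End R M :=
  ∑ k with p k, c.incl k ∘ₗ c.proj k

theorem projOn_apply (c : LocalDecomposition M) (p : c.κ → Prop) [DecidablePred p] (x : M) :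
    c.projOn p x = ∑ k with p k, c.incl k (c.proj k x) := by
  simp only [projOn, LinearMap.sum_apply, LinearMap.comp_apply]
  congr!

theorem projOn_add_projOn_not (c : LocalDecomposition M) (p : c.κ → Prop) :
    c.projOn p + c.projOn (fun k => ¬ p k) = 1 := by
  classical
  ext x
  rw [LinearMap.add_apply, projOn_apply, projOn_apply, Finset.sum_filter_add_sum_filter_not,
    c.sum_incl, Module.End.one_apply]

theorem proj_projOn_eq_zero (c : LocalDecomposition M) {p : c.κ → Prop} {k : c.κ}
    (h : ∀ j, p j → ∀ ψ : c.part j →ₗ[R] c.part k, ψ = 0) (φ : Module.End R M) (x : M) :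
    c.proj k (φ (c.projOn p x)) = 0 := by
  classical
  rw [projOn_apply, map_sum, map_sum]
  exact Finset.sum_eq_zero fun j hj => LinearMap.congr_fun
    (h j (Finset.mem_filter.1 hj).2 (c.proj k ∘ₗ φ ∘ₗ c.incl j)) (c.proj j x)

theorem projOn_mul_mul_projOn (c : LocalDecomposition M) {p q : c.κ → Prop}
    (h : ∀ j k, p j → q k → ∀ ψ : c.part j →ₗ[R] c.part k, ψ = 0) (φ : Module.End R M) :
    c.projOn q * φ * c.projOn p = 0 := by
  classical
  ext x
  refine (c.projOn_apply q _).trans (Finset.sum_eq_zero fun k hk => ?_)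
  rw [c.proj_projOn_eq_zero (fun j hj => h j k hj (Finset.mem_filter.1 hk).2), map_zero]

theorem isIdempotentElem_projOn (c : LocalDecomposition M) {p : c.κ → Prop}
    (h : ∀ j k, ¬ p j → p k → ∀ ψ : c.part j →ₗ[R] c.part k, ψ = 0) :
    IsIdempotentElem (c.projOn p) := by
  have h1 := c.projOn_mul_mul_projOn h 1
  rw [mul_one] at h1
  rw [IsIdempotentElem]
  conv_rhs => rw [← mul_one (c.projOn p), ← c.projOn_add_projOn_not p, mul_add, h1, add_zero]

section Orthogonal

variable (c : LocalDecomposition M) {p : c.κ → Prop}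
  (h₁ : ∀ j k, p j → ¬ p k → ∀ ψ : c.part j →ₗ[R] c.part k, ψ = 0)
include h₁

theorem forall_of_projOn_eq_one (h : c.projOn p = 1) (k : c.κ) : p k := by
  by_contra hk
  have := (c.isLocal k).1
  obtain ⟨x, hx⟩ := exists_ne (0 : c.part k)
  refine hx ?_
  rw [← c.proj_incl k x, ← c.proj_projOn_eq_zero (fun j hj => h₁ j k hj hk) 1 (c.incl k x), h]
  rfl

variable (h₂ : ∀ j k, ¬ p j → p k → ∀ ψ : c.part j →ₗ[R] c.part k, ψ = 0)
include h₂

theorem commute_projOn (φ : Module.End R M) : Commute (c.projOn p) φ := calc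
  c.projOn p * φ = c.projOn p * φ * (c.projOn p + c.projOn fun k => ¬ p k) := by
    rw [c.projOn_add_projOn_not, mul_one]
  _ = c.projOn p * φ * c.projOn p := by
    rw [mul_add, c.projOn_mul_mul_projOn h₂, add_zero]
  _ = (c.projOn p + c.projOn fun k => ¬ p k) * φ * c.projOn p := by
    rw [add_mul, add_mul, c.projOn_mul_mul_projOn h₁, add_zero]
  _ = φ * c.projOn p := by rw [c.projOn_add_projOn_not, one_mul]

end Orthogonal

/-- The decomposition of a zero module into no summands. -/
def empty (M : ModuleCat.{u} R) [Subsingleton M] : LocalDecomposition M :=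
  ⟨Empty, inferInstance, nofun, nofun, nofun, nofun, nofun, fun _ => Subsingleton.elim _ _⟩

/-- The decomposition of a local module into a single summand. -/
def single (h : IsLocalModule R M) : LocalDecomposition M :=
  ⟨Unit, inferInstance, fun _ => M, fun _ => LinearMap.id, fun _ => LinearMap.id, fun _ => h,
    fun _ _ => rfl, fun _ => by simp⟩

/-- The decomposition of `M` obtained from those of two complementary submodules. -/
def sup {A B : Submodule R M} (h : IsCompl A B) (c : LocalDecomposition (ModuleCat.of R A))
    (d : LocalDecomposition (ModuleCat.of R B)) : LocalDecomposition M where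
  κ := c.κ ⊕ d.κ
  fintype := inferInstance
  part := Sum.elim c.part d.part
  incl k := match k with
    | .inl k => A.subtype ∘ₗ c.incl k
    | .inr k => B.subtype ∘ₗ d.incl k
  proj k := match k with
    | .inl k => c.proj k ∘ₗ A.projectionOnto B h
    | .inr k => d.proj k ∘ₗ B.projectionOnto A h.symm
  isLocal k := match k with
    | .inl k => c.isLocal k
    | .inr k => d.isLocal k
  proj_incl k := match k with
    | .inl k => fun x => (congrArg (c.proj k)
        (Submodule.projectionOnto_apply_left h _)).trans (c.proj_incl k x)
    | .inr k => fun x => (congrArg (d.proj k)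
        (Submodule.projectionOnto_apply_left h.symm _)).trans (d.proj_incl k x)
  sum_incl x := by
    rw [Fintype.sum_sum_type]
    change ∑ k, A.subtype (c.incl k (c.proj k (A.projectionOnto B h x))) +
      ∑ k, B.subtype (d.incl k (d.proj k (B.projectionOnto A h.symm x))) = x
    rw [← map_sum, ← map_sum, c.sum_incl, d.sum_incl]
    exact Submodule.projection_add_projection_eq_self h x

end LocalDecomposition

theorem nonempty_localDecomposition (M : ModuleCat.{u} R) [IsArtinian R M] [IsNoetherian R M] :
    Nonempty (LocalDecomposition M) := by
  induction hn : Module.length R M using WellFoundedLT.induction generalizing M with | ind n ih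
  obtain _ | _ := subsingleton_or_nontrivial M
  · exact ⟨.empty M⟩
  by_cases hM : Indecomposable M
  · exact ⟨.single (isLocalModule_of_indecomposable hM)⟩
  obtain ⟨f, hf, hf0, hf1⟩ : ∃ f : Module.End R M, IsIdempotentElem f ∧ f ≠ 0 ∧ f ≠ 1 := by
    by_contra! h
    exact hM (indecomposable_of_isIdempotentElem fun f hf => or_iff_not_imp_left.2 (h f hf))
  have hcompl := LinearMap.IsIdempotentElem.isCompl hf
  have hran : LinearMap.range f ≠ ⊤ := fun h => hf1 <| LinearMap.ext fun x => by
    obtain ⟨y, rfl⟩ := LinearMap.range_eq_top.1 h x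
    exact LinearMap.congr_fun hf y
  have hker : LinearMap.ker f ≠ ⊤ := mt LinearMap.ker_eq_top.1 hf0
  obtain ⟨c⟩ := ih _ (hn ▸ Submodule.length_lt hran) (ModuleCat.of R (LinearMap.range f)) rfl
  obtain ⟨d⟩ := ih _ (hn ▸ Submodule.length_lt hker) (ModuleCat.of R (LinearMap.ker f)) rfl
  exact ⟨.sup hcompl c d⟩

theorem LocalDecomposition.forall_or_forall_not (hconn : IsConnectedAlg R)
    (c : LocalDecomposition (ModuleCat.of R R)) {p : c.κ → Prop}
    (h₁ : ∀ j k, p j → ¬ p k → ∀ ψ : c.part j →ₗ[R] c.part k, ψ = 0)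
    (h₂ : ∀ j k, ¬ p j → p k → ∀ ψ : c.part j →ₗ[R] c.part k, ψ = 0) :
    (∀ k, p k) ∨ ∀ k, ¬ p k := by
  let ε : Module.End R R := c.projOn p
  have apply_eq (x : R) : ε x = x * ε 1 := by
    rw [← smul_eq_mul, ← map_smul, smul_eq_mul, mul_one]
  have idem : IsIdempotentElem (ε 1) :=
    (apply_eq _).symm.trans (LinearMap.congr_fun (c.isIdempotentElem_projOn h₂) 1)
  have central : ε 1 ∈ Subring.center R := Subring.mem_center_iff.2 fun y => by
    have := LinearMap.congr_fun (c.commute_projOn h₁ h₂ (LinearMap.toSpanSingleton R R y)) 1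
    change ε ((1 : R) • y) = ε 1 • y at this
    rw [← apply_eq, ← smul_eq_mul (ε 1), ← this, one_smul]
  rcases hconn.2 _ idem central with h | h
  · have hε : c.projOn p = 0 := LinearMap.ext fun x => (apply_eq x).trans (by rw [h, mul_zero]; rfl)
    refine .inr (c.forall_of_projOn_eq_one (fun j k hj hk => h₂ j k hj (not_not.1 hk)) ?_)
    rw [← c.projOn_add_projOn_not p, hε, zero_add]
  · exact .inl (c.forall_of_projOn_eq_one h₁
      (LinearMap.ext fun x => (apply_eq x).trans (by rw [h, mul_one]; rfl)))

end Decomposition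

section LeftAlmostSplit

/-- The map `l` out of `X` is left almost split: it does not split, and every map from `X` to a
finitely generated module that does not split factors through it. -/
structure IsLeftAlmostSplit {R : Type u} [Ring R] {X E : ModuleCat.{u} R} (l : X →ₗ[R] E) :
    Prop where
  no_retraction : ¬ HasRetraction l
  exists_factor : ∀ (Q : ModuleCat.{u} R) (f : X →ₗ[R] Q), Module.Finite R Q → ¬ HasRetraction f →
    ∃ t : E →ₗ[R] Q, ∀ x, t (l x) = f x

theorem IsLocalModule.isLeftAlmostSplit_mkQ {R : Type u} [Ring R] {P S : ModuleCat.{u} R}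
    [Module.Injective R P] (hP : IsLocalModule R P) [IsSimpleModule R S] {j : S →ₗ[R] P}
    (hj : Function.Injective j) :
    IsLeftAlmostSplit (E := ModuleCat.of R (P ⧸ LinearMap.range j)) (LinearMap.range j).mkQ where
  no_retraction := fun ⟨t, ht⟩ => by
    have := IsSimpleModule.nontrivial R S
    obtain ⟨z, hz⟩ := exists_ne (0 : S)
    have hmk : (LinearMap.range j).mkQ (j z) = 0 := (Submodule.Quotient.mk_eq_zero _).2 ⟨z, rfl⟩
    refine hz (hj ?_)
    rw [← ht (j z), hmk, map_zero, map_zero]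
  exists_factor Q f _ hf := by
    have hle : LinearMap.range j ≤ LinearMap.ker f := hP.range_le_of_ne_bot hj fun h =>
      hf (Module.Injective.out f (LinearMap.ker_eq_bot.1 h) (LinearMap.id : P →ₗ[R] P))
    exact ⟨(LinearMap.range j).liftQ f hle, fun _ => rfl⟩

theorem IsExtendedCore.exists_isLeftAlmostSplit {K : Type u} [Field K] {R : Type u} [Ring R]
    [Algebra K R] [FiniteDimensional K R] {e : R} {lam : R →ₗ[K] K} {hs : IsSymmIdempotent e lam}
    {X : ModuleCat.{u} R} (hX : IsExtendedCore hs X) :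
    ∃ (E : ModuleCat.{u} R) (l : X →ₗ[R] E), Module.Finite R E ∧ IsLeftAlmostSplit l ∧
      ∀ (Y : ModuleCat.{u} R) (s : Y →ₗ[R] E) (r : E →ₗ[R] Y), (∀ y, r (s y) = y) →
        IsLocalModule R Y → IsExtendedCore hs Y := by
  have := hX.finite
  by_cases hproj : Module.Projective R X
  · obtain ⟨S, b, j, _, hj, hS⟩ := hX.exists_socle
    have := b.injective hs
    have := IsSimpleModule.nontrivial R S
    exact ⟨_, _, inferInstanceAs (Module.Finite R (X ⧸ LinearMap.range j)),
      hX.isLocal.isLeftAlmostSplit_mkQ hj, fun Y s r hrs hY =>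
      (b.isCore_of_retract_quotient hX.isLocal hj hS hY hrs).isExtendedCore⟩
  · have := IsArtinianRing.of_finite K R
    obtain ⟨E, N, l, q, hN, -, h⟩ := (hX.isCore hproj).exists_tauInv
    have := h.finite
    refine ⟨E, l, h.finite, ⟨h.no_retraction, h.left⟩, fun Y s r hrs hY => ?_⟩
    have := hY.1
    have : Module.Finite R Y := .of_surjective r (Function.LeftInverse.surjective hrs)
    exact hX.of_irreducible_from hY (h.isIrreducibleMor hN.isLocal hX.isLocal s r hrs)

end LeftAlmostSplit

section Vanishing

variable {R : Type u} [Ring R]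

theorem mem_jacobson_of_not_hasRetraction {G X Y : ModuleCat.{u} R} (hX : IsLocalModule R X)
    {r : X →ₗ[R] Y} (hr : ¬ HasRetraction r) (π : G →ₗ[R] X) (σ : Y →ₗ[R] G) :
    (σ ∘ₗ r ∘ₗ π : Module.End R G) ∈ Ideal.jacobson (⊥ : Ideal (Module.End R G)) := by
  refine Ideal.mem_jacobson_iff.2 fun y => ?_
  let a : Module.End R G := y * (σ ∘ₗ r ∘ₗ π)
  let b : Module.End R X := π ∘ₗ (y : G →ₗ[R] G) ∘ₗ σ ∘ₗ r
  obtain ⟨n, hn⟩ : IsNilpotent b := (hX.2 b).resolve_right fun hb => hr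
    ⟨(LinearEquiv.ofBijective b hb).symm.toLinearMap ∘ₗ π ∘ₗ (y : G →ₗ[R] G) ∘ₗ σ,
      (LinearEquiv.ofBijective b hb).symm_apply_apply⟩
  have comm : (b ^ n) ∘ₗ π = π ∘ₗ (a ^ n) :=
    Module.End.commute_pow_left_of_commute (g₂ := b) (f := π) (g := a) rfl n
  have ha : IsNilpotent a := ⟨n + 1, LinearMap.ext fun x => by
    have h : π ((a ^ n) x) = 0 := by rw [← LinearMap.comp_apply, ← comm, hn]; rfl
    rw [pow_succ', Module.End.mul_apply, Module.End.mul_apply]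
    simp [h]⟩
  obtain ⟨z, hz⟩ := ha.isUnit_add_one.exists_left_inv
  refine ⟨z, ?_⟩
  rw [mul_add, mul_one, ← mul_assoc] at hz
  rw [hz, sub_self]
  exact Submodule.zero_mem _

theorem eq_zero_of_mem_closure_comp {G Q : ModuleCat.{u} R} {J : Ideal (Module.End R G)}
    [J.IsTwoSided] (hJ : IsNilpotent J)
    (h : ∀ f : G →ₗ[R] Q, f ∈ AddSubmonoid.closure
      {f | ∃ (g : G →ₗ[R] Q) (a : Module.End R G), a ∈ J ∧ g ∘ₗ a = f}) (f : G →ₗ[R] Q) :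
    f = 0 := by
  obtain ⟨N, hN⟩ := hJ
  have comp_eq_zero : ∀ a ∈ J ^ 0, ∀ f : G →ₗ[R] Q, f ∘ₗ a = 0 := by
    refine Nat.decreasingInduction (motive := fun m _ => ∀ a ∈ J ^ m, ∀ f : G →ₗ[R] Q, f ∘ₗ a = 0)
      (fun m _ ih a ha f => ?_) (fun a ha f => ?_) N.zero_le
    · induction h f using AddSubmonoid.closure_induction with
      | mem _ hf =>
        obtain ⟨g, b, hb, rfl⟩ := hf
        exact ih (b * a) (Ideal.IsTwoSided.pow_succ (I := J) m ▸ Ideal.mul_mem_mul hb ha) g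
      | zero => exact LinearMap.zero_comp a
      | add f g _ _ hf hg => rw [LinearMap.add_comp, hf, hg, add_zero]
    · rw [hN] at ha
      rw [show a = 0 from ha, LinearMap.comp_zero]
  exact comp_eq_zero 1 (by rw [Submodule.pow_zero]; exact Submodule.one_le.1 le_rfl) f

variable {K : Type u} [Field K] [Algebra K R] [FiniteDimensional K R] {n : ℕ}
  {F : Fin n → ModuleCat.{u} R}

variable (K) in
include K in
theorem isNilpotent_jacobson_end (G : ModuleCat.{u} R) [Module.Finite R G] :
    IsNilpotent (Ideal.jacobson (⊥ : Ideal (Module.End R G))) :=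
  have := finiteDimensional_hom K G G
  have := IsArtinianRing.of_finite K (Module.End R G)
  IsArtinianRing.isNilpotent_jacobson_bot

variable (K) in
include K in
theorem hom_pi_eq_zero (hF : ∀ k, IsLocalModule R (F k)) [∀ k, Module.Finite R (F k)]
    (hl : ∀ k, ∃ (E : ModuleCat.{u} R) (l : F k →ₗ[R] E), Module.Finite R E ∧
      IsLeftAlmostSplit l ∧ ∀ (Y : ModuleCat.{u} R) (s : Y →ₗ[R] E) (r : E →ₗ[R] Y),
        (∀ y, r (s y) = y) → IsLocalModule R Y → ∃ j, Nonempty (Y ≃ₗ[R] F j))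
    {Q : ModuleCat.{u} R} [Module.Finite R Q] (hQ : IsLocalModule R Q)
    (hFQ : ∀ k, IsEmpty (F k ≃ₗ[R] Q)) (f : (∀ k, F k) →ₗ[R] Q) : f = 0 := by
  have := IsArtinianRing.of_finite K R
  have := IsNoetherianRing.of_finite K R
  let G := ModuleCat.of R (∀ k, F k)
  have : Module.Finite R G := inferInstanceAs (Module.Finite R (∀ k, F k))
  let σ (k) : F k →ₗ[R] G := LinearMap.single R (fun k => F k) k
  let π (k) : G →ₗ[R] F k := LinearMap.proj k
  refine eq_zero_of_mem_closure_comp (G := G) (isNilpotent_jacobson_end K G) (fun f => ?_) f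
  have hf : f = ∑ k, f ∘ₗ σ k ∘ₗ π k := LinearMap.ext fun x => by
    rw [LinearMap.sum_apply]
    conv_lhs => rw [← Finset.univ_sum_single x, map_sum]
    rfl
  rw [hf]
  refine AddSubmonoid.sum_mem _ fun k _ => ?_
  obtain ⟨E, l, hE, hl, hY⟩ := hl k
  obtain ⟨t, ht⟩ := hl.exists_factor Q (f ∘ₗ σ k) inferInstance fun ⟨r, hr⟩ => by
    have := (hF k).1
    exact (hFQ k).false (.ofBijective (f ∘ₗ σ k) (hQ.bijective_of_retract hr))
  obtain ⟨c⟩ := nonempty_localDecomposition E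
  have hfk : f ∘ₗ σ k ∘ₗ π k = ∑ i, t ∘ₗ c.incl i ∘ₗ c.proj i ∘ₗ l ∘ₗ π k := by
    ext x
    simp only [LinearMap.sum_apply, LinearMap.comp_apply, ← map_sum, c.sum_incl, ht]
  rw [hfk]
  refine AddSubmonoid.sum_mem _ fun i _ => AddSubmonoid.subset_closure ?_
  obtain ⟨j, ⟨φ⟩⟩ := hY _ (c.incl i) (c.proj i) (c.proj_incl i) (c.isLocal i)
  refine ⟨t ∘ₗ c.incl i ∘ₗ φ.symm.toLinearMap ∘ₗ π j, _,
    mem_jacobson_of_not_hasRetraction (hF k) (r := φ.toLinearMap ∘ₗ c.proj i ∘ₗ l)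
      (fun ⟨r, hr⟩ => hl.no_retraction ⟨r ∘ₗ φ.toLinearMap ∘ₗ c.proj i, hr⟩) (π k) (σ j), ?_⟩
  ext x
  have hπσ (y) : π j (σ j y) = y := Pi.single_eq_same (M := fun k => F k) j y
  simp only [LinearMap.comp_apply, hπσ, LinearEquiv.coe_coe, φ.symm_apply_apply]

variable {e : R} {lam : R →ₗ[K] K} {hs : IsSymmIdempotent e lam}

/-- There are only finitely many modules in the extended core, up to isomorphism. -/
def FiniteExtendedCore (hs : IsSymmIdempotent e lam) : Prop :=
  ∃ (n : ℕ) (F : Fin n → ModuleCat.{u} R), (∀ k, IsExtendedCore hs (F k)) ∧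
    ∀ X : ModuleCat.{u} R, IsExtendedCore hs X → ∃ k, Nonempty (X ≃ₗ[R] F k)

namespace FiniteExtendedCore

variable {X P Q : ModuleCat.{u} R} (hfin : FiniteExtendedCore hs)
include hfin

theorem hom_eq_zero (hX : IsExtendedCore hs X) [Module.Finite R Q] (hQ : IsLocalModule R Q)
    (hQ' : ¬ IsExtendedCore hs Q) (f : X →ₗ[R] Q) : f = 0 := by
  obtain ⟨n, F, hF, hF'⟩ := hfin
  have := fun k => (hF k).finite
  obtain ⟨k, ⟨φ⟩⟩ := hF' X hX
  have h := hom_pi_eq_zero K (fun k => (hF k).isLocal) (fun k => ?_) hQ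
    (fun k => ⟨fun ψ => hQ' ((hF k).of_linearEquiv ψ)⟩)
    (f ∘ₗ φ.symm.toLinearMap ∘ₗ LinearMap.proj k)
  · ext x
    simpa using LinearMap.congr_fun h (Pi.single k (φ x))
  · obtain ⟨E, l, hE, hl, hY⟩ := (hF k).exists_isLeftAlmostSplit
    exact ⟨E, l, hE, hl, fun Y s r hrs h => hF' Y (hY Y s r hrs h)⟩

theorem hom_eq_zero_of_projective (hP : IsExtendedCore hs P) [Module.Projective R P]
    [Module.Finite R Q] (hQ : IsLocalModule R Q) (hQ' : ¬ IsExtendedCore hs Q) (f : Q →ₗ[R] P) :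
    f = 0 := by
  have := hP.finite
  obtain ⟨b⟩ := hP.biperfect.nonempty_dualBasis
  refine b.left_eq_zero_of_trace hs f fun v => ?_
  rw [hfin.hom_eq_zero hP hQ hQ' v]
  simp [DualBasis.trace]

theorem exists_isExtendedCore_projective (hX : IsExtendedCore hs X) :
    ∃ P : ModuleCat.{u} R, IsExtendedCore hs P ∧ Module.Projective R P := by
  have := hX.finite
  have := IsArtinianRing.of_finite K R
  have := IsNoetherianRing.of_finite K R
  have := hX.isLocal.1
  obtain ⟨Q, b, i, hi⟩ := exists_embedding hs hX.biperfect.e_faithful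
  have := b.finite
  have := b.projective
  obtain ⟨x, hx⟩ := exists_ne (0 : X)
  have hi0 : i ≠ 0 := fun h => hx (hi (by rw [h]; rfl))
  obtain ⟨d⟩ := nonempty_localDecomposition Q
  obtain ⟨m, hm⟩ := d.exists_proj_comp_ne_zero hi0
  have := d.finite_part m
  exact ⟨d.part m, by_contra fun h => hm (hfin.hom_eq_zero hX (d.isLocal m) h _),
    .of_split (d.incl m) (d.proj m) (LinearMap.ext (d.proj_incl m))⟩

theorem exists_isExtendedCore_part (hX : IsExtendedCore hs X)
    (c : LocalDecomposition (ModuleCat.of R R)) : ∃ k, IsExtendedCore hs (c.part k) := by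
  have : Module.Finite R (ModuleCat.of R R) := inferInstanceAs (Module.Finite R R)
  obtain ⟨P, hP, _⟩ := hfin.exists_isExtendedCore_projective hX
  have := hP.isLocal.1
  obtain ⟨y, hy⟩ := exists_ne (0 : P)
  obtain ⟨k, hk⟩ := c.exists_comp_incl_ne_zero (f := LinearMap.toSpanSingleton R P y)
    fun h => hy (by simpa using LinearMap.congr_fun h (1 : R))
  have := c.finite_part k
  exact ⟨k, by_contra fun h => hk (hfin.hom_eq_zero_of_projective hP (c.isLocal k) h _)⟩

theorem injective (hconn : IsConnectedAlg R) (hX : IsExtendedCore hs X) :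
    Module.Injective R R := by
  have := IsArtinianRing.of_finite K R
  have := IsNoetherianRing.of_finite K R
  have : Module.Finite R (ModuleCat.of R R) := inferInstanceAs (Module.Finite R R)
  have : Module.Projective R (ModuleCat.of R R) := inferInstanceAs (Module.Projective R R)
  obtain ⟨c⟩ := nonempty_localDecomposition (ModuleCat.of R R)
  have := c.finite_part
  have : ∀ k, Module.Projective R (c.part k) := fun k =>
    .of_split (c.incl k) (c.proj k) (LinearMap.ext (c.proj_incl k))
  obtain ⟨k, hk⟩ := hfin.exists_isExtendedCore_part hX c
  have hcore : ∀ j, IsExtendedCore hs (c.part j) :=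
    (c.forall_or_forall_not hconn
      (fun _ k hj hk => hfin.hom_eq_zero hj (c.isLocal k) hk)
      (fun j _ hj hk => hfin.hom_eq_zero_of_projective hk (c.isLocal j) hj)).resolve_right
      fun h => h k hk
  refine c.injective fun j => ?_
  obtain ⟨b⟩ := (hcore j).biperfect.nonempty_dualBasis
  exact b.injective hs

end FiniteExtendedCore

theorem IsCMFinite.finiteExtendedCore (hs : IsSymmIdempotent e lam) (hfin : IsCMFinite R) :
    FiniteExtendedCore hs := by
  obtain ⟨S, hS, hS'⟩ := hfin
  obtain ⟨n, F, -, hF⟩ := (hS.subset (Set.sep_subset S (IsExtendedCore hs))).fin_param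
  refine ⟨n, F, fun k => (hF ▸ ⟨k, rfl⟩ : F k ∈ {N ∈ S | IsExtendedCore hs N}).2, fun X hX => ?_⟩
  have := hX.finite
  obtain ⟨N, hN, ⟨φ⟩⟩ := hS' ⟨X, hX.finite, hX.isLocal.indecomposable⟩
    hX.biperfect.isGorensteinProjective
  obtain ⟨k, rfl⟩ : N ∈ Set.range F := hF ▸ ⟨hN, hX.of_iso φ⟩
  exact ⟨k, ⟨φ.toLinearEquiv⟩⟩

theorem projective_of_isCMFinite (hs : IsSymmIdempotent e lam) (hconn : IsConnectedAlg R)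
    (hinj : ¬ Module.Injective R R) (hfin : IsCMFinite R) (M : ModuleCat.{u} R)
    [Module.Finite R M] (hM : IsGorensteinProjInj K M) : Module.Projective R M := by
  have := IsArtinianRing.of_finite K R
  have := IsNoetherianRing.of_finite K R
  obtain ⟨c⟩ := nonempty_localDecomposition M
  refine c.projective fun k => by_contra fun hk => ?_
  have hX : IsCore hs (c.part k) := ⟨c.finite_part k, c.isLocal k, hk,
    (hM.isBiperfect hs).of_retract (c.incl k) (c.proj k) (c.proj_incl k)⟩
  exact hinj ((hfin.finiteExtendedCore hs).injective hconn hX.isExtendedCore)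

end Vanishing

section GendoSymmetric

variable {K : Type u} [Field K] {A : Type u} [Ring A] [Algebra K A] {e : A} {lam : A →ₗ[K] K}

namespace IsSymmPairing

theorem mul_mul_eq (hs : IsSymmPairing e lam) {γ : A →ₗ[K] A →ₗ[K] K}
    (hγ : ∀ a x y, γ (x * (e * a * e)) y = γ x (e * a * e * y)) {x y v w : A}
    (hv : ∀ y, lam (y * v) = γ x y) (hw : ∀ x, lam (w * x) = γ x y) :
    e * y * v * e = e * w * x * e := by
  rw [← sub_eq_zero]
  refine hs.nondeg_right _ (by simp [mul_sub, ← mul_assoc, hs.idem]) fun q => ?_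
  have h1 : lam (e * y * v * e * q) = γ x (e * q * e * y) := by
    rw [← hv, ← hs.lam_mul_e, mul_assoc _ e q, mul_assoc _ (e * q) e, mul_assoc (e * q * e),
      hs.symm, mul_assoc e y, mul_assoc e (y * v), hs.lam_e_mul]
  have h2 : lam (e * w * x * e * q) = γ x (e * q * e * y) := by
    rw [← hγ, ← hw, ← hs.lam_mul_e, ← hs.lam_e_mul (w * _)]
    simp only [mul_assoc]
  rw [sub_mul, map_sub, h1, h2, sub_self]

variable [FiniteDimensional K A] (hs : IsSymmPairing e lam) {γ : A →ₗ[K] A →ₗ[K] K}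
  (hγ : ∀ x y, γ (x * e) (e * y) = γ x y)
include hs hγ

theorem exists_right_mul_eq (x : A) : ∃ v, ∀ y, lam (y * v) = γ x y := by
  obtain ⟨v, hv⟩ := exists_eq_of_forall_apply_eq_zero ((LinearMap.mul K A).compr₂ lam).flip (γ x)
    fun y hy => by
      have h0 : e * y = 0 := hs.nondeg_right _ (by rw [← mul_assoc, hs.idem]) fun w => by
        rw [mul_assoc, hs.lam_e_mul]
        exact hy w
      rw [← hγ, h0, map_zero]
  exact ⟨v, LinearMap.congr_fun hv⟩

theorem exists_left_mul_eq (y : A) : ∃ w, ∀ x, lam (w * x) = γ x y := by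
  obtain ⟨w, hw⟩ := exists_eq_of_forall_apply_eq_zero ((LinearMap.mul K A).compr₂ lam) (γ.flip y)
    fun x hx => by
      have h0 : x * e = 0 := hs.nondeg_left _ (by rw [mul_assoc, hs.idem]) fun w => by
        rw [← mul_assoc, hs.lam_mul_e]
        exact hx w
      rw [LinearMap.flip_apply, ← hγ, h0, map_zero, LinearMap.zero_apply]
  exact ⟨w, LinearMap.congr_fun hw⟩

end IsSymmPairing

theorem eq_zero_of_forall_mul_smul_eq_zero {R : Type*} [Ring R] {e : R}
    (he : ∀ a : R, (∀ y, e * y * a = 0) → a = 0) {M P : Type*} [AddCommGroup M] [Module R M]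
    [AddCommGroup P] [Module R P] [Module.Projective R P] {f : M →ₗ[R] P}
    (hf : Function.Injective f) {m : M} (hm : ∀ y, (e * y) • m = 0) : m = 0 := by
  obtain ⟨s, hs⟩ := Module.projective_def.1 ‹Module.Projective R P›
  have hsm : s (f m) = 0 := Finsupp.ext fun t => he _ fun y => by
    rw [← smul_eq_mul, ← Finsupp.smul_apply, ← map_smul, ← map_smul, hm, map_zero, map_zero,
      Finsupp.zero_apply]
  refine hf (hs.injective ?_)
  rw [hsm, map_zero, map_zero]

theorem exists_mul_eq_of_domDim (hdom : DomDimAtLeast 2 (ModuleCat.of A A))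
    (faithful_left : ∀ a : A, (∀ x, a * x * e = 0) → a = 0)
    (faithful_right : ∀ a : A, (∀ y, e * y * a = 0) → a = 0) {v w : A → A}
    (h : ∀ x y, e * y * v x * e = e * w y * x * e) : ∃ a, ∀ y, e * w y = e * y * a := by
  obtain ⟨I, ι, hι, -, I₁, ι₁, hι₁, hproj, -⟩ := hdom
  let i : A →ₗ[A] (A → A) := LinearMap.pi fun x => LinearMap.toSpanSingleton A A (x * e)
  have i_apply (a x) : i a x = a * x * e := (mul_assoc a x e).symm
  have hi : Function.Injective i := (injective_iff_map_eq_zero i).2 fun a ha =>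
    faithful_left a fun x => by rw [← i_apply, ha]; rfl
  let ι' : A →ₗ[A] I := ι.hom
  obtain ⟨r, hr⟩ := hι.injective.out i hi ι'
  have smul_r (y) : (e * y) • r (fun x => v x * e) = ι' (e * w y) := by
    rw [← hr, ← map_smul]
    congr 1
    funext x
    rw [i_apply, ← h, Pi.smul_apply, smul_eq_mul, ← mul_assoc]
  obtain ⟨a, ha⟩ : r (fun x => v x * e) ∈ LinearMap.range ι' := by
    refine (Submodule.Quotient.mk_eq_zero _).1 (eq_zero_of_forall_mul_smul_eq_zero
      faithful_right hι₁.mono (m := Submodule.Quotient.mk _) fun y => ?_)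
    rw [← Submodule.Quotient.mk_smul, smul_r]
    exact (Submodule.Quotient.mk_eq_zero _).2 ⟨_, rfl⟩
  refine ⟨a, fun y => hι.mono ?_⟩
  change ι' _ = ι' _
  rw [← smul_r, ← ha, ← map_smul, smul_eq_mul]

theorem IsSymmPairing.isSymmIdempotent [FiniteDimensional K A] (hs : IsSymmPairing e lam)
    (hdom : DomDimAtLeast 2 (ModuleCat.of A A)) : IsSymmIdempotent e lam where
  __ := hs
  exists_form γ hγ hγ' := by
    choose v hv using hs.exists_right_mul_eq hγ
    choose w hw using hs.exists_left_mul_eq hγ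
    obtain ⟨a, ha⟩ := exists_mul_eq_of_domDim hdom hs.faithful_left hs.faithful_right
      fun x y => hs.mul_mul_eq hγ' (hv x) (hw y)
    refine ⟨a, fun x y => ?_⟩
    rw [← hw, ← hs.lam_e_mul, ← mul_assoc, ha, mul_assoc, mul_assoc, hs.lam_e_mul, ← mul_assoc]

theorem mem_span_left (he : e * e = e) {x : A} : x ∈ Submodule.span A {e} ↔ x * e = x := by
  rw [Submodule.mem_span_singleton]
  constructor
  · rintro ⟨a, rfl⟩
    rw [smul_eq_mul, mul_assoc, he]
  · exact fun h => ⟨x, h⟩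

theorem mem_span_right (he : e * e = e) {y : A} : y ∈ Submodule.span Aᵐᵒᵖ {e} ↔ e * y = y := by
  rw [Submodule.mem_span_singleton]
  constructor
  · rintro ⟨a, rfl⟩
    rw [MulOpposite.smul_eq_mul_unop, ← mul_assoc, he]
  · exact fun h => ⟨MulOpposite.op y, h⟩

/-- Left multiplication by the idempotent `e`, as a map from `A` onto `eA`. -/
def toSpanRight (he : e * e = e) : A →ₗ[K] Submodule.span Aᵐᵒᵖ {e} where
  toFun y := ⟨e * y, (mem_span_right he).2 (by rw [← mul_assoc, he])⟩
  map_add' x y := Subtype.ext (mul_add e x y)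
  map_smul' k y := Subtype.ext (mul_smul_comm k e y)

theorem BimoduleIsoDual.exists_isSymmPairing (he : e * e = e)
    (hfaith : FaithfulSMul A (Submodule.span A {e})) (h : BimoduleIsoDual K e) :
    ∃ lam : A →ₗ[K] K, IsSymmPairing e lam := by
  obtain ⟨Φ, hΦ, hΦ'⟩ := h
  let L (x : A) (hx : x * e = x) : Submodule.span A {e} := ⟨x, (mem_span_left he).2 hx⟩
  let ρ := toSpanRight (K := K) he
  let lam : A →ₗ[K] K := Φ (L e he) ∘ₗ ρ
  have hρ (y : Submodule.span Aᵐᵒᵖ {e}) : ρ y = y := Subtype.ext ((mem_span_right he).1 y.2)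
  have lam_mul (x : A) (hx : x * e = x) (y) : lam (y * x) = Φ (L x hx) (ρ y) := by
    have h1 : L x hx = x • L e he := Subtype.ext hx.symm
    rw [h1, hΦ]
    exact congrArg (Φ (L e he)) (Subtype.ext (mul_assoc e y x).symm)
  refine ⟨lam, he, fun z => ?_, fun a q => ?_, fun x hx h0 => ?_, fun y hy h0 => ?_,
    fun a ha => ?_⟩
  · rw [lam_mul e he]
    exact congrArg (Φ (L e he)) (Subtype.ext (by simp [ρ, toSpanRight, ← mul_assoc, he]))
  · have hx : e * a * e * e = e * a * e := by rw [mul_assoc, he]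
    rw [lam_mul _ hx]
    refine (hΦ' a (L e he) (L _ hx) (ρ q) (ρ (e * a * e * q)) ?_ ?_).symm
    · simp [L, ← mul_assoc, he]
    · simp only [ρ, toSpanRight, LinearMap.coe_mk, AddHom.coe_mk, ← mul_assoc, he]
      simp only [mul_assoc, he]
  · have : L x hx = 0 := Φ.map_eq_zero_iff.1 (LinearMap.ext fun y => by
      rw [← hρ y, ← lam_mul x hx, h0, LinearMap.zero_apply])
    exact congrArg Subtype.val this
  · have : ρ y = 0 := (Module.forall_dual_apply_eq_zero_iff K _).1 fun f => by
      obtain ⟨x, rfl⟩ := Φ.surjective f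
      rw [← lam_mul x ((mem_span_left he).1 x.2) y, h0]
    exact hy.symm.trans (congrArg Subtype.val this)
  · refine hfaith.eq_of_smul_eq_smul fun x => Subtype.ext ?_
    have := ha x
    rw [mul_assoc, (mem_span_left he).1 x.2] at this
    simpa using this

theorem IsGendoSymmetric.exists_isSymmIdempotent [FiniteDimensional K A]
    (h : IsGendoSymmetric K A) : ∃ (e : A) (lam : A →ₗ[K] K), IsSymmIdempotent e lam := by
  obtain ⟨hdom, e, he, ⟨-, hfaith, -⟩, hbimod⟩ := h
  obtain ⟨lam, hs⟩ := hbimod.exists_isSymmPairing he hfaith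
  exact ⟨e, lam, hs.isSymmIdempotent hdom⟩

end GendoSymmetric

end

end FinDimAlg

theorem mainTheorem2 (K : Type u) [Field K] (A : Type u) [Ring A] [Algebra K A]
    [FiniteDimensional K A] (hconn : FinDimAlg.IsConnectedAlg A)
    (hgendo : FinDimAlg.IsGendoSymmetric K A) (hnsi : ¬ Module.Injective A A) :
    (∀ C : Set (FinDimAlg.IndMod A), FinDimAlg.IsARComponent C →
      (∃ M ∈ C, ¬ Module.Projective A M.1 ∧ FinDimAlg.IsGorensteinProjInj K M.1) →
      ∀ N ∈ C, FinDimAlg.IsGorensteinProjInj K N.1) ∧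
    (∃ S : Set (Set (FinDimAlg.IndMod A)), (∀ C ∈ S, FinDimAlg.IsStableARComponent K C) ∧
      {M : FinDimAlg.IndMod A |
        ¬ Module.Projective A M.1 ∧ FinDimAlg.IsGorensteinProjInj K M.1} = ⋃₀ S) ∧
    (FinDimAlg.IsCMFinite A → ∀ M : ModuleCat.{u} A, Module.Finite A M →
      FinDimAlg.IsGorensteinProjInj K M → Module.Projective A M) := by
  obtain ⟨e, lam, hs⟩ := hgendo.exists_isSymmIdempotent
  exact ⟨fun C hC hM => FinDimAlg.gorensteinProjInj_of_component hs hC hM,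
    FinDimAlg.gorensteinProjInj_eq_sUnion hs,
    fun hfin M _ hM => FinDimAlg.projective_of_isCMFinite hs hconn hnsi hfin M hM⟩
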